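/- **Conventions.** Work on $\mathbb{R}^3$ in Cartesian coordinates. $2$-forms $\omega=(\omega_{ij})$ and $2$-vector fields $\alpha=(\alpha^{ij})$ are antisymmetric, with $\langle\omega,\alpha\rangle=\frac12\sum_{i,j}\omega_{ij}\alpha^{ij}$. Let $d$ be the exterior derivative, $(\delta\alpha)^j=-\sum_i\partial_i\alpha^{ij}$, and $\mathcal L_u\omega=\iota_u d\omega+d\iota_u\omega$. Let $B_2$ be the space of closed $2$-forms and $B^1$ the space of divergence-free vector fields (in the distributional sense where needed), and let $C_c^\infty\cap B_2$ be the smooth compactly supported closed $2$-forms. Let $\|f\|_{\dot H^s}=\big(\int|2\pi\xi|^{2s}|\hat f(\xi)|^2\,d\xi\big)^{1/2}$, for tempered distributions $f$ whose Fourier transform $\hat f$ is a function, and $\|f\|_{H^s}^2=\|f\|_{L^2}^2+\|f\|_{\dot H^s}^2$. Let $\dot W^{1,2}$ have the seminorm $\|\nabla f\|_{L^2}$. On the time interval $[0,1]$ put $$X^{10,2}=C^0([0,1]\to L^2\cap H^{10}\cap B_2)\cap C^1([0,1]\to H^{9}\cap B_2),\qquad Y^{10,2}=C^0([0,1]\to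 \dot W^{1,2}\cap\dot H^{11}\cap B^1).$$ A *vector potential operator* is a linear map $A$ from $C_c^\infty\cap B_2$ to $2$-vector fields on $\mathbb R^3$. It is *$M$-reasonable* if * $A\omega(x)=\int_{\mathbb R^3}K(x,y)\,\omega(y)\,dy$ for a tensor-valued kernel $K$ that is smooth for $x\ne y$ and satisfies $|\nabla_x^i\nabla_y^jK(x,y)|\le C|x-y|^{-i-j-1}$ for all $x\neq y$ and all $0\le i,j\le M$ with $i+j\ge1$; and * $\|\nabla^2A\omega\|_{H^k}\le C\|\omega\|_{H^k}$ for all $0\le k\le M$ and all $\omega\in C_c^\infty\cap B_2$, where $C$ does not depend on $x,y,i,j,k,\omega$. Then $\delta A$ extends continuously to a map from $L^2\cap B_2$ to vector fields in $\dot H^1$, and $\delta A$ denotes this extension. $A$ is *formally self-adjoint* if $\int\langle\omega,A\omega'\rangle\,dx=\int\langle\omega',A\omega\rangle\,dx$ for all $\omega,\omega'\in C_c^\infty\cap B_2$. **Theorem 1.5 (Stable non-self-adjoint blowup).** There exist a $100$-reasonable vector potential operator $A$ on $\mathbb R^3$ that is not formally self-adjoint, and initial data $\omega_0\in C_c^\infty\cap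 B_2$, such that the generalised Euler equations $$\partial_t\omega+\mathcal L_u\omega=0,\qquad u=\delta A\omega,$$ have no solution $\omega\in X^{10,2}$, $u\in Y^{10,2}$ on the time interval $[0,1]$ with $\omega(0)=\omega_0$. Moreover, the blowup is stable: there are $\varepsilon>0$ and $N\in\mathbb N$ such that for every $\omega_1\in C_c^\infty\cap B_2$ that is supported in the $\varepsilon$-neighbourhood of the support of $\omega_0$ and satisfies $|\nabla^n(\omega_1-\omega_0)(x)|<\varepsilon$ for all $x\in\mathbb R^3$ and $0\le n\le N$, there is likewise no solution $\omega\in X^{10,2}$, $u\in Y^{10,2}$ on $[0,1]$ with $\omega(0)=\omega_1$. -/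

import Mathlib

open MeasureTheory Set Filter Topology
open scoped ENNReal NNReal FourierTransform SchwartzMap

noncomputable section

namespace GenEuler

/-! ### Tensors, forms and multivector fields on `ℝ³`, in Cartesian coordinates -/

/-- Euclidean space `ℝ³`. -/
abbrev R3 : Type := EuclideanSpace ℝ (Fin 3)

/-- Tensors of rank two with the Euclidean norm. -/
abbrev Ten2 : Type := EuclideanSpace ℝ (Fin 3 × Fin 3)

/-- Antisymmetric tensors `w_{ij} = - w_{ji}`: the values of `2`-forms (lower indices) and
of `2`-vector fields (upper indices). -/
def Alt2 : Submodule ℝ Ten2 where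
  carrier := {w | ∀ i j, w (i, j) = - w (j, i)}
  add_mem' := by
    intro a b ha hb i j
    have h1 := ha i j
    have h2 := hb i j
    simp only [PiLp.add_apply]
    linarith
  zero_mem' := by intro i j; simp
  smul_mem' := by
    intro c a ha i j
    have h1 := ha i j
    simp only [PiLp.smul_apply, smul_eq_mul]
    rw [h1]; ring

/-- The coordinate function `ω_{ij}`. -/
def comp (ω : R3 → Alt2) (i j : Fin 3) : R3 → ℝ := fun x => (ω x : Ten2) (i, j)

/-- A field of antisymmetric tensors seen as a field of tensors. -/
def tens (ω : R3 → Alt2) : R3 → Ten2 := fun x => (ω x : Ten2)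

/-- The partial derivative `∂_i f`. -/
def pd (i : Fin 3) (f : R3 → ℝ) : R3 → ℝ :=
  fun x => fderiv ℝ f x (EuclideanSpace.single i 1)

/-- The exterior derivative of a `2`-form:
`(dω)_{ijk} = ∂_i ω_{jk} - ∂_j ω_{ik} + ∂_k ω_{ij}`. -/
def extD2 (ω : R3 → Alt2) (x : R3) (i j k : Fin 3) : ℝ :=
  pd i (comp ω j k) x - pd j (comp ω i k) x + pd k (comp ω i j) x

/-- The exterior derivative of a `1`-form: `(dv)_{ij} = ∂_i v_j - ∂_j v_i`. -/
def extD1 (v : Fin 3 → R3 → ℝ) (x : R3) (i j : Fin 3) : ℝ :=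
  pd i (v j) x - pd j (v i) x

/-- The contraction of a `2`-form by a vector field: `(ι_u ω)_j = ∑_k u^k ω_{kj}`. -/
def contract2 (u : R3 → R3) (ω : R3 → Alt2) (j : Fin 3) : R3 → ℝ :=
  fun x => ∑ k, u x k * comp ω k j x

/-- The Lie derivative of a `2`-form, by Cartan's formula `ι_u (dω) + d (ι_u ω)`. -/
def lieD (u : R3 → R3) (ω : R3 → Alt2) (x : R3) (i j : Fin 3) : ℝ :=
  (∑ k, u x k * extD2 ω x k i j) + extD1 (contract2 u ω) x i j

/-- The codifferential of a `2`-vector field: `(δα)^j = - ∑_i ∂_i α^{ij}`. -/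
def codiff (α : R3 → Alt2) : R3 → R3 :=
  fun x => WithLp.toLp 2 (fun j => - ∑ i, pd i (comp α i j) x)

/-- The pairing `⟨ω, α⟩ = 1/2 ω_{ij} α^{ij}` of a `2`-form and a `2`-vector field. -/
def pairing (ω α : R3 → Alt2) (x : R3) : ℝ :=
  1 / 2 * ∑ i, ∑ j, comp ω i j x * comp α i j x

lemma differentiable_comp {ω : R3 → Alt2} (h : ContDiff ℝ (⊤ : ℕ∞) ω) (i j : Fin 3) :
    Differentiable ℝ (comp ω i j) := by
  have h1 : Differentiable ℝ ω := h.differentiable (by simp)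
  have h2 : Differentiable ℝ (fun x => (Alt2.subtypeL (ω x))) :=
    Alt2.subtypeL.differentiable.comp h1
  exact (EuclideanSpace.proj (𝕜 := ℝ) (i, j)).differentiable.comp h2

/-- The space of smooth compactly supported closed `2`-forms on `ℝ³`. -/
def CcB2 : Submodule ℝ (R3 → Alt2) where
  carrier := {ω | ContDiff ℝ (⊤ : ℕ∞) ω ∧ HasCompactSupport ω ∧ ∀ x i j k, extD2 ω x i j k = 0}
  add_mem' := by
    rintro a b ⟨ha, ha', ha''⟩ ⟨hb, hb', hb''⟩
    refine ⟨ha.add hb, ha'.add hb', fun x i j k => ?_⟩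
    have key : ∀ l m n, pd l (comp (a + b) m n) x
        = pd l (comp a m n) x + pd l (comp b m n) x := by
      intro l m n
      have : comp (a + b) m n = comp a m n + comp b m n := by
        funext y; simp [comp]
      simp only [pd, this]
      rw [fderiv_add (differentiable_comp ha m n x) (differentiable_comp hb m n x)]
      rfl
    have h1 := ha'' x i j k
    have h2 := hb'' x i j k
    simp only [extD2] at h1 h2 ⊢
    rw [key, key, key]
    linarith
  zero_mem' := by
    refine ⟨contDiff_const, HasCompactSupport.zero, fun x i j k => ?_⟩
    have : ∀ m n, comp (0 : R3 → Alt2) m n = fun _ => 0 := by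
      intro m n; funext y; simp [comp]
    simp [extD2, pd, this]
  smul_mem' := by
    rintro c a ⟨ha, ha', ha''⟩
    refine ⟨ha.const_smul c, ha'.smul_left (f := fun _ => c), fun x i j k => ?_⟩
    have key : ∀ l m n, pd l (comp (c • a) m n) x = c * pd l (comp a m n) x := by
      intro l m n
      have : comp (c • a) m n = c • comp a m n := by
        funext y; simp [comp]
      simp only [pd, this]
      rw [fderiv_const_smul (differentiable_comp ha m n x)]
      rfl
    have h1 := ha'' x i j k
    simp only [extD2] at h1 ⊢
    rw [key, key, key, ← mul_sub, ← mul_add, h1, mul_zero]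

/-! ### Distributional derivatives -/

/-- Real-valued test functions on `ℝ³`. -/
def IsTest (φ : R3 → ℝ) : Prop := ContDiff ℝ (⊤ : ℕ∞) φ ∧ HasCompactSupport φ

/-- `g` is the distributional partial derivative `∂_i f`. -/
def IsWeakPartial (i : Fin 3) (f g : R3 → ℝ) : Prop :=
  LocallyIntegrable f ∧ LocallyIntegrable g ∧
    ∀ φ, IsTest φ → ∫ x, f x * pd i φ x = - ∫ x, g x * φ x

/-- `G` is the distributional second derivative `∇² α`, with the components
`G_{((i,j),(a,b))} = ∂_i ∂_j α^{ab}`. -/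
def IsWeakHessian (α : R3 → Alt2)
    (G : R3 → EuclideanSpace ℝ ((Fin 3 × Fin 3) × (Fin 3 × Fin 3))) : Prop :=
  ∀ i j a b, LocallyIntegrable (comp α a b) ∧ LocallyIntegrable (fun x => G x ((i, j), (a, b))) ∧
    ∀ φ, IsTest φ →
      ∫ x, comp α a b x * pd i (pd j φ) x = ∫ x, G x ((i, j), (a, b)) * φ x

/-- `dω = 0` in the sense of distributions. -/
def WeakClosed (ω : R3 → Alt2) : Prop :=
  ∀ φ, IsTest φ → ∀ i j k,
    ∫ x, (comp ω j k x * pd i φ x - comp ω i k x * pd j φ x + comp ω i j x * pd k φ x) = 0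

/-- `δu = 0` (that is, `div u = 0`) in the sense of distributions. -/
def WeakDivFree (u : R3 → R3) : Prop :=
  ∀ φ, IsTest φ → ∫ x, ∑ i, u x i * pd i φ x = 0

/-! ### Function spaces -/

/-- The tempered distribution given by the function `f` has a Fourier transform that is given by
the function `g` (normalised as `∫ f(x) exp(-2πi x·ξ) dx`). -/
def IsFourier (f : R3 → ℝ) (g : R3 → ℂ) : Prop :=
  ∀ φ : 𝓢(R3, ℂ),
    Integrable (fun x => (f x : ℂ) * (𝓕 φ) x) ∧ Integrable (fun ξ => g ξ * φ ξ) ∧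
      ∫ x, (f x : ℂ) * (𝓕 φ) x = ∫ ξ, g ξ * φ ξ

/-- The homogeneous Sobolev norm `‖f‖_{Ḣ^s} = (∫ |2πξ|^{2s} |f̂(ξ)|² dξ)^{1/2}`, the Fourier
transform being taken componentwise. The function `f̂` is unique almost everywhere if it exists,
so the infimum is over equal numbers; it is `∞` if `f̂` is not a function. -/
def homNorm {ι : Type} [Fintype ι] (s : ℕ) (f : R3 → EuclideanSpace ℝ ι) : ℝ≥0∞ :=
  ⨅ (g : R3 → EuclideanSpace ℂ ι)
    (_ : ∀ i, IsFourier (fun x => f x i) (fun ξ => g ξ i)),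
    eLpNorm (fun ξ => (((2 * Real.pi * ‖ξ‖) ^ s : ℝ) : ℂ) • g ξ) 2 volume

/-- The Sobolev norm `‖f‖_{H^s} = (‖f‖_{L²}² + ‖f‖_{Ḣ^s}²)^{1/2}`. -/
def sobNorm {ι : Type} [Fintype ι] (s : ℕ) (f : R3 → EuclideanSpace ℝ ι) : ℝ≥0∞ :=
  (eLpNorm f 2 volume ^ 2 + homNorm s f ^ 2) ^ (1 / 2 : ℝ)

/-- The seminorm `‖∇u‖_{L^p}` of `Ẇ^{1,p}`, with the distributional gradient (unique almost
everywhere if it exists); it is `∞` if there is no such gradient. -/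
def gradNorm (p : ℝ≥0∞) (u : R3 → R3) : ℝ≥0∞ :=
  ⨅ (G : R3 → Ten2)
    (_ : ∀ i j, IsWeakPartial i (fun x => u x j) (fun x => G x (i, j))),
    eLpNorm G p volume

/-- `f` is a continuous map from `[0,T]` to the space given by the extended (semi)norm `N`. -/
def ContInto {F : Type} [AddCommGroup F] (N : F → ℝ≥0∞) (T : ℝ) (f : ℝ → F) : Prop :=
  ∀ t ∈ Icc 0 T, N (f t) < ∞ ∧ Tendsto (fun τ => N (f τ - f t)) (𝓝[Icc 0 T] t) (𝓝 0)

/-- `f'` is the time derivative of `f` on `[0,T]` with respect to the extended norm `N`. -/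
def DerivInto {F : Type} [AddCommGroup F] [Module ℝ F] (N : F → ℝ≥0∞) (T : ℝ)
    (f f' : ℝ → F) : Prop :=
  ∀ t ∈ Icc 0 T,
    Tendsto (fun τ => N ((τ - t)⁻¹ • (f τ - f t) - f' t)) (𝓝[Icc 0 T \ {t}] t) (𝓝 0)

/-- The space
`X^{s,p} = C⁰([0,T] → L^p ∩ H^s ∩ B_2) ∩ C¹([0,T] → H^{s-1} ∩ B_2)`. -/
structure MemX (s : ℕ) (p : ℝ≥0∞) (T : ℝ) (ω : ℝ → R3 → Alt2) : Prop where
  contLp : ContInto (fun f : R3 → Ten2 => eLpNorm f p volume) T (fun t => tens (ω t))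
  memLp : ∀ t ∈ Icc 0 T, MemLp (tens (ω t)) p volume
  contSob : ContInto (fun f : R3 → Ten2 => sobNorm s f) T (fun t => tens (ω t))
  closed : ∀ t ∈ Icc 0 T, WeakClosed (ω t)
  deriv : ∃ ω' : ℝ → R3 → Alt2,
    ContInto (fun f : R3 → Ten2 => sobNorm (s - 1) f) T (fun t => tens (ω' t)) ∧
    (∀ t ∈ Icc 0 T, WeakClosed (ω' t)) ∧
    DerivInto (fun f : R3 → Ten2 => sobNorm (s - 1) f) T
      (fun t => tens (ω t)) (fun t => tens (ω' t))

/-- The space `Y^{s,p} = C⁰([0,T] → Ẇ^{1,p} ∩ Ḣ^{s+1} ∩ B¹)`. -/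
structure MemY (s : ℕ) (p : ℝ≥0∞) (T : ℝ) (u : ℝ → R3 → R3) : Prop where
  contGrad : ContInto (gradNorm p) T u
  contHom : ContInto (fun f : R3 → R3 => homNorm (s + 1) f) T u
  divFree : ∀ t ∈ Icc 0 T, WeakDivFree (u t)

/-! ### Vector potential operators and the generalised Euler equations -/

/-- Vector potential operators: linear maps from smooth compactly supported closed `2`-forms to
`2`-vector fields. -/
abbrev VectorPotentialOp : Type := CcB2 →ₗ[ℝ] (R3 → Alt2)

/-- `M`-reasonable vector potential operators on `ℝ³`. The bound on the kernel is
`|x-y|^{-i-j-d+2}` with `d = 3`. -/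
def IsReasonable (M : ℕ) (A : VectorPotentialOp) : Prop :=
  (∃ K : R3 → R3 → (Alt2 →L[ℝ] Alt2),
    (∀ (ω : CcB2) (x : R3), Integrable (fun y => K x y (ω.1 y)) ∧
      A ω x = ∫ y, K x y (ω.1 y)) ∧
    ContDiffOn ℝ (⊤ : ℕ∞) (fun q : R3 × R3 => K q.1 q.2) {q | q.1 ≠ q.2} ∧
    ∃ C : ℝ, ∀ i j : ℕ, i ≤ M → j ≤ M → 1 ≤ i + j → ∀ x y : R3, x ≠ y →
      ‖iteratedFDeriv ℝ i (fun x' => iteratedFDeriv ℝ j (fun y' => K x' y') y) x‖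
        ≤ C / ‖x - y‖ ^ (i + j + 1)) ∧
  (∃ C : ℝ≥0, ∀ k ≤ M, ∀ ω : CcB2, ∃ G, IsWeakHessian (A ω) G ∧
    sobNorm k G ≤ C * sobNorm k (tens ω.1))

/-- Formal self-adjointness: `∫ ⟨ω, A ω'⟩ = ∫ ⟨ω', A ω⟩`. -/
def FormallySelfAdjoint (A : VectorPotentialOp) : Prop :=
  ∀ ω ω' : CcB2, ∫ x, pairing ω.1 (A ω') x = ∫ x, pairing ω'.1 (A ω) x

/-- `v = δ A w` for the continuous extension of `δ A` from smooth compactly supported closed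
`2`-forms to a map from `L² ∩ B_2` to `Ḣ¹`. -/
def IsCodiffOf (A : VectorPotentialOp) (w : R3 → Alt2) (v : R3 → R3) : Prop :=
  ∃ a : ℕ → CcB2,
    Tendsto (fun n => eLpNorm (tens (a n).1 - tens w) 2 volume) atTop (𝓝 0) ∧
    Tendsto (fun n => homNorm 1 (codiff (A (a n)) - v)) atTop (𝓝 0)

/-- `ω ∈ X^{s,p}`, `u ∈ Y^{s,p}` is a classical solution on `[0,T]` of the generalised Euler
equations `∂_t ω + L_u ω = 0`, `u = δ A ω` with initial data `ω₀`. Elements of the function spaces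
are given by their continuous representatives. -/
structure IsSolution (A : VectorPotentialOp) (s : ℕ) (p : ℝ≥0∞) (T : ℝ) (ω₀ : R3 → Alt2)
    (ω : ℝ → R3 → Alt2) (u : ℝ → R3 → R3) : Prop where
  memX : MemX s p T ω
  memY : MemY s p T u
  cont_ω : ∀ t ∈ Icc 0 T, Continuous (ω t)
  cont_u : ∀ t ∈ Icc 0 T, Continuous (u t)
  vorticity_eq : ∀ t ∈ Icc 0 T, ∀ x i j,
    HasDerivWithinAt (fun τ => comp (ω τ) i j x) (- lieD (u t) (ω t) x i j) (Icc 0 T) t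
  velocity_eq : ∀ t ∈ Icc 0 T, IsCodiffOf A (ω t) (u t)
  initial : ω 0 = ω₀

end GenEuler

end

open GenEuler

/-!
The operator is built so that the equations contain a dyadic cascade that can be followed by hand.
Put `r_k = 64⁻⁽ᵏ⁺¹⁾`. At each scale there is a *stream*, the profile `stream (x / r_k)`, whose
codifferential is a divergence-free planar velocity with a jet along the positive `x₀` axis, and a
*sensor* `sensor (y / r_k)`, which reads the component `ω₀₂` in the layer `3 r_k < x₂ < 4 r_k`;
`potentialOp ω = ∑ₖ r_k⁻¹ ⟨sensor_k, ω₀₂⟩ stream_k e₀₁`. The kernel is a sum of products at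
dyadic scales, so it satisfies the pointwise bounds (`kernel_spec`). The sensor is an axial
derivative of order `100`, so up to `100` derivatives can be moved to `ω`, and Bessel's
inequality for sensors in almost disjoint layers gives the Sobolev bounds (`sobolev_spec`).
No stream meets the layer of the sensor at the scale `0`, so forms in this layer are read but feel
no stream, and the operator is not self-adjoint (`not_formallySelfAdjoint`).

A solution in the given classes is `C¹` in space (`IsSolution.regularFamily`) and its velocity is
the sum of the streams with coefficients `mode ω k t` (`IsCodiffOf.eq_velPart`). In the layer
`slab J`, which contains the sensor at the scale `J`, only the streams at larger scales act, and
they do not depend on the height there. So `ω₀₁` is transported (`SlabFlow.transport`), its vertical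
derivative stays as small as it is initially, and, as `ω` is closed, the potential
`axialPot ω = ∫₀^{x₀} ω₀₂` is almost conserved along trajectories (`SlabFlow.abs_axialPot_sub_le`).
Integration by parts shows that the mode `J` is the average of this potential over the sensor
(`mode_mem_Icc`): for `x₀ > 0` the sensor decreases along the axis, with a bump as its slope, and
its part in `x₀ ≤ 0`, where the vorticity vanishes, reads nothing.

The initial form is `d(θ dx₂)` for a cut-off function `θ`, whose potential is `θ` itself. Traced
backwards, a point of the sensor at the scale `J` is carried outwards through the scales
`J - 1, …, 0`, spending a time `2 r_k` at the scale `k`, while the transverse coordinate grows by at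
most `e⁴ < 64` per stage (`BackFlow.stage`), and it ends where `θ = 1` (`BackFlow.trace`). Hence
every mode `J` is at least `0.9` at the time `stageTime J ≤ 1` (`cascade`). But a reading of bounded
vorticity by the sensor at the scale `J` gives a mode of size `O(r_J)`, a contradiction. All
estimates have slack, so the argument also applies to data near the initial form that vanish for
`x₀ ≤ 0`.
-/

noncomputable section

namespace GenEuler

/-! ### Scales and profiles -/

/-- The scales `r_k = 64^{-(k+1)}` at which the operator acts. -/
def scale (k : ℕ) : ℝ := (1 / 64) ^ (k + 1)

lemma scale_pos (k : ℕ) : 0 < scale k := by unfold scale; positivity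

lemma scale_succ (k : ℕ) : scale (k + 1) = scale k / 64 := by
  unfold scale; ring

lemma scale_anti {i j : ℕ} (h : i ≤ j) : scale j ≤ scale i := by
  unfold scale
  exact pow_le_pow_of_le_one (by norm_num) (by norm_num) (by omega)

lemma scale_le_div {i j : ℕ} (h : i < j) : scale j ≤ scale i / 64 := by
  rw [← scale_succ]; exact scale_anti h

lemma scale_le_one (k : ℕ) : scale k ≤ 1 := by
  unfold scale; exact pow_le_one₀ (by norm_num) (by norm_num)

lemma tendsto_scale : Tendsto scale atTop (𝓝 0) := by
  unfold scale
  exact (tendsto_pow_atTop_nhds_zero_of_lt_one (by norm_num) (by norm_num)).comp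
    (tendsto_add_atTop_nat 1)

/-- The axial profile: it is `1` on `[1/64, 8]` and vanishes off `[1/128, 16]`, so that the
profiles `gProf (x / scale k)` of neighbouring scales overlap where both are `1`. -/
def gProf (x : ℝ) : ℝ :=
  Real.smoothTransition ((x - 1 / 128) * 128) * Real.smoothTransition ((16 - x) / 8)

lemma contDiff_gProf : ContDiff ℝ (⊤ : ℕ∞) gProf := by
  unfold gProf
  exact (Real.smoothTransition.contDiff.comp (by fun_prop)).mul
    (Real.smoothTransition.contDiff.comp (by fun_prop))

lemma gProf_nonneg (x : ℝ) : 0 ≤ gProf x :=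
  mul_nonneg (Real.smoothTransition.nonneg _) (Real.smoothTransition.nonneg _)

lemma gProf_le_one (x : ℝ) : gProf x ≤ 1 :=
  mul_le_one₀ (Real.smoothTransition.le_one _) (Real.smoothTransition.nonneg _)
    (Real.smoothTransition.le_one _)

lemma gProf_eq_one {x : ℝ} (h1 : 1 / 64 ≤ x) (h2 : x ≤ 8) : gProf x = 1 := by
  unfold gProf
  rw [Real.smoothTransition.one_of_one_le (by linarith),
    Real.smoothTransition.one_of_one_le (by linarith), one_mul]

lemma gProf_eq_zero_left {x : ℝ} (h : x ≤ 1 / 128) : gProf x = 0 := by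
  unfold gProf; rw [Real.smoothTransition.zero_of_nonpos (by linarith), zero_mul]

lemma gProf_eq_zero_right {x : ℝ} (h : 16 ≤ x) : gProf x = 0 := by
  unfold gProf
  rw [Real.smoothTransition.zero_of_nonpos (x := (16 - x) / 8) (by linarith), mul_zero]

lemma gProf_ne_zero {x : ℝ} (h : gProf x ≠ 0) : 1 / 128 < x ∧ x < 16 := by
  constructor
  · by_contra h'; exact h (gProf_eq_zero_left (by linarith))
  · by_contra h'; exact h (gProf_eq_zero_right (by linarith))

lemma deriv_gProf_eq_zero {x : ℝ} (h1 : 1 / 64 ≤ x) (h2 : x ≤ 8) : deriv gProf x = 0 := by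
  apply IsLocalMax.deriv_eq_zero
  filter_upwards with y
  rw [gProf_eq_one h1 h2]; exact gProf_le_one y

lemma deriv_gProf_nonneg {x : ℝ} (h : x < 8) : 0 ≤ deriv gProf x := by
  have : gProf =ᶠ[𝓝 x] fun y => Real.smoothTransition ((y - 1 / 128) * 128) := by
    filter_upwards [Iio_mem_nhds h] with y hy
    have hy' : y < 8 := hy
    unfold gProf
    rw [Real.smoothTransition.one_of_one_le (x := (16 - y) / 8) (by linarith), mul_one]
  rw [this.deriv_eq]
  apply Monotone.deriv_nonneg
  intro a b hab
  exact Real.smoothTransition.monotone (by linarith)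

lemma deriv_gProf_nonpos {x : ℝ} (h : 1 / 64 < x) : deriv gProf x ≤ 0 := by
  have : gProf =ᶠ[𝓝 x] fun y => Real.smoothTransition ((16 - y) / 8) := by
    filter_upwards [Ioi_mem_nhds h] with y hy
    have hy' : 1 / 64 < y := hy
    unfold gProf
    rw [Real.smoothTransition.one_of_one_le (x := (y - 1 / 128) * 128) (by linarith), one_mul]
  rw [this.deriv_eq]
  apply Antitone.deriv_nonpos
  intro a b hab
  exact Real.smoothTransition.monotone (by linarith)

lemma deriv_gProf_ne_zero {x : ℝ} (h : deriv gProf x ≠ 0) : 1 / 128 ≤ x ∧ x ≤ 16 := by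
  constructor
  · by_contra! h'
    apply h
    have : gProf =ᶠ[𝓝 x] fun _ => 0 := by
      filter_upwards [Iio_mem_nhds h'] with y hy
      exact gProf_eq_zero_left (le_of_lt hy)
    rw [this.deriv_eq]; simp
  · by_contra! h'
    apply h
    have : gProf =ᶠ[𝓝 x] fun _ => 0 := by
      filter_upwards [Ioi_mem_nhds h'] with y hy
      exact gProf_eq_zero_right (le_of_lt hy)
    rw [this.deriv_eq]; simp

/-- A smooth bump on the line: `1` on the closed interval of radius `r` about `c`, and `0` off the
open interval of radius `R`. -/
def lineBump (c r R : ℝ) (hr : 0 < r) (hR : r < R) : ContDiffBump c := ⟨r, R, hr, hR⟩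

lemma lineBump_eq_one {c r R : ℝ} (hr : 0 < r) (hR : r < R) {x : ℝ} (h1 : c - r ≤ x)
    (h2 : x ≤ c + r) : lineBump c r R hr hR x = 1 := by
  apply ContDiffBump.one_of_mem_closedBall
  rw [Metric.mem_closedBall, Real.dist_eq, abs_le]
  exact ⟨by simp only [lineBump]; linarith, by simp only [lineBump]; linarith⟩

lemma lineBump_ne_zero {c r R : ℝ} (hr : 0 < r) (hR : r < R) {x : ℝ}
    (h : lineBump c r R hr hR x ≠ 0) : c - R < x ∧ x < c + R := by
  have : x ∈ Function.support (lineBump c r R hr hR) := h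
  rw [ContDiffBump.support_eq, Metric.mem_ball, Real.dist_eq, abs_lt] at this
  simp only [lineBump] at this
  constructor <;> linarith

/-- The transversal profile: linear on `[-64, 64]`, so that the flow is linear in the transversal
variable there, and supported in `[-128, 128]`. -/
def qProf (y : ℝ) : ℝ := y * lineBump 0 64 128 (by norm_num) (by norm_num) y

/-- The vertical cutoff. -/
def chiProf : ℝ → ℝ := lineBump 0 1 2 (by norm_num) (by norm_num)

lemma contDiff_qProf : ContDiff ℝ (⊤ : ℕ∞) qProf :=
  contDiff_id.mul (ContDiffBump.contDiff _)

lemma contDiff_chiProf : ContDiff ℝ (⊤ : ℕ∞) chiProf := ContDiffBump.contDiff _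

lemma qProf_eq {y : ℝ} (h : |y| ≤ 64) : qProf y = y := by
  rw [abs_le] at h
  unfold qProf
  rw [lineBump_eq_one _ _ (by linarith) (by linarith), mul_one]

lemma deriv_qProf_eq {y : ℝ} (h : |y| < 64) : deriv qProf y = 1 := by
  have : qProf =ᶠ[𝓝 y] fun y => y := by
    have : ∀ᶠ z in 𝓝 y, |z| < 64 := (continuous_abs.tendsto y).eventually (gt_mem_nhds h)
    filter_upwards [this] with z hz using qProf_eq hz.le
  rw [this.deriv_eq]; simp

lemma qProf_ne_zero {y : ℝ} (h : qProf y ≠ 0) : -128 < y ∧ y < 128 := by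
  have := lineBump_ne_zero _ _ (right_ne_zero_of_mul h)
  constructor <;> linarith

lemma chiProf_eq_one {z : ℝ} (h : |z| ≤ 1) : chiProf z = 1 := by
  rw [abs_le] at h
  exact lineBump_eq_one _ _ (by linarith) (by linarith)

lemma chiProf_ne_zero {z : ℝ} (h : chiProf z ≠ 0) : -2 < z ∧ z < 2 := by
  have := lineBump_ne_zero _ _ h
  constructor <;> linarith

/-! ### Test functions of product form -/

lemma norm_le_of_abs_le {x : R3} {C : ℝ} (h : ∀ i, |x i| ≤ C) : ‖x‖ ≤ 2 * C := by
  have hC : 0 ≤ C := (abs_nonneg _).trans (h 0)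
  rw [EuclideanSpace.norm_eq, Real.sqrt_le_left (by positivity), Fin.sum_univ_three]
  have : ∀ i, ‖x i‖ ^ 2 ≤ C ^ 2 := fun i => by
    rw [Real.norm_eq_abs]; gcongr; exact h i
  nlinarith [this 0, this 1, this 2]

lemma abs_coord_le (x : R3) (i : Fin 3) : |x i| ≤ ‖x‖ := by
  have := PiLp.norm_apply_le x i
  simpa using this

lemma isTest_of_box {f : R3 → ℝ} (hf : ContDiff ℝ (⊤ : ℕ∞) f) {C : ℝ}
    (h : ∀ x, f x ≠ 0 → ∀ i, |x i| ≤ C) : IsTest f := by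
  refine ⟨hf, HasCompactSupport.intro (isCompact_closedBall (0 : R3) (2 * C)) ?_⟩
  intro x hx
  by_contra h'
  exact hx (by simpa using norm_le_of_abs_le (h x h'))

/-- The product of three functions of the coordinates. -/
def prod3 (f g h : ℝ → ℝ) (x : R3) : ℝ := f (x 0) * g (x 1) * h (x 2)

lemma contDiff_coord (i : Fin 3) : ContDiff ℝ (⊤ : ℕ∞) (fun x : R3 => x i) :=
  (EuclideanSpace.proj (𝕜 := ℝ) i).contDiff

lemma contDiff_prod3 {f g h : ℝ → ℝ} (hf : ContDiff ℝ (⊤ : ℕ∞) f) (hg : ContDiff ℝ (⊤ : ℕ∞) g)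
    (hh : ContDiff ℝ (⊤ : ℕ∞) h) : ContDiff ℝ (⊤ : ℕ∞) (prod3 f g h) :=
  ((hf.comp (contDiff_coord 0)).mul (hg.comp (contDiff_coord 1))).mul
    (hh.comp (contDiff_coord 2))

lemma hasFDerivAt_coord (i : Fin 3) (x : R3) :
    HasFDerivAt (fun x : R3 => x i) (EuclideanSpace.proj (𝕜 := ℝ) i : R3 →L[ℝ] ℝ) x :=
  (EuclideanSpace.proj (𝕜 := ℝ) i : R3 →L[ℝ] ℝ).hasFDerivAt

lemma pd_prod3 {f g h : ℝ → ℝ} (hf : Differentiable ℝ f) (hg : Differentiable ℝ g)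
    (hh : Differentiable ℝ h) :
    pd 0 (prod3 f g h) = prod3 (deriv f) g h ∧ pd 1 (prod3 f g h) = prod3 f (deriv g) h ∧
      pd 2 (prod3 f g h) = prod3 f g (deriv h) := by
  have key : ∀ x : R3, HasFDerivAt (prod3 f g h) _ x := fun x =>
    (((hf (x 0)).hasDerivAt.comp_hasFDerivAt x (hasFDerivAt_coord 0 x)).mul
      ((hg (x 1)).hasDerivAt.comp_hasFDerivAt x (hasFDerivAt_coord 1 x))).mul
      ((hh (x 2)).hasDerivAt.comp_hasFDerivAt x (hasFDerivAt_coord 2 x))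
  refine ⟨?_, ?_, ?_⟩ <;> funext x <;> simp [pd, (key x).fderiv, prod3] <;> ring

/-! ### Calculus of test functions and dilations -/

namespace IsTest
variable {f h : R3 → ℝ}

lemma continuous (hf : IsTest f) : Continuous f := hf.1.continuous
lemma differentiable (hf : IsTest f) : Differentiable ℝ f := hf.1.differentiable (by simp)
lemma integrable (hf : IsTest f) : Integrable f := hf.continuous.integrable_of_hasCompactSupport hf.2

lemma pd (hf : IsTest f) (i : Fin 3) : IsTest (pd i f) :=
  ⟨(hf.1.fderiv_right (by simp)).clm_apply contDiff_const, hf.2.fderiv_apply (𝕜 := ℝ) _⟩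

lemma pd_iterate (hf : IsTest f) (i : Fin 3) (n : ℕ) : IsTest ((GenEuler.pd i)^[n] f) := by
  induction n with
  | zero => exact hf
  | succ n ih => rw [Function.iterate_succ_apply']; exact ih.pd i

lemma add (hf : IsTest f) (hh : IsTest h) : IsTest (fun x => f x + h x) :=
  ⟨hf.1.add hh.1, hf.2.add hh.2⟩

lemma const_mul (hf : IsTest f) (c : ℝ) : IsTest (fun x => c * f x) :=
  ⟨contDiff_const.mul hf.1, hf.2.mul_left⟩

lemma mul (hf : IsTest f) (hh : ContDiff ℝ (⊤ : ℕ∞) h) : IsTest (fun x => f x * h x) :=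
  ⟨hf.1.mul hh, hf.2.mul_right⟩

lemma zero : IsTest (fun _ : R3 => (0 : ℝ)) := ⟨contDiff_const, HasCompactSupport.zero⟩

lemma sum {ι : Type*} {s : Finset ι} {F : ι → R3 → ℝ} (hF : ∀ k ∈ s, IsTest (F k)) :
    IsTest (fun x => ∑ k ∈ s, F k x) := by
  classical
  induction s using Finset.induction_on with
  | empty => simpa using zero
  | insert a s ha ih =>
    simp only [Finset.sum_insert ha]
    exact (hF a (by simp)).add (ih fun k hk => hF k (by simp [hk]))

lemma exists_bound (hf : IsTest f) : ∃ C, 0 ≤ C ∧ ∀ x, |f x| ≤ C := by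
  obtain ⟨C, hC⟩ := hf.continuous.bounded_above_of_compact_support hf.2
  exact ⟨C, (norm_nonneg _).trans (hC 0), hC⟩

end IsTest

lemma integral_mul_pd {f φ : R3 → ℝ} (hf : Differentiable ℝ f) (hf' : ∀ i, Continuous (pd i f))
    (hφ : IsTest φ) (i : Fin 3) : ∫ x, f x * pd i φ x = - ∫ x, pd i f x * φ x := by
  apply integral_mul_fderiv_eq_neg_fderiv_mul_of_integrable
  · exact ((hf' i).mul hφ.continuous).integrable_of_hasCompactSupport hφ.2.mul_left
  · exact (hf.continuous.mul (hφ.pd i).continuous).integrable_of_hasCompactSupport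
      (hφ.pd i).2.mul_left
  · exact (hf.continuous.mul hφ.continuous).integrable_of_hasCompactSupport hφ.2.mul_left
  · exact fun x _ => hf x
  · exact fun x _ => hφ.differentiable x

lemma IsTest.integral_mul_pd {f φ : R3 → ℝ} (hf : IsTest f) (hφ : IsTest φ) (i : Fin 3) :
    ∫ x, f x * GenEuler.pd i φ x = - ∫ x, GenEuler.pd i f x * φ x :=
  GenEuler.integral_mul_pd hf.differentiable (fun i => (hf.pd i).continuous) hφ i

lemma IsTest.integral_iterate_pd_mul {f φ : R3 → ℝ} (hf : IsTest f) (hφ : IsTest φ) (i : Fin 3)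
    (n : ℕ) : ∫ x, (GenEuler.pd i)^[n] f x * φ x
      = (-1) ^ n * ∫ x, f x * (GenEuler.pd i)^[n] φ x := by
  induction n generalizing φ with
  | zero => simp
  | succ n ih =>
    rw [Function.iterate_succ_apply', Function.iterate_succ_apply, pow_succ, mul_neg_one, neg_mul,
      ← ih (hφ.pd i), (hf.pd_iterate i n).integral_mul_pd hφ, neg_neg]

/-- The dilation `x ↦ f (x / r)`. -/
def dil (r : ℝ) (f : R3 → ℝ) (x : R3) : ℝ := f (r⁻¹ • x)

lemma dil_apply (r : ℝ) (f : R3 → ℝ) (x : R3) : dil r f x = f (r⁻¹ • x) := rfl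

lemma contDiff_dil {f : R3 → ℝ} (hf : ContDiff ℝ (⊤ : ℕ∞) f) (r : ℝ) :
    ContDiff ℝ (⊤ : ℕ∞) (dil r f) := hf.comp (contDiff_const_smul _)

lemma IsTest.dil {f : R3 → ℝ} (hf : IsTest f) {r : ℝ} (hr : 0 < r) : IsTest (dil r f) :=
  ⟨contDiff_dil hf.1 r, hf.2.comp_smul (inv_pos.2 hr).ne'⟩

lemma pd_dil {f : R3 → ℝ} (hf : Differentiable ℝ f) (r : ℝ) (i : Fin 3) (x : R3) :
    pd i (dil r f) x = r⁻¹ * dil r (pd i f) x := by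
  have h1 : HasFDerivAt (fun x : R3 => r⁻¹ • x) (r⁻¹ • ContinuousLinearMap.id ℝ R3) x :=
    (r⁻¹ • ContinuousLinearMap.id ℝ R3).hasFDerivAt
  have h2 := (hf (r⁻¹ • x)).hasFDerivAt.comp x h1
  have h3 : fderiv ℝ (dil r f) x = _ := h2.fderiv
  simp [pd, h3, dil]

lemma iterate_pd_dil {f : R3 → ℝ} (hf : IsTest f) (r : ℝ) (i : Fin 3) (n : ℕ) (x : R3) :
    (pd i)^[n] (dil r f) x = r⁻¹ ^ n * dil r ((pd i)^[n] f) x := by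
  induction n generalizing x with
  | zero => simp
  | succ n ih =>
    have h1 : (pd i)^[n] (dil r f) = fun y => r⁻¹ ^ n * dil r ((pd i)^[n] f) y := funext ih
    have h2 : Differentiable ℝ (dil r ((pd i)^[n] f)) :=
      (contDiff_dil (hf.pd_iterate i n).1 r).differentiable (by simp)
    rw [Function.iterate_succ_apply', h1, Function.iterate_succ_apply']
    have h3 : pd i (fun y => r⁻¹ ^ n * dil r ((pd i)^[n] f) y) x
        = r⁻¹ ^ n * pd i (dil r ((pd i)^[n] f)) x := by
      simp only [pd]
      rw [fderiv_const_mul (h2 x)]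
      simp
    rw [h3, pd_dil (hf.pd_iterate i n).differentiable]
    ring

lemma integral_dil {r : ℝ} (hr : 0 < r) (f : R3 → ℝ) : ∫ x, dil r f x = r ^ 3 * ∫ x, f x := by
  have := Measure.integral_comp_smul (volume : Measure R3) f r⁻¹
  simp only [dil]
  rw [this, finrank_euclideanSpace_fin, abs_of_pos (by positivity), smul_eq_mul, inv_pow, inv_inv]

/-! ### The stream function and the sensor -/

/-- The stream function `a = - g(x₀) q(x₁) χ(x₂)` of the basic velocity field. -/
def stream : R3 → ℝ := fun x => -prod3 gProf qProf chiProf x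

lemma stream_ne_zero {x : R3} (h : stream x ≠ 0) :
    (1 / 128 < x 0 ∧ x 0 < 16) ∧ (-128 < x 1 ∧ x 1 < 128) ∧ (-2 < x 2 ∧ x 2 < 2) := by
  have h' : gProf (x 0) * qProf (x 1) * chiProf (x 2) ≠ 0 := by
    simpa [stream, prod3] using h
  exact ⟨gProf_ne_zero (left_ne_zero_of_mul (left_ne_zero_of_mul h')),
    qProf_ne_zero (right_ne_zero_of_mul (left_ne_zero_of_mul h')),
    chiProf_ne_zero (right_ne_zero_of_mul h')⟩

lemma isTest_stream : IsTest stream := by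
  refine isTest_of_box (C := 128)
    (contDiff_prod3 contDiff_gProf contDiff_qProf contDiff_chiProf).neg ?_
  intro x hx i
  obtain ⟨⟨h1, h2⟩, ⟨h3, h4⟩, h5, h6⟩ := stream_ne_zero hx
  rw [abs_le]
  fin_cases i <;> constructor <;> simp <;> linarith

/-- The closed box that contains the support of the stream function. -/
def streamBox : Set R3 := {x | (1 / 128 ≤ x 0 ∧ x 0 ≤ 16) ∧ |x 1| ≤ 128 ∧ |x 2| ≤ 2}

lemma isClosed_streamBox : IsClosed streamBox := by
  have h : ∀ i : Fin 3, Continuous fun x : R3 => x i := fun i => (contDiff_coord i).continuous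
  refine ((isClosed_le continuous_const (h 0)).inter (isClosed_le (h 0) continuous_const)).inter
    ((isClosed_le (continuous_abs.comp (h 1)) continuous_const).inter
      (isClosed_le (continuous_abs.comp (h 2)) continuous_const))

lemma tsupport_stream_subset : tsupport stream ⊆ streamBox := by
  refine closure_minimal ?_ isClosed_streamBox
  intro x hx
  obtain ⟨⟨h1, h2⟩, ⟨h3, h4⟩, h5, h6⟩ := stream_ne_zero hx
  exact ⟨⟨h1.le, h2.le⟩, abs_le.2 ⟨h3.le, h4.le⟩, abs_le.2 ⟨h5.le, h6.le⟩⟩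

/-- The bump `β` that averages in the axial variable. -/
def axialBump : ℝ → ℝ := lineBump (5 / 2) (1 / 4) (1 / 2) (by norm_num) (by norm_num)

lemma exists_iterated_primitive {c : ℝ → ℝ} (hc : ContDiff ℝ (⊤ : ℕ∞) c)
    (h0 : ∀ y, 3 ≤ y → c y = 0) (n : ℕ) :
    ∃ F : ℝ → ℝ, ContDiff ℝ (⊤ : ℕ∞) F ∧ (∀ y, 3 ≤ y → F y = 0) ∧ iteratedDeriv n F = c := by
  induction n with
  | zero => exact ⟨c, hc, h0, by simp⟩
  | succ n ih =>
    obtain ⟨F, hF, hF0, hFc⟩ := ih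
    have hd : ∀ y, HasDerivAt (fun y => ∫ s in (3 : ℝ)..y, F s) (F y) y := fun y =>
      intervalIntegral.integral_hasDerivAt_right (hF.continuous.intervalIntegrable _ _)
        (hF.continuous.stronglyMeasurableAtFilter _ _) hF.continuous.continuousAt
    have hd' : deriv (fun y => ∫ s in (3 : ℝ)..y, F s) = F := funext fun y => (hd y).deriv
    refine ⟨fun y => ∫ s in (3 : ℝ)..y, F s, ?_, ?_, ?_⟩
    · rw [contDiff_infty_iff_deriv, hd']
      exact ⟨fun y => (hd y).differentiableAt, hF⟩
    · intro y hy
      beta_reduce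
      rw [intervalIntegral.integral_congr (g := fun _ => (0 : ℝ))]
      · simp
      · intro s hs
        rw [uIcc_of_le hy] at hs
        exact hF0 s hs.1
    · rw [iteratedDeriv_succ', hd', hFc]

/-- A compactly supported profile all of whose derivatives up to order `100` have vanishing
moments, while its `101`-st derivative is a negative bump on the positive half-line: what
compensates the bump lives on the negative half-line, which the vorticity never visits. -/
lemma exists_momentProf : ∃ G : ℝ → ℝ, ContDiff ℝ (⊤ : ℕ∞) G ∧ (∀ y, G y ≠ 0 → -1 ≤ y ∧ y ≤ 3) ∧
    ∀ y, 0 < y → iteratedDeriv 101 G y = - axialBump y := by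
  obtain ⟨F, hF, hF0, hFc⟩ := exists_iterated_primitive (c := fun y => - axialBump y)
    (ContDiffBump.contDiff (n := (⊤ : ℕ∞)) _).neg (fun y hy => by
      by_contra h
      have := lineBump_ne_zero _ _ (neg_ne_zero.1 h)
      linarith) 101
  refine ⟨fun y => Real.smoothTransition (y + 1) * F y,
    (Real.smoothTransition.contDiff.comp (by fun_prop)).mul hF, ?_, ?_⟩
  · intro y hy
    constructor
    · by_contra h
      exact left_ne_zero_of_mul hy (Real.smoothTransition.zero_of_nonpos (by linarith))
    · by_contra h
      exact right_ne_zero_of_mul hy (hF0 y (by linarith))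
  · intro y hy
    have : (fun y => Real.smoothTransition (y + 1) * F y) =ᶠ[𝓝 y] F := by
      filter_upwards [Ioi_mem_nhds hy] with z hz
      have hz' : 0 < z := hz
      rw [Real.smoothTransition.one_of_one_le (by linarith), one_mul]
    rw [this.iteratedDeriv_eq, hFc]

/-- The axial profile of the sensor, before differentiation. -/
def momentProf : ℝ → ℝ := exists_momentProf.choose

lemma contDiff_momentProf : ContDiff ℝ (⊤ : ℕ∞) momentProf := exists_momentProf.choose_spec.1

lemma momentProf_ne_zero {y : ℝ} (h : momentProf y ≠ 0) : -1 ≤ y ∧ y ≤ 3 :=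
  exists_momentProf.choose_spec.2.1 y h

lemma iteratedDeriv_momentProf {y : ℝ} (h : 0 < y) :
    iteratedDeriv 101 momentProf y = - axialBump y := exists_momentProf.choose_spec.2.2 y h

lemma iteratedDeriv_momentProf_ne_zero {n : ℕ} {y : ℝ} (h : iteratedDeriv n momentProf y ≠ 0) :
    -1 ≤ y ∧ y ≤ 3 := by
  have key : ∀ U : Set ℝ, IsOpen U → y ∈ U → (∀ z ∈ U, ¬ (-1 ≤ z ∧ z ≤ 3)) → False := by
    intro U hU hy hz
    apply h
    have : momentProf =ᶠ[𝓝 y] fun _ => 0 := by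
      filter_upwards [hU.mem_nhds hy] with z hzU
      by_contra h'
      exact hz z hzU (momentProf_ne_zero h')
    rw [this.iteratedDeriv_eq]; simp
  constructor
  · by_contra! h'
    exact key (Iio (-1)) isOpen_Iio h' fun z hz hz' => absurd hz'.1 (not_le.2 hz)
  · by_contra! h'
    exact key (Ioi 3) isOpen_Ioi h' fun z hz hz' => absurd hz'.2 (not_le.2 hz)

/-- The transversal profile of the sensor. -/
def transBump : ℝ → ℝ := lineBump 0 (1 / 2) 1 (by norm_num) (by norm_num)

/-- The vertical profile of the sensor: it places the sensor above the streams of its own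
and all smaller scales, and inside the region where the streams of the larger scales do not depend on the height. -/
def vertBump : ℝ → ℝ := lineBump (7 / 2) (1 / 4) (1 / 2) (by norm_num) (by norm_num)

lemma contDiff_transBump : ContDiff ℝ (⊤ : ℕ∞) transBump := ContDiffBump.contDiff _
lemma contDiff_vertBump : ContDiff ℝ (⊤ : ℕ∞) vertBump := ContDiffBump.contDiff _
lemma contDiff_axialBump : ContDiff ℝ (⊤ : ℕ∞) axialBump := ContDiffBump.contDiff _

lemma transBump_ne_zero {y : ℝ} (h : transBump y ≠ 0) : -1 < y ∧ y < 1 := by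
  have := lineBump_ne_zero _ _ h
  constructor <;> linarith

lemma vertBump_ne_zero {y : ℝ} (h : vertBump y ≠ 0) : 3 < y ∧ y < 4 := by
  have := lineBump_ne_zero _ _ h
  constructor <;> linarith

lemma axialBump_ne_zero {y : ℝ} (h : axialBump y ≠ 0) : 2 < y ∧ y < 3 := by
  have := lineBump_ne_zero _ _ h
  constructor <;> linarith

/-- The density with which the sensor averages. -/
def density : R3 → ℝ := prod3 axialBump transBump vertBump

lemma density_nonneg (x : R3) : 0 ≤ density x :=
  mul_nonneg (mul_nonneg (ContDiffBump.nonneg _) (ContDiffBump.nonneg _)) (ContDiffBump.nonneg _)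

lemma density_ne_zero {x : R3} (h : density x ≠ 0) :
    (2 < x 0 ∧ x 0 < 3) ∧ (-1 < x 1 ∧ x 1 < 1) ∧ (3 < x 2 ∧ x 2 < 4) :=
  ⟨axialBump_ne_zero (left_ne_zero_of_mul (left_ne_zero_of_mul h)),
    transBump_ne_zero (right_ne_zero_of_mul (left_ne_zero_of_mul h)),
    vertBump_ne_zero (right_ne_zero_of_mul h)⟩

lemma isTest_density : IsTest density := by
  refine isTest_of_box (C := 4)
    (contDiff_prod3 contDiff_axialBump contDiff_transBump contDiff_vertBump) ?_
  intro x hx i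
  obtain ⟨⟨h1, h2⟩, ⟨h3, h4⟩, h5, h6⟩ := density_ne_zero hx
  rw [abs_le]
  fin_cases i <;> constructor <;> simp <;> linarith

/-- The total mass of the density. -/
def mass : ℝ := ∫ x, density x

lemma mass_pos : 0 < mass := by
  refine isTest_density.continuous.integral_pos_of_hasCompactSupport_nonneg_nonzero
    isTest_density.2 density_nonneg (x := !₂[5 / 2, 0, 7 / 2]) ?_
  have h1 : axialBump (5 / 2) = 1 := lineBump_eq_one _ _ (by norm_num) (by norm_num)
  have h2 : transBump 0 = 1 := lineBump_eq_one _ _ (by norm_num) (by norm_num)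
  have h3 : vertBump (7 / 2) = 1 := lineBump_eq_one _ _ (by norm_num) (by norm_num)
  simp [density, prod3, h1, h2, h3]

/-- The `n`-th axial derivative of the undifferentiated sensor. -/
def presensor (n : ℕ) : R3 → ℝ :=
  fun x => mass⁻¹ * prod3 (iteratedDeriv n momentProf) transBump vertBump x

/-- The sensor `b`, an axial derivative of order `100` of a test function. -/
def sensor : R3 → ℝ := presensor 100

lemma contDiff_iteratedDeriv_momentProf (n : ℕ) :
    ContDiff ℝ (⊤ : ℕ∞) (iteratedDeriv n momentProf) := by
  rw [iteratedDeriv_eq_iterate]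
  exact contDiff_momentProf.iterate_deriv n

lemma presensor_ne_zero {n : ℕ} {x : R3} (h : presensor n x ≠ 0) :
    (-1 ≤ x 0 ∧ x 0 ≤ 3) ∧ (-1 < x 1 ∧ x 1 < 1) ∧ (3 < x 2 ∧ x 2 < 4) := by
  replace h := right_ne_zero_of_mul h
  exact ⟨iteratedDeriv_momentProf_ne_zero (left_ne_zero_of_mul (left_ne_zero_of_mul h)),
    transBump_ne_zero (right_ne_zero_of_mul (left_ne_zero_of_mul h)),
    vertBump_ne_zero (right_ne_zero_of_mul h)⟩

lemma isTest_presensor (n : ℕ) : IsTest (presensor n) := by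
  refine isTest_of_box (C := 4) (contDiff_const.mul
    (contDiff_prod3 (contDiff_iteratedDeriv_momentProf n) contDiff_transBump contDiff_vertBump)) ?_
  intro x hx i
  obtain ⟨⟨h1, h2⟩, ⟨h3, h4⟩, h5, h6⟩ := presensor_ne_zero hx
  rw [abs_le]
  fin_cases i <;> constructor <;> simp <;> linarith

lemma pd_presensor (n : ℕ) : pd 0 (presensor n) = presensor (n + 1) := by
  have hd : Differentiable ℝ (iteratedDeriv n momentProf) :=
    (contDiff_iteratedDeriv_momentProf n).differentiable (by simp)
  have h2 : Differentiable ℝ transBump := contDiff_transBump.differentiable (by simp)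
  have h3 : Differentiable ℝ vertBump := contDiff_vertBump.differentiable (by simp)
  have h4 : Differentiable ℝ (prod3 (iteratedDeriv n momentProf) transBump vertBump) :=
    (contDiff_prod3 (contDiff_iteratedDeriv_momentProf n) contDiff_transBump
      contDiff_vertBump).differentiable (by simp)
  funext x
  have h5 : pd 0 (presensor n) x
      = mass⁻¹ * pd 0 (prod3 (iteratedDeriv n momentProf) transBump vertBump) x := by
    unfold presensor pd
    rw [fderiv_const_mul (h4 x)]
    simp
  rw [h5, (pd_prod3 hd h2 h3).1, presensor, iteratedDeriv_succ]

lemma iterate_pd_presensor (m n : ℕ) : (pd 0)^[n] (presensor m) = presensor (m + n) := by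
  induction n with
  | zero => rfl
  | succ n ih => rw [Function.iterate_succ_apply', ih, pd_presensor]; rfl

lemma isTest_sensor : IsTest sensor := isTest_presensor _

lemma pd_sensor {x : R3} (h : 0 < x 0) : pd 0 sensor x = - (mass⁻¹ * density x) := by
  rw [sensor, pd_presensor, presensor, prod3, iteratedDeriv_momentProf h, density, prod3]
  ring

/-! ### Dyadic families: overlap and local finiteness -/

/-- `f` vanishes off the closed box that contains the support of the stream function. -/
def SuppInBox (f : R3 → ℝ) : Prop := ∀ x, f x ≠ 0 → x ∈ streamBox

lemma suppInBox_of_tsupport {f : R3 → ℝ} (h : tsupport f ⊆ streamBox) : SuppInBox f :=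
  fun _ hx => h (subset_tsupport f hx)

lemma tsupport_pd_subset (f : R3 → ℝ) (i : Fin 3) : tsupport (pd i f) ⊆ tsupport f :=
  tsupport_fderiv_apply_subset ℝ _

lemma smul_coord (r : ℝ) (x : R3) (i : Fin 3) : (r • x) i = r * x i := by simp

lemma dil_mem_streamBox {r : ℝ} (hr : 0 < r) {x : R3} (h : r⁻¹ • x ∈ streamBox) :
    (r / 128 ≤ x 0 ∧ x 0 ≤ 16 * r) ∧ |x 1| ≤ 128 * r ∧ |x 2| ≤ 2 * r := by
  obtain ⟨⟨h1, h2⟩, h3, h4⟩ := h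
  simp only [smul_coord] at h1 h2 h3 h4
  rw [inv_mul_eq_div, le_div_iff₀ hr] at h1
  rw [inv_mul_eq_div, div_le_iff₀ hr] at h2
  rw [inv_mul_eq_div, abs_div, abs_of_pos hr, div_le_iff₀ hr] at h3 h4
  exact ⟨⟨by linarith, h2⟩, h3, h4⟩

lemma overlap_streamBox {x : R3} {k l : ℕ} (hk : (scale k)⁻¹ • x ∈ streamBox)
    (hl : (scale l)⁻¹ • x ∈ streamBox) : l ≤ k + 1 := by
  have h1 := (dil_mem_streamBox (scale_pos k) hk).1.1
  have h2 := (dil_mem_streamBox (scale_pos l) hl).1.2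
  by_contra h
  have h3 := scale_le_div (show k + 1 < l by omega)
  rw [scale_succ] at h3
  linarith [scale_pos k]

/-- A set of scales each two of which are equal or adjacent has at most two members. -/
lemma card_le_two_of_overlap {P : ℕ → Prop} (hP : ∀ k l, P k → P l → l ≤ k + 1)
    (s : Finset ℕ) (hs : ∀ k ∈ s, P k) : s.card ≤ 2 := by
  rcases s.eq_empty_or_nonempty with rfl | hne
  · simp
  · have : s ⊆ {s.min' hne, s.min' hne + 1} := by
      intro l hl
      have h1 := hP _ l (hs _ (s.min'_mem hne)) (hs l hl)
      have h2 := s.min'_le l hl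
      simp only [Finset.mem_insert, Finset.mem_singleton]
      omega
    exact (Finset.card_le_card this).trans Finset.card_le_two

lemma sum_le_of_overlap {P : ℕ → Prop} (hP : ∀ k l, P k → P l → l ≤ k + 1) (s : Finset ℕ)
    {F : ℕ → ℝ} {C : ℝ} (hC : 0 ≤ C) (h0 : ∀ k ∈ s, F k ≠ 0 → P k) (hF : ∀ k ∈ s, P k → F k ≤ C) :
    ∑ k ∈ s, F k ≤ 2 * C := by
  classical
  rw [← Finset.sum_filter_ne_zero]
  have h1 := card_le_two_of_overlap hP (s.filter fun k => F k ≠ 0) (fun k hk => by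
    rw [Finset.mem_filter] at hk; exact h0 k hk.1 hk.2)
  have h2 := Finset.sum_le_card_nsmul (s.filter fun k => F k ≠ 0) F C (fun k hk => by
    rw [Finset.mem_filter] at hk; exact hF k hk.1 (h0 k hk.1 hk.2))
  rw [nsmul_eq_mul] at h2
  have h3 : ((s.filter fun k => F k ≠ 0).card : ℝ) ≤ 2 := by exact_mod_cast h1
  nlinarith

lemma sq_sum_le_of_overlap {P : ℕ → Prop} (hP : ∀ k l, P k → P l → l ≤ k + 1) (s : Finset ℕ)
    {F : ℕ → ℝ} (h0 : ∀ k ∈ s, F k ≠ 0 → P k) :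
    (∑ k ∈ s, F k) ^ 2 ≤ 2 * ∑ k ∈ s, F k ^ 2 := by
  classical
  have e1 : ∑ k ∈ s, F k ^ 2 = ∑ k ∈ s.filter (fun k => F k ≠ 0), F k ^ 2 := by
    rw [← Finset.sum_filter_ne_zero]
    congr 1
    ext k; simp
  rw [← Finset.sum_filter_ne_zero, e1]
  have h1 := card_le_two_of_overlap hP (s.filter fun k => F k ≠ 0) (fun k hk => by
    rw [Finset.mem_filter] at hk; exact h0 k hk.1 hk.2)
  have h2 := sq_sum_le_card_mul_sum_sq (s := s.filter fun k => F k ≠ 0) (f := F)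
  have h3 : ((s.filter fun k => F k ≠ 0).card : ℝ) ≤ 2 := by exact_mod_cast h1
  have h4 : 0 ≤ ∑ k ∈ s.filter (fun k => F k ≠ 0), F k ^ 2 :=
    Finset.sum_nonneg fun _ _ => sq_nonneg _
  nlinarith

lemma exists_scale_lt {δ : ℝ} (hδ : 0 < δ) : ∃ N, ∀ k, N ≤ k → scale k < δ := by
  have := (tendsto_order.1 tendsto_scale).2 δ hδ
  exact eventually_atTop.1 this

/-- Away from the origin only finitely many members of a dyadic family are nonzero. -/
lemma eventually_dil_eq_zero {f : R3 → ℝ} {C : ℝ} (hf : ∀ x, f x ≠ 0 → ‖x‖ ≤ C) {x : R3}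
    (hx : x ≠ 0) : ∃ N, ∀ᶠ x' in 𝓝 x, ∀ k, N ≤ k → dil (scale k) f x' = 0 := by
  have hx' : 0 < ‖x‖ := norm_pos_iff.2 hx
  have hC' : 0 < |C| + 1 := by positivity
  obtain ⟨N, hN⟩ := exists_scale_lt (δ := ‖x‖ / 2 / (|C| + 1)) (by positivity)
  refine ⟨N, ?_⟩
  have : ∀ᶠ x' : R3 in 𝓝 x, ‖x‖ / 2 < ‖x'‖ :=
    (continuous_norm.tendsto x).eventually (lt_mem_nhds (by linarith))
  filter_upwards [this] with x' hx' k hk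
  by_contra h
  have h1 := hf _ h
  have h2 := hN k hk
  rw [lt_div_iff₀ hC'] at h2
  rw [norm_smul, norm_inv, Real.norm_eq_abs, abs_of_pos (scale_pos k), inv_mul_eq_div,
    div_le_iff₀ (scale_pos k)] at h1
  nlinarith [le_abs_self C, scale_pos k]

lemma SuppInBox.norm_le {f : R3 → ℝ} (hf : SuppInBox f) (x : R3) (hx : f x ≠ 0) :
    ‖x‖ ≤ 256 := by
  obtain ⟨⟨h1, h2⟩, h3, h4⟩ := hf x hx
  have : ∀ i, |x i| ≤ 128 := by
    intro i
    fin_cases i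
    · simp only [Fin.zero_eta]; rw [abs_le]; constructor <;> linarith
    · simpa using h3
    · simp only [Fin.reduceFinMk]; linarith
  linarith [norm_le_of_abs_le this]

lemma suppInBox_stream : SuppInBox stream := suppInBox_of_tsupport tsupport_stream_subset

lemma presensor_norm_le {n : ℕ} (x : R3) (hx : presensor n x ≠ 0) : ‖x‖ ≤ 8 := by
  obtain ⟨⟨h1, h2⟩, ⟨h3, h4⟩, h5, h6⟩ := presensor_ne_zero hx
  have : ∀ i, |x i| ≤ 4 := by
    intro i; rw [abs_le]
    fin_cases i <;> constructor <;> simp <;> linarith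
  linarith [norm_le_of_abs_le this]

lemma SuppInBox.exists_finite {f : R3 → ℝ} (hf : SuppInBox f) (x : R3) :
    ∃ N, ∀ k, N ≤ k → dil (scale k) f x = 0 := by
  rcases eq_or_ne x 0 with rfl | hx
  · refine ⟨0, fun k _ => ?_⟩
    by_contra h
    have h1 := (dil_mem_streamBox (scale_pos k) (hf _ h)).1.1
    simp only [PiLp.zero_apply] at h1
    linarith [scale_pos k]
  · obtain ⟨N, hN⟩ := eventually_dil_eq_zero hf.norm_le hx
    exact ⟨N, hN.self_of_nhds⟩

/-! ### The vector potential operator -/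

/-- The unit `2`-vector `∂₀ ∧ ∂₁`. -/
def e01 : Alt2 :=
  ⟨WithLp.toLp 2 fun p => if p = (0, 1) then 1 else if p = (1, 0) then -1 else 0, by
    intro i j; fin_cases i <;> fin_cases j <;> simp⟩

/-- The coordinate `w_{02}` as a continuous linear functional. -/
def coord02 : Alt2 →L[ℝ] ℝ :=
  (EuclideanSpace.proj (𝕜 := ℝ) ((0, 2) : Fin 3 × Fin 3)).comp Alt2.subtypeL

lemma coord02_apply (w : Alt2) : coord02 w = (w : Ten2) (0, 2) := rfl

/-- The reading `∫ b(y / r_k) f(y) dy` of the sensor at scale `k`. -/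
def sens (k : ℕ) (f : R3 → ℝ) : ℝ := ∫ y, dil (scale k) sensor y * f y

lemma isTest_comp (ω : CcB2) (i j : Fin 3) : IsTest (comp ω.1 i j) := by
  constructor
  · exact (EuclideanSpace.proj (𝕜 := ℝ) (i, j)).contDiff.comp
      (Alt2.subtypeL.contDiff.comp ω.2.1)
  · exact ω.2.2.1.comp_left (g := fun w : Alt2 => (w : Ten2) (i, j)) (by simp)

lemma sens_integrable (k : ℕ) {f : R3 → ℝ} (hf : LocallyIntegrable f) :
    Integrable fun y => dil (scale k) sensor y * f y := by
  have := isTest_sensor.dil (scale_pos k)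
  exact hf.integrable_smul_left_of_hasCompactSupport this.continuous this.2

lemma sens_add (k : ℕ) {f h : R3 → ℝ} (hf : LocallyIntegrable f) (hh : LocallyIntegrable h) :
    sens k (fun y => f y + h y) = sens k f + sens k h := by
  simp only [sens, mul_add]
  exact integral_add (sens_integrable k hf) (sens_integrable k hh)

lemma sens_const_mul (k : ℕ) (c : ℝ) (f : R3 → ℝ) :
    sens k (fun y => c * f y) = c * sens k f := by
  simp only [sens]
  rw [← integral_const_mul]
  congr 1; funext y; ring

/-- The dyadic sum `∑ₖ cₖ f(x / r_k)`. -/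
def dyadicSum (c : ℕ → ℝ) (f : R3 → ℝ) (x : R3) : ℝ := ∑' k, c k * dil (scale k) f x

lemma dyadicSum_eq_sum {f : R3 → ℝ} {x : R3} {N : ℕ}
    (h : ∀ k, N ≤ k → dil (scale k) f x = 0) (c : ℕ → ℝ) :
    dyadicSum c f x = ∑ k ∈ Finset.range N, c k * dil (scale k) f x := by
  refine tsum_eq_sum fun k hk => ?_
  rw [h k (by simpa using hk), mul_zero]

/-- The vector potential operator `A ω = (∑ₖ r_k⁻¹ (∫ b(y/r_k) ω₀₂(y) dy) a(x/r_k)) ∂₀ ∧ ∂₁`. -/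
def potentialOp : VectorPotentialOp where
  toFun ω x := dyadicSum (fun k => (scale k)⁻¹ * sens k (comp ω.1 0 2)) stream x • e01
  map_add' := by
    intro ω ω'
    funext x
    obtain ⟨N, hN⟩ := suppInBox_stream.exists_finite x
    have h1 : comp (ω + ω').1 0 2 = fun y => comp ω.1 0 2 y + comp ω'.1 0 2 y := by
      funext y; simp [comp]
    simp only [dyadicSum_eq_sum hN, Pi.add_apply, ← add_smul, ← Finset.sum_add_distrib]
    congr 1
    refine Finset.sum_congr rfl fun k _ => ?_
    rw [h1, sens_add k (isTest_comp ω 0 2).continuous.locallyIntegrable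
      (isTest_comp ω' 0 2).continuous.locallyIntegrable]
    ring
  map_smul' := by
    intro c ω
    funext x
    obtain ⟨N, hN⟩ := suppInBox_stream.exists_finite x
    have h1 : comp (c • ω).1 0 2 = fun y => c * comp ω.1 0 2 y := by
      funext y; simp [comp]
    simp only [dyadicSum_eq_sum hN, Pi.smul_apply, smul_smul, RingHom.id_apply, Finset.mul_sum]
    congr 1
    refine Finset.sum_congr rfl fun k _ => ?_
    rw [h1, sens_const_mul]
    ring

lemma potentialOp_apply (ω : CcB2) (x : R3) : potentialOp ω x
    = dyadicSum (fun k => (scale k)⁻¹ * sens k (comp ω.1 0 2)) stream x • e01 := rfl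

/-! ### The kernel -/

/-- The rank-one map `w ↦ w₀₂ ∂₀ ∧ ∂₁`. -/
def rankOne : Alt2 →L[ℝ] Alt2 := coord02.smulRight e01

/-- The scalar kernel `∑ₖ r_k⁻¹ a(x / r_k) b(y / r_k)`. -/
def scalarKernel (x y : R3) : ℝ :=
  ∑' k, (scale k)⁻¹ * dil (scale k) stream x * dil (scale k) sensor y

/-- The kernel of the operator. -/
def kernel (x y : R3) : Alt2 →L[ℝ] Alt2 := scalarKernel x y • rankOne

lemma kernel_apply (x y : R3) (w : Alt2) :
    kernel x y w = (scalarKernel x y * (w : Ten2) (0, 2)) • e01 := by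
  simp [kernel, rankOne, coord02_apply, smul_smul]

lemma scalarKernel_eq_sum {x y : R3} {N : ℕ}
    (h : ∀ k, N ≤ k → dil (scale k) stream x = 0 ∨ dil (scale k) sensor y = 0) :
    scalarKernel x y = ∑ k ∈ Finset.range N,
      ((scale k)⁻¹ * dil (scale k) stream x) * dil (scale k) sensor y := by
  refine tsum_eq_sum fun k hk => ?_
  rcases h k (by simpa using hk) with h | h <;> simp [h]

lemma kernel_integral (ω : CcB2) (x : R3) : Integrable (fun y => kernel x y (ω.1 y)) ∧
    potentialOp ω x = ∫ y, kernel x y (ω.1 y) := by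
  obtain ⟨N, hN⟩ := suppInBox_stream.exists_finite x
  have h1 : ∀ y, kernel x y (ω.1 y) = (∑ k ∈ Finset.range N,
      ((scale k)⁻¹ * dil (scale k) stream x) * (dil (scale k) sensor y * comp ω.1 0 2 y)) •
        e01 := by
    intro y
    rw [kernel_apply, scalarKernel_eq_sum fun k hk => Or.inl (hN k hk), Finset.sum_mul]
    congr 1
    refine Finset.sum_congr rfl fun k _ => ?_
    rw [comp]; ring
  have h2 : ∀ k ∈ Finset.range N, Integrable fun y =>
      ((scale k)⁻¹ * dil (scale k) stream x) * (dil (scale k) sensor y * comp ω.1 0 2 y) :=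
    fun k _ => (sens_integrable k
      (isTest_comp ω 0 2).continuous.locallyIntegrable).const_mul _
  simp only [h1]
  refine ⟨(integrable_finsetSum _ h2).smul_const _, ?_⟩
  rw [integral_smul_const, integral_finsetSum _ h2, potentialOp_apply, dyadicSum_eq_sum hN]
  congr 1
  refine Finset.sum_congr rfl fun k _ => ?_
  rw [integral_const_mul, sens]; ring

lemma exists_kernel_eq_sum {x y : R3} (h : x ≠ y) : ∃ N, ∀ᶠ x' in 𝓝 x, ∀ᶠ y' in 𝓝 y,
    ∀ k, N ≤ k → dil (scale k) stream x' = 0 ∨ dil (scale k) sensor y' = 0 := by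
  rcases eq_or_ne x 0 with rfl | hx
  · obtain ⟨N, hN⟩ := eventually_dil_eq_zero (f := sensor) presensor_norm_le h.symm
    exact ⟨N, Eventually.of_forall fun x' => hN.mono fun y' hy' k hk => Or.inr (hy' k hk)⟩
  · obtain ⟨N, hN⟩ := eventually_dil_eq_zero suppInBox_stream.norm_le hx
    exact ⟨N, hN.mono fun x' hx' => Eventually.of_forall fun y' k hk => Or.inl (hx' k hk)⟩

lemma contDiffOn_scalarKernel :
    ContDiffOn ℝ (⊤ : ℕ∞) (fun q : R3 × R3 => scalarKernel q.1 q.2) {q | q.1 ≠ q.2} := by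
  intro q hq
  apply ContDiffAt.contDiffWithinAt
  have hN : ∃ N, ∀ᶠ q' in 𝓝 q,
      ∀ k, N ≤ k → dil (scale k) stream q'.1 = 0 ∨ dil (scale k) sensor q'.2 = 0 := by
    rcases eq_or_ne q.1 0 with hx | hx
    · have hy : q.2 ≠ 0 := fun h => hq (hx.trans h.symm)
      obtain ⟨N, hN⟩ := eventually_dil_eq_zero (f := sensor) presensor_norm_le hy
      exact ⟨N, (continuous_snd.tendsto q).eventually hN |>.mono
        fun q' hq' k hk => Or.inr (hq' k hk)⟩
    · obtain ⟨N, hN⟩ := eventually_dil_eq_zero suppInBox_stream.norm_le hx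
      exact ⟨N, (continuous_fst.tendsto q).eventually hN |>.mono
        fun q' hq' k hk => Or.inl (hq' k hk)⟩
  obtain ⟨N, hN⟩ := hN
  have : (fun q : R3 × R3 => scalarKernel q.1 q.2) =ᶠ[𝓝 q] fun q => ∑ k ∈ Finset.range N,
      ((scale k)⁻¹ * dil (scale k) stream q.1) * dil (scale k) sensor q.2 :=
    hN.mono fun q' hq' => scalarKernel_eq_sum hq'
  refine ContDiffAt.congr_of_eventuallyEq ?_ this
  apply ContDiff.contDiffAt
  refine ContDiff.sum fun k _ => ?_
  exact (contDiff_const.mul ((contDiff_dil isTest_stream.1 _).comp contDiff_fst)).mul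
    ((contDiff_dil isTest_sensor.1 _).comp contDiff_snd)

lemma norm_iteratedFDeriv_dil_le {f : R3 → ℝ} (hf : ContDiff ℝ (⊤ : ℕ∞) f) {r : ℝ} (hr : 0 < r)
    (n : ℕ) (x : R3) :
    ‖iteratedFDeriv ℝ n (dil r f) x‖ ≤ r⁻¹ ^ n * ‖iteratedFDeriv ℝ n f (r⁻¹ • x)‖ := by
  have h := (r⁻¹ • ContinuousLinearMap.id ℝ R3).iteratedFDeriv_comp_right (f := f) hf x
    (i := n) (by exact_mod_cast le_top)
  have h2 : (f ∘ ⇑(r⁻¹ • ContinuousLinearMap.id ℝ R3)) = dil r f := by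
    funext y; simp [dil]
  rw [h2] at h
  rw [h]
  refine (ContinuousMultilinearMap.norm_compContinuousLinearMap_le _ _).trans ?_
  rw [mul_comm]
  have h3 : ‖r⁻¹ • ContinuousLinearMap.id ℝ R3‖ ≤ r⁻¹ := by
    rw [norm_smul, norm_inv, Real.norm_eq_abs, abs_of_pos hr]
    exact mul_le_of_le_one_right (by positivity) ContinuousLinearMap.norm_id_le
  have h4 : ∏ _i : Fin n, ‖r⁻¹ • ContinuousLinearMap.id ℝ R3‖ ≤ r⁻¹ ^ n := by
    rw [Finset.prod_const, Finset.card_univ, Fintype.card_fin]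
    exact pow_le_pow_left₀ (norm_nonneg _) h3 n
  simp only [smul_apply, ContinuousLinearMap.id_apply] at *
  exact mul_le_mul_of_nonneg_right h4 (norm_nonneg _)

lemma IsTest.exists_bound_iteratedFDeriv {f : R3 → ℝ} (hf : IsTest f) (M : ℕ) :
    ∃ C, 0 ≤ C ∧ ∀ n ≤ M, ∀ x, ‖iteratedFDeriv ℝ n f x‖ ≤ C := by
  have h : ∀ n : ℕ, ∃ C, ∀ x, ‖iteratedFDeriv ℝ n f x‖ ≤ C := fun n =>
    (hf.1.continuous_iteratedFDeriv (m := n) (by exact_mod_cast le_top)).bounded_above_of_compact_support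
      (hf.2.iteratedFDeriv n)
  choose C hC using h
  refine ⟨∑ n ∈ Finset.range (M + 1), |C n|, Finset.sum_nonneg fun _ _ => abs_nonneg _, ?_⟩
  intro n hn x
  refine (hC n x).trans ((le_abs_self _).trans ?_)
  exact Finset.single_le_sum (f := fun n => |C n|) (fun _ _ => abs_nonneg _)
    (Finset.mem_range.2 (by omega))

section
variable {F : Type*} [NormedAddCommGroup F] [NormedSpace ℝ F]

lemma contDiffOn_scalarKernel_smul (T : F) :
    ContDiffOn ℝ (⊤ : ℕ∞) (fun q : R3 × R3 => scalarKernel q.1 q.2 • T) {q | q.1 ≠ q.2} :=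
  contDiffOn_scalarKernel.smul contDiffOn_const

/-- The derivatives in `y` of the scalar kernel, near a point `x`. -/
lemma eventually_iteratedFDeriv_kernel (T : F) {x y : R3} {N : ℕ}
    (hN : ∀ᶠ x' in 𝓝 x, ∀ᶠ y' in 𝓝 y,
      ∀ k, N ≤ k → dil (scale k) stream x' = 0 ∨ dil (scale k) sensor y' = 0) (j : ℕ) :
    (fun x' => iteratedFDeriv ℝ j (fun y' => scalarKernel x' y' • T) y) =ᶠ[𝓝 x]
      ContinuousLinearMap.compContinuousMultilinearMapL ℝ (fun _ : Fin j => R3) ℝ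
        F (ContinuousLinearMap.toSpanSingleton ℝ T) ∘ fun x' => ∑ k ∈ Finset.range N,
          ((scale k)⁻¹ * dil (scale k) stream x') • iteratedFDeriv ℝ j (dil (scale k) sensor) y := by
  filter_upwards [hN] with x' hx'
  have h1 : (fun y' => scalarKernel x' y' • T) =ᶠ[𝓝 y]
      ⇑(ContinuousLinearMap.toSpanSingleton ℝ T) ∘ fun y' => ∑ k ∈ Finset.range N,
      ((scale k)⁻¹ * dil (scale k) stream x') * dil (scale k) sensor y' :=
    hx'.mono fun y' hy' => congrArg (· • T) (scalarKernel_eq_sum hy')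
  have h2 : ∀ k, ContDiff ℝ (⊤ : ℕ∞) fun y' =>
      ((scale k)⁻¹ * dil (scale k) stream x') * dil (scale k) sensor y' :=
    fun k => contDiff_const.mul (contDiff_dil isTest_sensor.1 _)
  rw [h1.iteratedFDeriv ℝ j |>.self_of_nhds, (ContinuousLinearMap.toSpanSingleton ℝ T).iteratedFDeriv_comp_left
    (n := (⊤ : ℕ∞)) (ContDiff.sum fun k _ => h2 k).contDiffAt (by exact_mod_cast le_top)]
  simp only [Function.comp_apply, ContinuousLinearMap.compContinuousMultilinearMapL_apply]
  congr 1
  refine (congrFun (iteratedFDeriv_sum (𝕜 := ℝ) (i := j) (u := Finset.range N)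
    (f := fun k y' => ((scale k)⁻¹ * dil (scale k) stream x') * dil (scale k) sensor y')
    fun k _ => (h2 k).of_le (by exact_mod_cast le_top)) y).trans ?_
  rw [Finset.sum_apply]
  refine Finset.sum_congr rfl fun k _ => ?_
  have := iteratedFDeriv_const_smul_apply (𝕜 := ℝ) (i := j)
    (a := (scale k)⁻¹ * dil (scale k) stream x') (x := y)
    ((contDiff_dil isTest_sensor.1 (scale k)).of_le (by exact_mod_cast le_top)).contDiffAt
  exact this

lemma kernel_bound (T : F) (M : ℕ) : ∃ C : ℝ, ∀ i j : ℕ, i ≤ M → j ≤ M → 1 ≤ i + j → ∀ x y : R3, x ≠ y →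
    ‖iteratedFDeriv ℝ i (fun x' => iteratedFDeriv ℝ j (fun y' => scalarKernel x' y' • T) y) x‖
      ≤ C / ‖x - y‖ ^ (i + j + 1) := by
  obtain ⟨Ca, hCa, ha⟩ := isTest_stream.exists_bound_iteratedFDeriv M
  obtain ⟨Cb, hCb, hb⟩ := isTest_sensor.exists_bound_iteratedFDeriv M
  refine ⟨‖ContinuousLinearMap.toSpanSingleton ℝ T‖ * (2 * (264 ^ (2 * M + 1) * (Ca * Cb))), ?_⟩
  intro i j hi hj _ x y hxy
  obtain ⟨N, hN⟩ := exists_kernel_eq_sum hxy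
  rw [(eventually_iteratedFDeriv_kernel T hN j).iteratedFDeriv ℝ i |>.self_of_nhds]
  have hs : ∀ k, ContDiff ℝ (⊤ : ℕ∞) fun x' => ((scale k)⁻¹ * dil (scale k) stream x') •
      iteratedFDeriv ℝ j (dil (scale k) sensor) y := fun k =>
    (contDiff_const.mul (contDiff_dil isTest_stream.1 _)).smul contDiff_const
  have hxy' : 0 < ‖x - y‖ := norm_pos_iff.2 (sub_ne_zero.2 hxy)
  have hterm : ∀ k, ‖iteratedFDeriv ℝ i (fun x' => ((scale k)⁻¹ * dil (scale k) stream x') •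
      iteratedFDeriv ℝ j (dil (scale k) sensor) y) x‖
      ≤ (scale k)⁻¹ ^ (i + j + 1) * (‖iteratedFDeriv ℝ i stream ((scale k)⁻¹ • x)‖ *
        ‖iteratedFDeriv ℝ j sensor ((scale k)⁻¹ • y)‖) := by
    intro k
    have hk := scale_pos k
    set D := iteratedFDeriv ℝ j (dil (scale k) sensor) y
    have e : (fun x' => ((scale k)⁻¹ * dil (scale k) stream x') • D)
        = ⇑((scale k)⁻¹ • ContinuousLinearMap.toSpanSingleton ℝ D) ∘ dil (scale k) stream := by
      funext x'; simp [mul_smul]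
    rw [e]
    refine (ContinuousLinearMap.norm_iteratedFDeriv_comp_left _ (n := i)
      ((contDiff_dil isTest_stream.1 _).of_le (by exact_mod_cast le_top)).contDiffAt le_rfl).trans ?_
    have h1 := norm_iteratedFDeriv_dil_le isTest_stream.1 hk i x
    have h2 : ‖D‖ ≤ _ := norm_iteratedFDeriv_dil_le isTest_sensor.1 hk j y
    rw [norm_smul, ContinuousLinearMap.norm_toSpanSingleton, norm_inv, Real.norm_eq_abs,
      abs_of_pos hk]
    calc (scale k)⁻¹ * ‖D‖ * ‖iteratedFDeriv ℝ i (dil (scale k) stream) x‖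
        ≤ (scale k)⁻¹ * ((scale k)⁻¹ ^ j * ‖iteratedFDeriv ℝ j sensor ((scale k)⁻¹ • y)‖) *
          ((scale k)⁻¹ ^ i * ‖iteratedFDeriv ℝ i stream ((scale k)⁻¹ • x)‖) := by gcongr
      _ = _ := by ring
  refine (ContinuousLinearMap.norm_iteratedFDeriv_comp_left _ (n := i)
      ((ContDiff.sum fun k _ => hs k).of_le (by exact_mod_cast le_top)).contDiffAt le_rfl).trans ?_
  rw [mul_div_assoc]
  refine mul_le_mul (ContinuousLinearMap.opNorm_le_bound _ (norm_nonneg _) fun D =>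
    (ContinuousLinearMap.toSpanSingleton ℝ T).norm_compContinuousMultilinearMap_le D) ?_
    (norm_nonneg _) (norm_nonneg _)
  have hsum := congrFun (iteratedFDeriv_sum (𝕜 := ℝ) (i := i) (u := Finset.range N)
    (f := fun k x' => ((scale k)⁻¹ * dil (scale k) stream x') •
      iteratedFDeriv ℝ j (dil (scale k) sensor) y)
    fun k _ => (hs k).of_le (by exact_mod_cast le_top)) x
  rw [hsum, Finset.sum_apply]
  refine (norm_sum_le _ _).trans ?_
  rw [mul_div_assoc]
  refine sum_le_of_overlap (P := fun k => (scale k)⁻¹ • x ∈ streamBox)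
    (fun k l => overlap_streamBox) _ (by positivity) ?_ ?_
  · intro k _ hk
    by_contra h
    have h0 : iteratedFDeriv ℝ i stream ((scale k)⁻¹ • x) = 0 := by
      by_contra h'
      exact h (tsupport_stream_subset (support_iteratedFDeriv_subset i h'))
    have := hterm k
    rw [h0, norm_zero, zero_mul, mul_zero] at this
    exact hk (le_antisymm this (norm_nonneg _))
  · intro k _ hk
    have hr := scale_pos k
    refine (hterm k).trans ?_
    by_cases h0 : iteratedFDeriv ℝ j sensor ((scale k)⁻¹ • y) = 0
    · rw [h0, norm_zero, mul_zero, mul_zero]; positivity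
    have h1 : ‖(scale k)⁻¹ • y‖ ≤ 8 := by
      have h2 : (scale k)⁻¹ • y ∈ tsupport sensor := support_iteratedFDeriv_subset j h0
      have h3 : tsupport sensor ⊆ Metric.closedBall 0 8 :=
        closure_minimal (fun z hz => by simpa using presensor_norm_le z hz)
          Metric.isClosed_closedBall
      simpa using h3 h2
    have h2 : ‖(scale k)⁻¹ • x‖ ≤ 256 := by
      by_cases h' : (scale k)⁻¹ • x ∈ streamBox
      · obtain ⟨⟨h1, h2⟩, h3, h4⟩ := h'
        have : ∀ i, |((scale k)⁻¹ • x) i| ≤ 128 := by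
          intro i
          fin_cases i
          · simp only [Fin.zero_eta]; rw [abs_le]; constructor <;> linarith
          · simpa using h3
          · simp only [Fin.reduceFinMk]; linarith
        linarith [norm_le_of_abs_le this]
      · exact absurd hk h'
    have h3 : ‖x - y‖ ≤ 264 * scale k := by
      have : ‖(scale k)⁻¹ • (x - y)‖ ≤ 264 := by
        rw [smul_sub]; exact (norm_sub_le _ _).trans (by linarith)
      rwa [norm_smul, norm_inv, Real.norm_eq_abs, abs_of_pos hr, inv_mul_eq_div,
        div_le_iff₀ hr] at this
    have h4 : (scale k)⁻¹ ≤ 264 / ‖x - y‖ := by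
      rw [inv_eq_one_div, div_le_div_iff₀ hr hxy']; linarith
    calc (scale k)⁻¹ ^ (i + j + 1) * (‖iteratedFDeriv ℝ i stream ((scale k)⁻¹ • x)‖ *
          ‖iteratedFDeriv ℝ j sensor ((scale k)⁻¹ • y)‖)
        ≤ (264 / ‖x - y‖) ^ (i + j + 1) * (Ca * Cb) := by
          gcongr
          · exact ha i hi _
          · exact hb j hj _
      _ = 264 ^ (i + j + 1) * (Ca * Cb) / ‖x - y‖ ^ (i + j + 1) := by rw [div_pow]; ring
      _ ≤ 264 ^ (2 * M + 1) * (Ca * Cb) / ‖x - y‖ ^ (i + j + 1) := by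
          gcongr
          · norm_num
          · omega

end

lemma kernel_spec (M : ℕ) : ∃ K : R3 → R3 → (Alt2 →L[ℝ] Alt2),
    (∀ (ω : CcB2) (x : R3), Integrable (fun y => K x y (ω.1 y)) ∧
      potentialOp ω x = ∫ y, K x y (ω.1 y)) ∧
    ContDiffOn ℝ (⊤ : ℕ∞) (fun q : R3 × R3 => K q.1 q.2) {q | q.1 ≠ q.2} ∧
    ∃ C : ℝ, ∀ i j : ℕ, i ≤ M → j ≤ M → 1 ≤ i + j → ∀ x y : R3, x ≠ y →
      ‖iteratedFDeriv ℝ i (fun x' => iteratedFDeriv ℝ j (fun y' => K x' y') y) x‖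
        ≤ C / ‖x - y‖ ^ (i + j + 1) :=
  ⟨kernel, kernel_integral, contDiffOn_scalarKernel_smul rankOne, kernel_bound rankOne M⟩

/-! ### The Fourier transform of test functions and of integrable functions -/

/-- A real-valued function seen as a complex-valued one. -/
def cx (f : R3 → ℝ) : R3 → ℂ := fun x => (f x : ℂ)

lemma IsFourier.locallyIntegrable {f : R3 → ℝ} {g : R3 → ℂ} (h : IsFourier f g) :
    LocallyIntegrable g := by
  rw [locallyIntegrable_iff]
  intro K hK
  obtain ⟨r, hr, hKr⟩ := hK.isBounded.subset_closedBall_lt 0 0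
  let φ : ContDiffBump (0 : R3) := ⟨r, r + 1, hr, by linarith⟩
  have hφ : IsTest φ := ⟨φ.contDiff, φ.hasCompactSupport⟩
  have hc : HasCompactSupport (cx φ) := hφ.2.comp_left (g := fun y : ℝ => (y : ℂ)) rfl
  have hd : ContDiff ℝ (⊤ : ℕ∞) (cx φ) := Complex.ofRealCLM.contDiff.comp hφ.1
  have h1 : IntegrableOn (fun ξ => g ξ * cx φ ξ) K := (h (hc.toSchwartzMap hd)).2.1.integrableOn
  refine h1.congr_fun (fun ξ hξ => ?_) hK.measurableSet
  have : φ ξ = 1 := φ.one_of_mem_closedBall (hKr hξ)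
  simp [cx, this]

lemma IsFourier.ae_eq {f : R3 → ℝ} {g g' : R3 → ℂ} (h : IsFourier f g) (h' : IsFourier f g') :
    g =ᵐ[volume] g' := by
  refine ae_eq_of_integral_contDiff_smul_eq h.locallyIntegrable h'.locallyIntegrable ?_
  intro φ hφ hφc
  have hc : HasCompactSupport (fun x => (φ x : ℂ)) := hφc.comp_left (g := fun y : ℝ => (y : ℂ)) rfl
  have hd : ContDiff ℝ (⊤ : ℕ∞) (fun x => (φ x : ℂ)) := Complex.ofRealCLM.contDiff.comp hφ
  have h1 := (h (hc.toSchwartzMap hd)).2.2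
  have h2 := (h' (hc.toSchwartzMap hd)).2.2
  rw [h1] at h2
  simpa [mul_comm] using h2

lemma isFourier_of_integrable {f : R3 → ℝ} (hf : Integrable f) : IsFourier f (𝓕 (cx f)) := by
  intro φ
  have hf' : Integrable (cx f) := hf.ofReal
  have hb : ∀ ξ, ‖𝓕 (cx f) ξ‖ ≤ ∫ x, ‖cx f x‖ := fun ξ => by
    exact VectorFourier.norm_fourierIntegral_le_integral_norm _ _ _ _ _
  have hc : Continuous (𝓕 (cx f)) :=
    VectorFourier.fourierIntegral_continuous Real.continuous_fourierChar (L := innerₗ R3) continuous_inner hf'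
  refine ⟨?_, ?_, ?_⟩
  · refine hf'.mul_bdd (c := ∫ x, ‖φ x‖) (𝓕 φ).continuous.aestronglyMeasurable (Eventually.of_forall fun ξ => ?_)
    exact VectorFourier.norm_fourierIntegral_le_integral_norm _ _ _ _ _
  · exact φ.integrable.bdd_mul hc.aestronglyMeasurable (Eventually.of_forall hb)
  · have := VectorFourier.integral_fourierIntegral_smul_eq_flip (L := innerₗ R3) (μ := volume)
      (ν := volume) Real.continuous_fourierChar continuous_inner hf' φ.integrable
    rw [flip_innerₗ] at this
    exact this.symm

/-- A test function as a complex Schwartz function. -/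
def IsTest.schwartz {f : R3 → ℝ} (hf : IsTest f) : 𝓢(R3, ℂ) :=
  (hf.2.comp_left (g := fun y : ℝ => (y : ℂ)) rfl : HasCompactSupport (cx f)).toSchwartzMap
    (Complex.ofRealCLM.contDiff.comp hf.1)

lemma IsTest.coe_schwartz {f : R3 → ℝ} (hf : IsTest f) : ⇑hf.schwartz = cx f := rfl

lemma IsTest.fourier_pd {f : R3 → ℝ} (hf : IsTest f) (q : Fin 3) (ξ : R3) :
    𝓕 (cx (GenEuler.pd q f)) ξ = (2 * Real.pi * Complex.I * ξ q) * 𝓕 (cx f) ξ := by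
  have hd : Differentiable ℝ (cx f) := Complex.ofRealCLM.differentiable.comp hf.differentiable
  have e : cx (GenEuler.pd q f) = ⇑(LineDeriv.lineDerivOp (EuclideanSpace.single q (1:ℝ)) hf.schwartz) := by
    funext x
    rw [SchwartzMap.lineDerivOp_apply_eq_fderiv, hf.coe_schwartz]
    have : HasFDerivAt (cx f) (Complex.ofRealCLM.comp (fderiv ℝ f x)) x :=
      Complex.ofRealCLM.hasFDerivAt.comp x (hf.differentiable x).hasFDerivAt
    rw [this.fderiv]
    rfl
  rw [e, ← SchwartzMap.fourier_coe, SchwartzMap.fourier_lineDerivOp_eq]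
  have ht : (fun x : R3 => inner ℝ x (EuclideanSpace.single q (1:ℝ))).HasTemperateGrowth := by fun_prop
  rw [smul_apply, SchwartzMap.smulLeftCLM_apply_apply ht,
    EuclideanSpace.inner_single_right, SchwartzMap.fourier_coe, hf.coe_schwartz]
  simp
  ring

lemma IsTest.fourier_iterate_pd {f : R3 → ℝ} (hf : IsTest f) (q : Fin 3) (n : ℕ) (ξ : R3) :
    𝓕 (cx ((GenEuler.pd q)^[n] f)) ξ = (2 * Real.pi * Complex.I * ξ q) ^ n * 𝓕 (cx f) ξ := by
  induction n with
  | zero => simp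
  | succ n ih =>
    rw [Function.iterate_succ_apply', (hf.pd_iterate q n).fourier_pd, ih]; ring

lemma lintegral_enorm_sq_eq {E : Type*} [NormedAddCommGroup E] {f : R3 → E} 
    (hf : Integrable fun x => ‖f x‖ ^ 2) :
    ∫⁻ x, ‖f x‖ₑ ^ 2 = ENNReal.ofReal (∫ x, ‖f x‖ ^ 2) := by
  rw [ofReal_integral_eq_lintegral_ofReal hf (Eventually.of_forall fun _ => by positivity)]
  congr 1; funext x
  rw [ENNReal.ofReal_pow (norm_nonneg _), ofReal_norm]

lemma integrable_schwartz_sq (f : 𝓢(R3, ℂ)) : Integrable fun x => ‖f x‖ ^ 2 :=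
  (memLp_two_iff_integrable_sq_norm f.continuous.aestronglyMeasurable).1 (f.memLp 2)

lemma IsTest.plancherel {f : R3 → ℝ} (hf : IsTest f) :
    ∫⁻ ξ, ‖𝓕 (cx f) ξ‖ₑ ^ 2 = ENNReal.ofReal (∫ x, f x ^ 2) := by
  have h1 := SchwartzMap.integral_norm_sq_fourier hf.schwartz
  have h2 := lintegral_enorm_sq_eq (integrable_schwartz_sq (𝓕 hf.schwartz))
  rw [h1] at h2
  rw [SchwartzMap.fourier_coe, hf.coe_schwartz] at h2
  rw [h2]
  simp [cx]

lemma eLpNorm_two_sq {E : Type*} [NormedAddCommGroup E] (f : R3 → E) :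
    eLpNorm f 2 volume ^ 2 = ∫⁻ x, ‖f x‖ₑ ^ 2 := by
  have := eLpNorm_nnreal_pow_eq_lintegral (μ := (volume : Measure R3)) (f := f) (p := 2) two_ne_zero
  simpa using this

lemma enorm_sq_eq_sum {𝕜 : Type*} [RCLike 𝕜] {ι : Type} [Fintype ι] (w : EuclideanSpace 𝕜 ι) :
    ‖w‖ₑ ^ 2 = ∑ i, ‖w i‖ₑ ^ 2 := by
  rw [← ofReal_norm, ← ENNReal.ofReal_pow (norm_nonneg _), EuclideanSpace.norm_sq_eq,
    ENNReal.ofReal_sum_of_nonneg (fun _ _ => by positivity)]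
  refine Finset.sum_congr rfl fun i _ => ?_
  rw [ENNReal.ofReal_pow (norm_nonneg _), ofReal_norm]

/-! ### Dyadic sums: integrability, weak derivatives and square integrals -/

/-- The partial sums of a dyadic sum. -/
def dyadicPart (c : ℕ → ℝ) (f : R3 → ℝ) (N : ℕ) (x : R3) : ℝ :=
  ∑ k ∈ Finset.range N, c k * dil (scale k) f x

lemma IsTest.dyadicPart {f : R3 → ℝ} (hf : IsTest f) (c : ℕ → ℝ) (N : ℕ) :
    IsTest (dyadicPart c f N) :=
  IsTest.sum fun k _ => (hf.dil (scale_pos k)).const_mul _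

lemma pd_dyadicPart {f : R3 → ℝ} (hf : IsTest f) (c : ℕ → ℝ) (N : ℕ) (i : Fin 3) :
    pd i (dyadicPart c f N) = dyadicPart (fun k => c k * (scale k)⁻¹) (pd i f) N := by
  funext x
  have h : ∀ k ∈ Finset.range N, DifferentiableAt ℝ (fun x => c k * dil (scale k) f x) x :=
    fun k _ => ((hf.dil (scale_pos k)).const_mul _).differentiable x
  unfold dyadicPart
  rw [pd, fderiv_fun_sum h, _root_.sum_apply]
  refine Finset.sum_congr rfl fun k _ => ?_
  rw [fderiv_const_mul ((hf.dil (scale_pos k)).differentiable x)]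
  have := pd_dil hf.differentiable (scale k) i x
  rw [pd] at this
  simp [this]
  ring

lemma iterate_pd_dyadicPart {f : R3 → ℝ} (hf : IsTest f) (c : ℕ → ℝ) (N : ℕ) (i : Fin 3) (p : ℕ) :
    (pd i)^[p] (dyadicPart c f N)
      = dyadicPart (fun k => c k * (scale k)⁻¹ ^ p) ((pd i)^[p] f) N := by
  induction p with
  | zero => simp
  | succ p ih =>
    rw [Function.iterate_succ_apply', ih, pd_dyadicPart (hf.pd_iterate i p),
      Function.iterate_succ_apply']
    congr 1; funext k; ring

lemma tendsto_dyadicPart {f : R3 → ℝ} (hf : SuppInBox f) (c : ℕ → ℝ) (x : R3) :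
    Tendsto (fun N => dyadicPart c f N x) atTop (𝓝 (dyadicSum c f x)) := by
  obtain ⟨N, hN⟩ := hf.exists_finite x
  refine tendsto_const_nhds.congr' ?_
  filter_upwards [eventually_ge_atTop N] with M hM
  exact dyadicSum_eq_sum (fun k hk => hN k (hM.trans hk)) c

lemma SuppInBox.eq_zero_of_norm {f : R3 → ℝ} (hf : SuppInBox f) {x : R3} (hx : 256 < ‖x‖) (k : ℕ) :
    dil (scale k) f x = 0 := by
  by_contra h
  have h1 := hf.norm_le _ h
  have hk := scale_pos k
  rw [norm_smul, norm_inv, Real.norm_eq_abs, abs_of_pos hk, inv_mul_eq_div, div_le_iff₀ hk] at h1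
  linarith [scale_le_one k]

lemma SuppInBox.dyadicPart_le {f : R3 → ℝ} (hf : SuppInBox f) {B : ℝ} (hB : 0 ≤ B)
    (hfB : ∀ x, |f x| ≤ B) {c : ℕ → ℝ} {M : ℝ} (hM : 0 ≤ M) (hc : ∀ k, |c k| ≤ M) (N : ℕ) (x : R3) :
    |dyadicPart c f N x| ≤ (Metric.closedBall (0 : R3) 256).indicator (fun _ => 2 * (M * B)) x := by
  by_cases hx : x ∈ Metric.closedBall (0 : R3) 256
  · rw [indicator_of_mem hx]
    refine (Finset.abs_sum_le_sum_abs _ _).trans ?_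
    refine sum_le_of_overlap (P := fun k => (scale k)⁻¹ • x ∈ streamBox)
      (fun k l => overlap_streamBox) _ (by positivity) ?_ ?_
    · intro k _ hk
      refine hf _ fun h => hk ?_
      rw [dil_apply, h, mul_zero, abs_zero]
    · intro k _ _
      rw [abs_mul]
      exact mul_le_mul (hc k) (hfB _) (abs_nonneg _) hM
  · rw [indicator_of_notMem hx]
    have : ∀ k, dil (scale k) f x = 0 := hf.eq_zero_of_norm (by simpa using hx)
    simp [dyadicPart, this]

lemma aestronglyMeasurable_dyadicSum {f : R3 → ℝ} (ht : IsTest f) (hf : SuppInBox f) (c : ℕ → ℝ) :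
    AEStronglyMeasurable (dyadicSum c f) volume :=
  aestronglyMeasurable_of_tendsto_ae atTop
    (fun N => (ht.dyadicPart c N).continuous.aestronglyMeasurable)
    (Eventually.of_forall fun x => tendsto_dyadicPart hf c x)

lemma integrable_ball_const (C : ℝ) :
    Integrable ((Metric.closedBall (0 : R3) 256).indicator (fun _ => C)) := by
  rw [integrable_indicator_iff measurableSet_closedBall]
  exact integrableOn_const measure_closedBall_lt_top.ne

lemma integrable_dyadicSum {f : R3 → ℝ} (ht : IsTest f) (hf : SuppInBox f) {c : ℕ → ℝ} {M : ℝ}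
    (hc : ∀ k, |c k| ≤ M) : Integrable (dyadicSum c f) := by
  obtain ⟨B, hB, hfB⟩ := ht.exists_bound
  refine (integrable_ball_const (2 * (M * B))).mono' (aestronglyMeasurable_dyadicSum ht hf c)
    (Eventually.of_forall fun x => ?_)
  exact le_of_tendsto (tendsto_dyadicPart hf c x).norm
    (Eventually.of_forall fun N => hf.dyadicPart_le hB hfB ((abs_nonneg _).trans (hc 0)) hc N x)

lemma tendsto_integral_dyadicPart {E : Type*} [NormedAddCommGroup E] [NormedSpace ℝ E]
    {f : R3 → ℝ} (ht : IsTest f) (hf : SuppInBox f) {c : ℕ → ℝ} {M : ℝ} (hc : ∀ k, |c k| ≤ M)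
    {h : R3 → E} (hh : AEStronglyMeasurable h) {D : ℝ} (hD : ∀ x, ‖h x‖ ≤ D) :
    Tendsto (fun N => ∫ x, dyadicPart c f N x • h x) atTop (𝓝 (∫ x, dyadicSum c f x • h x)) := by
  obtain ⟨B, hB, hfB⟩ := ht.exists_bound
  have hM : 0 ≤ M := (abs_nonneg _).trans (hc 0)
  refine tendsto_integral_of_dominated_convergence
    (fun x => (Metric.closedBall (0 : R3) 256).indicator (fun _ => 2 * (M * B)) x * D)
    (fun N => (ht.dyadicPart c N).continuous.aestronglyMeasurable.smul hh)
    ((integrable_ball_const _).mul_const D) (fun N => Eventually.of_forall fun x => ?_)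
    (Eventually.of_forall fun x => (tendsto_dyadicPart hf c x).smul_const _)
  rw [norm_smul]
  refine mul_le_mul (hf.dyadicPart_le hB hfB hM hc N x) (hD x) (norm_nonneg _)
    (indicator_nonneg (fun _ _ => by positivity) _)

lemma tendsto_fourier_dyadicPart {f : R3 → ℝ} (ht : IsTest f) (hf : SuppInBox f) {c : ℕ → ℝ} {M : ℝ}
    (hc : ∀ k, |c k| ≤ M) (ξ : R3) :
    Tendsto (fun N => 𝓕 (cx (dyadicPart c f N)) ξ) atTop (𝓝 (𝓕 (cx (dyadicSum c f)) ξ)) := by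
  have e : ∀ F : R3 → ℝ, 𝓕 (cx F) ξ = ∫ x, F x • (Real.fourierChar (-(inner ℝ x ξ)) : ℂ) := by
    intro F
    rw [Real.fourier_eq]
    refine integral_congr_ae (Eventually.of_forall fun x => ?_)
    simp only [cx, Circle.smul_def, smul_eq_mul, Complex.real_smul]
    ring
  simp only [e]
  refine tendsto_integral_dyadicPart ht hf hc ?_ (D := 1) fun x => (Circle.norm_coe _).le
  refine Continuous.aestronglyMeasurable ?_
  fun_prop

lemma integral_dyadicSum_mul_pd_pd {f φ : R3 → ℝ} (ht : IsTest f) (hf : tsupport f ⊆ streamBox)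
    {c : ℕ → ℝ} {M : ℝ} (hc : ∀ k, |c k| ≤ M) (hc' : ∀ k, |c k * (scale k)⁻¹ * (scale k)⁻¹| ≤ M)
    (hφ : IsTest φ) (i j : Fin 3) :
    ∫ x, dyadicSum c f x * pd i (pd j φ) x
      = ∫ x, dyadicSum (fun k => c k * (scale k)⁻¹ * (scale k)⁻¹) (pd j (pd i f)) x * φ x := by
  have hf' : SuppInBox (pd j (pd i f)) := suppInBox_of_tsupport
    (((tsupport_pd_subset _ _).trans (tsupport_pd_subset _ _)).trans hf)
  have h2 := (hφ.pd j).pd i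
  obtain ⟨D, _, hD⟩ := hφ.exists_bound
  obtain ⟨D2, _, hD2⟩ := h2.exists_bound
  refine tendsto_nhds_unique
    (tendsto_integral_dyadicPart ht (suppInBox_of_tsupport hf) hc h2.continuous.aestronglyMeasurable hD2) ?_
  refine (tendsto_integral_dyadicPart ((ht.pd i).pd j) hf' hc'
    hφ.continuous.aestronglyMeasurable hD).congr fun N => ?_
  have h3 := (ht.dyadicPart c N).integral_mul_pd (hφ.pd j) i
  have h4 := ((ht.dyadicPart c N).pd i).integral_mul_pd hφ j
  rw [pd_dyadicPart ht, pd_dyadicPart (ht.pd i)] at h4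
  rw [pd_dyadicPart ht] at h3
  simp only [smul_eq_mul]
  rw [h3, h4, neg_neg]

lemma integral_sq_dyadicPart_le {f : R3 → ℝ} (ht : IsTest f) (hf : SuppInBox f) (c : ℕ → ℝ) (N : ℕ) :
    ∫ x, dyadicPart c f N x ^ 2
      ≤ 2 * (∑ k ∈ Finset.range N, c k ^ 2 * scale k ^ 3) * ∫ x, f x ^ 2 := by
  have hi : ∀ k, Integrable fun x => (c k * dil (scale k) f x) ^ 2 := fun k => by
    have h := (ht.dil (scale_pos k)).const_mul (c k)
    simpa [sq] using (h.mul h.1).integrable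
  have h1 : ∫ x, dyadicPart c f N x ^ 2
      ≤ ∫ x, 2 * ∑ k ∈ Finset.range N, (c k * dil (scale k) f x) ^ 2 := by
    refine integral_mono_of_nonneg (Eventually.of_forall fun x => sq_nonneg _)
      ((integrable_finsetSum _ fun k _ => hi k).const_mul 2) (Eventually.of_forall fun x => ?_)
    refine sq_sum_le_of_overlap (P := fun k => (scale k)⁻¹ • x ∈ streamBox)
      (fun k l => overlap_streamBox) _ ?_
    intro k _ hk
    refine hf _ fun h => hk ?_
    rw [dil_apply, h, mul_zero]
  refine h1.trans_eq ?_
  rw [integral_const_mul, integral_finsetSum _ fun k _ => hi k, mul_assoc, Finset.sum_mul]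
  congr 1
  refine Finset.sum_congr rfl fun k _ => ?_
  have := integral_dil (scale_pos k) (fun x => f x ^ 2)
  simp only [mul_pow, integral_const_mul]
  rw [show ∫ x, dil (scale k) f x ^ 2 = _ from this]
  ring

/-! ### Square-summability of the sensor readings -/

/-- The layer in which the sensor at scale `k` reads. -/
def sensLayer (k : ℕ) : Set R3 := {x | 3 * scale k < x 2 ∧ x 2 < 4 * scale k}

lemma measurableSet_sensLayer (k : ℕ) : MeasurableSet (sensLayer k) :=
  ((isOpen_lt continuous_const (contDiff_coord 2).continuous).inter
    (isOpen_lt (contDiff_coord 2).continuous continuous_const)).measurableSet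

/-- As the sensor is an axial derivative of order `100`, its reading of `w` at scale `r` is `r ^ p`
times a reading of `∂₀ ^ p w`. -/
lemma sens_eq_iterate {w : R3 → ℝ} (hw : IsTest w) (k : ℕ) {p : ℕ} (hp : p ≤ 100) :
    sens k w = (-1) ^ p * (scale k ^ p *
      ∫ y, dil (scale k) (presensor (100 - p)) y * (pd 0)^[p] w y) := by
  have hk := scale_pos k
  have e : sensor = (pd 0)^[p] (presensor (100 - p)) := by
    rw [iterate_pd_presensor, sensor]; congr 1; omega
  have h1 : ∀ y, dil (scale k) sensor y
      = scale k ^ p * (pd 0)^[p] (dil (scale k) (presensor (100 - p))) y := by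
    intro y
    rw [iterate_pd_dil (isTest_presensor _), e, dil_apply, ← mul_assoc, ← mul_pow,
      mul_inv_cancel₀ hk.ne', one_pow, one_mul]
  simp only [sens, h1, mul_assoc]
  rw [integral_const_mul, ((isTest_presensor _).dil hk).integral_iterate_pd_mul hw]
  ring

lemma sq_integral_mul_le {f h : R3 → ℝ} (hf : Integrable fun x => f x ^ 2)
    (hh : Integrable fun x => h x ^ 2) (hfh : Integrable fun x => f x * h x) :
    (∫ x, f x * h x) ^ 2 ≤ (∫ x, f x ^ 2) * ∫ x, h x ^ 2 := by
  have key : ∀ t : ℝ, 0 ≤ (∫ x, f x ^ 2) * (t * t) + (2 * ∫ x, f x * h x) * t + ∫ x, h x ^ 2 := by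
    intro t
    have h0 : 0 ≤ ∫ x, (t * f x + h x) ^ 2 := integral_nonneg fun x => sq_nonneg _
    have e : ∀ x, (t * f x + h x) ^ 2 = (t ^ 2 * f x ^ 2 + 2 * t * (f x * h x)) + h x ^ 2 :=
      fun x => by ring
    simp only [e] at h0
    have hadd : Integrable fun x => t ^ 2 * f x ^ 2 + 2 * t * (f x * h x) :=
      (hf.const_mul _).add (hfh.const_mul _)
    rw [integral_add hadd hh,
      integral_add (hf.const_mul _) (hfh.const_mul _), integral_const_mul, integral_const_mul] at h0
    linarith
  have := discrim_le_zero key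
  rw [discrim] at this
  linarith

lemma sq_sens_le {w : R3 → ℝ} (hw : IsTest w) (k : ℕ) {p : ℕ} (hp : p ≤ 100) :
    sens k w ^ 2 ≤ scale k ^ (2 * p + 3) * (∫ y, presensor (100 - p) y ^ 2) *
      ∫ y, (sensLayer k).indicator (fun y => (pd 0)^[p] w y ^ 2) y := by
  have hk := scale_pos k
  set ψ := dil (scale k) (presensor (100 - p)) with hψ
  set h := (pd 0)^[p] w with hh
  have hψt : IsTest ψ := (isTest_presensor _).dil hk
  have hht : IsTest h := hw.pd_iterate 0 p
  have h1 : ∀ y, ψ y * h y = ψ y * (sensLayer k).indicator h y := by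
    intro y
    by_cases hy : y ∈ sensLayer k
    · rw [indicator_of_mem hy]
    · rw [indicator_of_notMem hy, mul_zero]
      have : ψ y = 0 := by
        by_contra h0
        obtain ⟨_, _, h2, h3⟩ := presensor_ne_zero h0
        simp only [smul_coord] at h2 h3
        rw [inv_mul_eq_div, lt_div_iff₀ hk] at h2
        rw [inv_mul_eq_div, div_lt_iff₀ hk] at h3
        exact hy ⟨h2, h3⟩
      rw [this, zero_mul]
  have e2 : ∀ y, (sensLayer k).indicator (fun y => h y ^ 2) y = (sensLayer k).indicator h y ^ 2 := by
    intro y; by_cases hy : y ∈ sensLayer k <;> simp [hy]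
  have h3 : (∫ y, ψ y * h y) ^ 2 ≤ (∫ y, ψ y ^ 2) * ∫ y, (sensLayer k).indicator h y ^ 2 := by
    simp only [h1]
    refine sq_integral_mul_le ?_ ?_ ?_
    · simpa [sq] using (hψt.mul hψt.1).integrable
    · simp only [← e2]
      refine Integrable.indicator ?_ (measurableSet_sensLayer k)
      simpa [sq] using (hht.mul hht.1).integrable
    · simp only [← h1]
      exact (hψt.mul hht.1).integrable
  rw [sens_eq_iterate hw k hp, mul_pow, ← pow_mul, mul_comm p 2, pow_mul, neg_one_sq, one_pow, one_mul, mul_pow]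
  have e1 : ∫ y, ψ y ^ 2 = scale k ^ 3 * ∫ y, presensor (100 - p) y ^ 2 :=
    integral_dil hk (fun y => presensor (100 - p) y ^ 2)
  simp only [e2]
  calc (scale k ^ p) ^ 2 * (∫ y, ψ y * h y) ^ 2
      ≤ (scale k ^ p) ^ 2 * ((∫ y, ψ y ^ 2) * ∫ y, (sensLayer k).indicator h y ^ 2) := by gcongr
    _ = _ := by rw [e1]; ring

lemma sum_layer_le {h : R3 → ℝ} (hh : Integrable fun y => h y ^ 2) (N : ℕ) :
    ∑ k ∈ Finset.range N, ∫ y, (sensLayer k).indicator (fun y => h y ^ 2) y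
      ≤ 2 * ∫ y, h y ^ 2 := by
  have hi : ∀ k ∈ Finset.range N, Integrable ((sensLayer k).indicator fun y => h y ^ 2) :=
    fun k _ => hh.indicator (measurableSet_sensLayer k)
  rw [← integral_finsetSum _ hi, ← integral_const_mul]
  refine integral_mono (integrable_finsetSum _ hi) (hh.const_mul 2) fun y => ?_
  refine sum_le_of_overlap (P := fun k => y ∈ sensLayer k) ?_ _ (sq_nonneg _) ?_ ?_
  · rintro k l ⟨h1, h2⟩ ⟨h3, h4⟩
    by_contra hl
    have := scale_le_div (show k < l by omega)
    linarith [scale_pos k]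
  · intro k _ hk; exact mem_of_indicator_ne_zero hk
  · intro k _ hk; rw [indicator_of_mem hk]

/-- A Bessel inequality: the axial derivatives of dyadic sums whose coefficients are sensor readings
are controlled by those of the field that is read. -/
lemma exists_integral_sq_iterate_le {f : R3 → ℝ} (ht : IsTest f) (hf : tsupport f ⊆ streamBox) :
    ∃ C : ℝ, 0 ≤ C ∧ ∀ p ≤ 100, ∀ (q : Fin 3) (w : R3 → ℝ), IsTest w → ∀ N,
      ∫ x, (pd q)^[p] (dyadicPart (fun k => (scale k)⁻¹ ^ 3 * sens k w) f N) x ^ 2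
        ≤ C * ∫ x, (pd 0)^[p] w x ^ 2 := by
  set D : ℕ → Fin 3 → ℝ := fun p q =>
    4 * ((∫ y, presensor (100 - p) y ^ 2) * ∫ x, (pd q)^[p] f x ^ 2) with hD
  have hint : ∀ g : R3 → ℝ, 0 ≤ ∫ x, g x ^ 2 := fun g => integral_nonneg fun x => sq_nonneg _
  have hD0 : ∀ p q, 0 ≤ D p q := fun p q => by
    have := hint (presensor (100 - p)); have := hint ((pd q)^[p] f); positivity
  refine ⟨∑ p ∈ Finset.range 101, ∑ q, D p q, Finset.sum_nonneg fun p _ =>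
    Finset.sum_nonneg fun q _ => hD0 p q, ?_⟩
  intro p hp q w hw N
  have hDle : D p q ≤ ∑ p ∈ Finset.range 101, ∑ q, D p q :=
    (Finset.single_le_sum (f := fun q => D p q) (fun q _ => hD0 p q) (Finset.mem_univ q)).trans
      (Finset.single_le_sum (f := fun p => ∑ q, D p q) (fun p _ => Finset.sum_nonneg fun q _ => hD0 p q)
        (Finset.mem_range.2 (by omega)))
  refine le_trans ?_ (mul_le_mul_of_nonneg_right hDle (hint _))
  have hsupp : ∀ n, tsupport ((pd q)^[n] f) ⊆ streamBox := by
    intro n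
    induction n with
    | zero => exact hf
    | succ n ih => rw [Function.iterate_succ_apply']; exact (tsupport_pd_subset _ _).trans ih
  rw [iterate_pd_dyadicPart ht]
  refine (integral_sq_dyadicPart_le (ht.pd_iterate q p) (suppInBox_of_tsupport (hsupp p)) _ N).trans ?_
  have hwi : Integrable fun y => (pd 0)^[p] w y ^ 2 := by
    have h := hw.pd_iterate 0 p
    simpa [sq] using (h.mul h.1).integrable
  have h1 : ∑ k ∈ Finset.range N, ((scale k)⁻¹ ^ 3 * sens k w * (scale k)⁻¹ ^ p) ^ 2 * scale k ^ 3
      ≤ (∫ y, presensor (100 - p) y ^ 2) * (2 * ∫ x, (pd 0)^[p] w x ^ 2) := by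
    refine le_trans ?_ (mul_le_mul_of_nonneg_left (sum_layer_le hwi N) (hint _))
    rw [Finset.mul_sum]
    refine Finset.sum_le_sum fun k _ => ?_
    have hk := scale_pos k
    have h2 := sq_sens_le hw k hp
    calc ((scale k)⁻¹ ^ 3 * sens k w * (scale k)⁻¹ ^ p) ^ 2 * scale k ^ 3
        = ((scale k)⁻¹ * scale k) ^ 3 * ((scale k)⁻¹ ^ (2 * p + 3)) * sens k w ^ 2 := by ring
      _ = ((scale k)⁻¹ ^ (2 * p + 3)) * sens k w ^ 2 := by
          rw [inv_mul_cancel₀ hk.ne', one_pow, one_mul]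
      _ ≤ ((scale k)⁻¹ ^ (2 * p + 3)) * (scale k ^ (2 * p + 3) * (∫ y, presensor (100 - p) y ^ 2) *
          ∫ y, (sensLayer k).indicator (fun y => (pd 0)^[p] w y ^ 2) y) := by gcongr
      _ = _ := by rw [inv_pow]; field_simp
  calc _ ≤ 2 * ((∫ y, presensor (100 - p) y ^ 2) * (2 * ∫ x, (pd 0)^[p] w x ^ 2)) *
        ∫ x, (pd q)^[p] f x ^ 2 := by gcongr
    _ = _ := by rw [hD]; ring

/-! ### The Sobolev bounds for the operator -/

lemma lintegral_enorm_sq_le_of_tendsto {E : Type*} [NormedAddCommGroup E] {F : ℕ → R3 → E} {f : R3 → E}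
    (hF : ∀ n, Continuous (F n)) (hlim : ∀ x, Tendsto (fun n => F n x) atTop (𝓝 (f x)))
    {B : ℝ≥0∞} (hB : ∀ n, ∫⁻ x, ‖F n x‖ₑ ^ 2 ≤ B) : ∫⁻ x, ‖f x‖ₑ ^ 2 ≤ B := by
  have h1 : ∀ x, ‖f x‖ₑ ^ 2 = liminf (fun n => ‖F n x‖ₑ ^ 2) atTop := fun x =>
    (((ENNReal.continuous_pow 2).tendsto _).comp
      ((continuous_enorm.tendsto _).comp (hlim x))).liminf_eq.symm
  simp only [h1]
  refine (lintegral_liminf_le fun n => ?_).trans ?_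
  · exact (((ENNReal.continuous_pow 2).comp (continuous_enorm.comp (hF n)))).measurable
  · exact liminf_le_of_le (by isBoundedDefault) fun b hb => by
      obtain ⟨n, hn⟩ := hb.exists
      exact hn.trans (hB n)

lemma continuous_fourier_of_integrable {f : R3 → ℝ} (hf : Integrable f) : Continuous (𝓕 (cx f)) :=
  VectorFourier.fourierIntegral_continuous Real.continuous_fourierChar (L := innerₗ R3)
    continuous_inner hf.ofReal

lemma norm_pow_le_sum (ξ : R3) (p : ℕ) : (‖ξ‖ ^ p) ^ 2 ≤ 3 ^ p * ∑ q, (|ξ q| ^ p) ^ 2 := by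
  obtain ⟨m, -, hm⟩ := Finset.exists_max_image Finset.univ (fun q => |ξ q|) Finset.univ_nonempty
  have h1 : ‖ξ‖ ^ 2 ≤ 3 * |ξ m| ^ 2 := by
    rw [EuclideanSpace.norm_sq_eq]
    refine (Finset.sum_le_card_nsmul _ _ (|ξ m| ^ 2) fun q _ => ?_).trans (by simp)
    rw [Real.norm_eq_abs]
    exact pow_le_pow_left₀ (abs_nonneg _) (hm q (Finset.mem_univ q)) 2
  calc (‖ξ‖ ^ p) ^ 2 = (‖ξ‖ ^ 2) ^ p := by ring
    _ ≤ (3 * |ξ m| ^ 2) ^ p := by gcongr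
    _ = 3 ^ p * (|ξ m| ^ p) ^ 2 := by ring
    _ ≤ _ := by
        gcongr
        exact Finset.single_le_sum (f := fun q => (|ξ q| ^ p) ^ 2) (fun q _ => by positivity)
          (Finset.mem_univ m)

lemma IsTest.lintegral_enorm_sq {f : R3 → ℝ} (hf : IsTest f) :
    ∫⁻ x, ‖f x‖ₑ ^ 2 = ENNReal.ofReal (∫ x, f x ^ 2) := by
  have h := lintegral_enorm_sq_eq (f := f) (by simpa [sq] using (hf.mul hf.1).integrable)
  simpa using h

lemma IsTest.lintegral_weight_fourier_le {f : R3 → ℝ} (hf : IsTest f) (p : ℕ) :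
    ∫⁻ ξ, ‖(((2 * Real.pi * ‖ξ‖) ^ p : ℝ) : ℂ) * 𝓕 (cx f) ξ‖ₑ ^ 2
      ≤ 3 ^ p * ∑ q, ENNReal.ofReal (∫ x, (GenEuler.pd q)^[p] f x ^ 2) := by
  simp only [← (hf.pd_iterate _ p).plancherel]
  rw [← lintegral_finsetSum' _ fun q _ => ?_, ← lintegral_const_mul' _ _ (by finiteness)]
  · refine lintegral_mono fun ξ => ?_
    have h : ∀ q, ‖𝓕 (cx ((GenEuler.pd q)^[p] f)) ξ‖ₑ ^ 2
        = ENNReal.ofReal (((2 * Real.pi) ^ p * |ξ q| ^ p * ‖𝓕 (cx f) ξ‖) ^ 2) := by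
      intro q
      rw [hf.fourier_iterate_pd, ← ofReal_norm, ← ENNReal.ofReal_pow (norm_nonneg _)]
      congr 2
      simp [abs_of_pos Real.pi_pos, mul_pow]
    simp only [h]
    rw [← ENNReal.ofReal_sum_of_nonneg (fun _ _ => by positivity), ← ofReal_norm,
      ← ENNReal.ofReal_pow (norm_nonneg _), show (3 : ℝ≥0∞) ^ p = ENNReal.ofReal (3 ^ p) by
        rw [ENNReal.ofReal_pow (by norm_num)]; norm_num, ← ENNReal.ofReal_mul (by positivity)]
    refine ENNReal.ofReal_le_ofReal ?_
    have h2 := norm_pow_le_sum ξ p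
    rw [norm_mul, Complex.norm_real, Real.norm_eq_abs, abs_of_nonneg (by positivity)]
    calc ((2 * Real.pi * ‖ξ‖) ^ p * ‖𝓕 (cx f) ξ‖) ^ 2
        = ((2 * Real.pi) ^ p * ‖𝓕 (cx f) ξ‖) ^ 2 * (‖ξ‖ ^ p) ^ 2 := by ring
      _ ≤ ((2 * Real.pi) ^ p * ‖𝓕 (cx f) ξ‖) ^ 2 * (3 ^ p * ∑ q, (|ξ q| ^ p) ^ 2) := by gcongr
      _ = _ := by
          rw [Finset.mul_sum, Finset.mul_sum, Finset.mul_sum]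
          exact Finset.sum_congr rfl fun q _ => by ring
  · have hc := continuous_fourier_of_integrable (hf.pd_iterate q p).integrable
    exact ((ENNReal.continuous_pow 2).comp (continuous_enorm.comp hc)).measurable.aemeasurable

lemma abs_sens_le {w : R3 → ℝ} {B : ℝ} (hB : ∀ x, |w x| ≤ B) (k : ℕ) :
    |sens k w| ≤ scale k ^ 3 * (B * ∫ x, |sensor x|) := by
  have h1 : Integrable fun y => |dil (scale k) sensor y| * B :=
    ((isTest_sensor.dil (scale_pos k)).integrable.abs).mul_const B
  have h2 : |sens k w| ≤ ∫ y, |dil (scale k) sensor y| * B := by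
    rw [sens, ← Real.norm_eq_abs]
    refine norm_integral_le_of_norm_le h1 (Eventually.of_forall fun y => ?_)
    rw [Real.norm_eq_abs, abs_mul]
    exact mul_le_mul_of_nonneg_left (hB y) (abs_nonneg _)
  refine h2.trans_eq ?_
  have h3 : ∫ y, |dil (scale k) sensor y| = scale k ^ 3 * ∫ x, |sensor x| :=
    integral_dil (scale_pos k) (fun y => |sensor y|)
  rw [integral_mul_const, h3]
  ring

lemma exists_coeff_bound {w : R3 → ℝ} (hw : IsTest w) : ∃ M, ∀ n ≤ 3, ∀ k,
    |(scale k)⁻¹ ^ n * sens k w| ≤ M := by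
  obtain ⟨B, hB, hwB⟩ := hw.exists_bound
  refine ⟨B * ∫ x, |sensor x|, fun n hn k => ?_⟩
  have hk := scale_pos k
  have hI : 0 ≤ B * ∫ x, |sensor x| := mul_nonneg hB (integral_nonneg fun _ => abs_nonneg _)
  rw [abs_mul, abs_of_pos (by positivity)]
  calc (scale k)⁻¹ ^ n * |sens k w|
      ≤ (scale k)⁻¹ ^ n * (scale k ^ 3 * (B * ∫ x, |sensor x|)) := by
        gcongr; exact abs_sens_le hwB k
    _ = scale k ^ (3 - n) * (B * ∫ x, |sensor x|) := by
        rw [show scale k ^ 3 = scale k ^ n * scale k ^ (3 - n) by rw [← pow_add]; congr 1; omega,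
          inv_pow]
        field_simp
    _ ≤ 1 * (B * ∫ x, |sensor x|) := by
        gcongr; exact pow_le_one₀ hk.le (scale_le_one k)
    _ = _ := one_mul _

/-- The `L²` and homogeneous Sobolev bounds for one entry of the second derivative. -/
lemma exists_dyadicSum_bound {f : R3 → ℝ} (ht : IsTest f) (hf : tsupport f ⊆ streamBox) :
    ∃ C : ℝ≥0, ∀ p ≤ 100, ∀ w : R3 → ℝ, IsTest w →
      ∫⁻ x, ‖dyadicSum (fun k => (scale k)⁻¹ ^ 3 * sens k w) f x‖ₑ ^ 2 ≤ C * ∫⁻ x, ‖w x‖ₑ ^ 2 ∧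
      ∫⁻ ξ, ‖(((2 * Real.pi * ‖ξ‖) ^ p : ℝ) : ℂ) *
          𝓕 (cx (dyadicSum (fun k => (scale k)⁻¹ ^ 3 * sens k w) f)) ξ‖ₑ ^ 2
        ≤ C * ∫⁻ ξ, ‖𝓕 (cx ((pd 0)^[p] w)) ξ‖ₑ ^ 2 := by
  obtain ⟨C, hC, h⟩ := exists_integral_sq_iterate_le ht hf
  have hs := suppInBox_of_tsupport hf
  refine ⟨3 ^ 101 * C.toNNReal, fun p hp w hw => ⟨?_, ?_⟩⟩
  · refine lintegral_enorm_sq_le_of_tendsto (fun N => (ht.dyadicPart _ N).continuous)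
      (tendsto_dyadicPart hs _) fun N => ?_
    rw [(ht.dyadicPart _ N).lintegral_enorm_sq, hw.lintegral_enorm_sq]
    have h1 := ENNReal.ofReal_le_ofReal (h 0 (by norm_num) 0 w hw N)
    simp only [Function.iterate_zero, id_eq] at h1
    refine h1.trans ?_
    rw [ENNReal.ofReal_mul hC]
    gcongr
    rw [ENNReal.ofReal]
    norm_cast
    exact le_mul_of_one_le_left (by positivity) (Nat.one_le_cast.2 (Nat.one_le_pow _ _ (by norm_num)))
  · obtain ⟨M, hM⟩ := exists_coeff_bound hw
    refine lintegral_enorm_sq_le_of_tendsto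
      (F := fun N ξ => (((2 * Real.pi * ‖ξ‖) ^ p : ℝ) : ℂ) * 𝓕 (cx (dyadicPart _ f N)) ξ)
      (fun N => ?_) (fun ξ => (tendsto_fourier_dyadicPart ht hs (hM 3 le_rfl) ξ).const_mul _)
      fun N => ?_
    · have := continuous_fourier_of_integrable
        (ht.dyadicPart (fun k => (scale k)⁻¹ ^ 3 * sens k w) N).integrable
      fun_prop
    · refine ((ht.dyadicPart _ N).lintegral_weight_fourier_le p).trans ?_
      rw [(hw.pd_iterate 0 p).plancherel]
      calc _ ≤ (3 : ℝ≥0∞) ^ p * ∑ q : Fin 3, ENNReal.ofReal (C * ∫ x, (pd 0)^[p] w x ^ 2) := by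
            gcongr with q; exact h p hp q w hw N
        _ = 3 ^ (p + 1) * ENNReal.ofReal C * ENNReal.ofReal (∫ x, (pd 0)^[p] w x ^ 2) := by
            rw [ENNReal.ofReal_mul hC]; simp; ring
        _ ≤ _ := by
            gcongr
            rw [ENNReal.ofReal]
            norm_cast
            gcongr
            · norm_num
            · omega

lemma homNorm_sq_le {ι : Type} [Fintype ι] {f : R3 → EuclideanSpace ℝ ι}
    (hf : ∀ i, Integrable fun x => f x i) (p : ℕ) :
    homNorm p f ^ 2
      ≤ ∑ i, ∫⁻ ξ, ‖(((2 * Real.pi * ‖ξ‖) ^ p : ℝ) : ℂ) * 𝓕 (cx fun x => f x i) ξ‖ₑ ^ 2 := by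
  have h1 : homNorm p f ≤ eLpNorm (fun ξ => (((2 * Real.pi * ‖ξ‖) ^ p : ℝ) : ℂ) •
      (WithLp.toLp 2 fun i => 𝓕 (cx fun x => f x i) ξ : EuclideanSpace ℂ ι)) 2 volume :=
    iInf₂_le (fun ξ => WithLp.toLp 2 fun i => 𝓕 (cx fun x => f x i) ξ)
      (fun i => isFourier_of_integrable (hf i))
  refine (pow_le_pow_left₀ (by positivity) h1 2).trans_eq ?_
  rw [eLpNorm_two_sq]
  simp only [enorm_sq_eq_sum]
  rw [lintegral_finsetSum']
  · simp
  · intro i _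
    have := continuous_fourier_of_integrable (hf i)
    refine Measurable.aemeasurable (Continuous.measurable ?_)
    refine (ENNReal.continuous_pow 2).comp (continuous_enorm.comp ?_)
    simp only [PiLp.smul_apply, smul_eq_mul]
    fun_prop

lemma lintegral_fourier_iterate_le_homNorm (ω : CcB2) (i j q : Fin 3) (p : ℕ) :
    ∫⁻ ξ, ‖𝓕 (cx ((pd q)^[p] (comp ω.1 i j))) ξ‖ₑ ^ 2 ≤ homNorm p (tens ω.1) ^ 2 := by
  have hw := isTest_comp ω i j
  rw [← eLpNorm_two_sq]
  refine pow_le_pow_left₀ (by positivity) (le_iInf₂ fun g hg => ?_) 2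
  have h1 := (isFourier_of_integrable hw.integrable).ae_eq (hg (i, j))
  refine eLpNorm_mono_ae ?_
  filter_upwards [h1] with ξ hξ
  rw [hw.fourier_iterate_pd, hξ, norm_smul, norm_mul]
  refine mul_le_mul ?_ (PiLp.norm_apply_le _ _) (norm_nonneg _) (norm_nonneg _)
  rw [norm_pow, Complex.norm_real, Real.norm_eq_abs, abs_of_nonneg (by positivity)]
  refine pow_le_pow_left₀ (norm_nonneg _) ?_ p
  simp only [norm_mul, Complex.norm_ofNat, Complex.norm_real, Complex.norm_I, mul_one,
    Real.norm_eq_abs, abs_of_pos Real.pi_pos]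
  gcongr
  exact abs_coord_le ξ q

lemma sobNorm_le {ι κ : Type} [Fintype ι] [Fintype κ] {p : ℕ} {f : R3 → EuclideanSpace ℝ ι}
    {h : R3 → EuclideanSpace ℝ κ} {C : ℝ≥0}
    (h0 : eLpNorm f 2 volume ^ 2 ≤ C ^ 2 * eLpNorm h 2 volume ^ 2)
    (h1 : homNorm p f ^ 2 ≤ C ^ 2 * homNorm p h ^ 2) : sobNorm p f ≤ C * sobNorm p h := by
  unfold sobNorm
  have : (C : ℝ≥0∞) = ((C : ℝ≥0∞) ^ 2) ^ (1 / 2 : ℝ) := by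
    rw [← ENNReal.rpow_natCast, ← ENNReal.rpow_mul]; norm_num
  rw [this, ← ENNReal.mul_rpow_of_nonneg _ _ (by norm_num : (0:ℝ) ≤ 1 / 2)]
  refine ENNReal.rpow_le_rpow ?_ (by norm_num)
  rw [mul_add]
  exact add_le_add h0 h1

/-- The second derivative of the potential. -/
def hessian (w : R3 → ℝ) (x : R3) : EuclideanSpace ℝ ((Fin 3 × Fin 3) × (Fin 3 × Fin 3)) :=
  WithLp.toLp 2 fun I => (e01 : Ten2) I.2 *
    dyadicSum (fun k => (scale k)⁻¹ ^ 3 * sens k w) (pd I.1.2 (pd I.1.1 stream)) x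

lemma abs_e01_le (I : Fin 3 × Fin 3) : |(e01 : Ten2) I| ≤ 1 := by
  simp only [e01]
  split_ifs <;> simp

lemma tsupport_pd_pd_stream (i j : Fin 3) : tsupport (pd j (pd i stream)) ⊆ streamBox :=
  ((tsupport_pd_subset _ _).trans (tsupport_pd_subset _ _)).trans tsupport_stream_subset

lemma integrable_hessian {w : R3 → ℝ} (hw : IsTest w) (I) : Integrable fun x => hessian w x I := by
  obtain ⟨M, hM⟩ := exists_coeff_bound hw
  exact (integrable_dyadicSum ((isTest_stream.pd _).pd _)
    (suppInBox_of_tsupport (tsupport_pd_pd_stream _ _)) (hM 3 le_rfl)).const_mul _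

lemma isWeakHessian (ω : CcB2) : IsWeakHessian (potentialOp ω) (hessian (comp ω.1 0 2)) := by
  intro i j a b
  have hw := isTest_comp ω 0 2
  obtain ⟨M, hM⟩ := exists_coeff_bound hw
  have e : comp (potentialOp ω) a b = fun x => (e01 : Ten2) (a, b) *
      dyadicSum (fun k => (scale k)⁻¹ * sens k (comp ω.1 0 2)) stream x := by
    funext x
    simp [comp, potentialOp_apply, mul_comm]
  have hM1 := hM 1 (by norm_num)
  simp only [pow_one] at hM1
  rw [e]
  refine ⟨((integrable_dyadicSum isTest_stream suppInBox_stream hM1).const_mul _).locallyIntegrable,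
    (integrable_hessian hw _).locallyIntegrable, fun φ hφ => ?_⟩
  have e3 : ∀ k, (scale k)⁻¹ * sens k (comp ω.1 0 2) * (scale k)⁻¹ * (scale k)⁻¹
      = (scale k)⁻¹ ^ 3 * sens k (comp ω.1 0 2) := fun k => by ring
  have h := integral_dyadicSum_mul_pd_pd isTest_stream tsupport_stream_subset hM1
    (fun k => by rw [e3]; exact hM 3 le_rfl k) hφ i j
  simp only [e3] at h
  simp only [hessian, mul_assoc]
  rw [integral_const_mul, integral_const_mul, h]

lemma sobolev_spec : ∃ C : ℝ≥0, ∀ p ≤ 100, ∀ ω : CcB2, ∃ G, IsWeakHessian (potentialOp ω) G ∧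
    sobNorm p G ≤ C * sobNorm p (tens ω.1) := by
  choose C hC using fun i j => exists_dyadicSum_bound ((isTest_stream.pd i).pd j)
    (tsupport_pd_pd_stream i j)
  set S : ℝ≥0 := ∑ I : (Fin 3 × Fin 3) × (Fin 3 × Fin 3), C I.1.1 I.1.2 with hS
  refine ⟨NNReal.sqrt S, fun p hp ω => ⟨_, isWeakHessian ω, ?_⟩⟩
  have hw := isTest_comp ω 0 2
  have hsq : ((NNReal.sqrt S : ℝ≥0) : ℝ≥0∞) ^ 2 = S := by
    norm_cast; exact NNReal.sq_sqrt S
  have hone : ∀ I : Fin 3 × Fin 3, ‖(e01 : Ten2) I‖ₑ ^ 2 ≤ 1 := by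
    intro I
    rw [← ofReal_norm, ← ENNReal.ofReal_pow (norm_nonneg _), ← ENNReal.ofReal_one]
    exact ENNReal.ofReal_le_ofReal (pow_le_one₀ (norm_nonneg _) (abs_e01_le I))
  refine sobNorm_le ?_ ?_
  · rw [eLpNorm_two_sq, eLpNorm_two_sq, hsq]
    simp only [enorm_sq_eq_sum (𝕜 := ℝ) (hessian _ _)]
    rw [lintegral_finsetSum' _ fun I _ => ((integrable_hessian hw I).1.enorm.pow_const 2)]
    rw [hS, ENNReal.ofNNReal_finsetSum, Finset.sum_mul]
    refine Finset.sum_le_sum fun I _ => ?_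
    calc ∫⁻ x, ‖hessian (comp ω.1 0 2) x I‖ₑ ^ 2
        ≤ ∫⁻ x, ‖dyadicSum (fun k => (scale k)⁻¹ ^ 3 * sens k (comp ω.1 0 2))
            (pd I.1.2 (pd I.1.1 stream)) x‖ₑ ^ 2 := by
          refine lintegral_mono fun x => ?_
          simp only [hessian, enorm_mul, mul_pow]
          exact mul_le_of_le_one_left (by positivity) (hone I.2)
      _ ≤ C I.1.1 I.1.2 * ∫⁻ x, ‖comp ω.1 0 2 x‖ₑ ^ 2 := (hC I.1.1 I.1.2 p hp _ hw).1
      _ ≤ C I.1.1 I.1.2 * ∫⁻ x, ‖tens ω.1 x‖ₑ ^ 2 := by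
          gcongr with x
          exact enorm_le_iff_norm_le.2 (PiLp.norm_apply_le (tens ω.1 x) (0, 2))
  · rw [hsq]
    refine (homNorm_sq_le (integrable_hessian hw) p).trans ?_
    rw [hS, ENNReal.ofNNReal_finsetSum, Finset.sum_mul]
    refine Finset.sum_le_sum fun I _ => ?_
    have e : ∀ ξ, 𝓕 (cx fun x => hessian (comp ω.1 0 2) x I) ξ = ((e01 : Ten2) I.2 : ℂ) *
        𝓕 (cx (dyadicSum (fun k => (scale k)⁻¹ ^ 3 * sens k (comp ω.1 0 2))
            (pd I.1.2 (pd I.1.1 stream)))) ξ := by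
      intro ξ
      rw [Real.fourier_eq, Real.fourier_eq, ← integral_const_mul]
      refine integral_congr_ae (Eventually.of_forall fun x => ?_)
      simp only [cx, hessian, Circle.smul_def, smul_eq_mul, Complex.ofReal_mul]
      ring
    calc _ ≤ ∫⁻ ξ, ‖(((2 * Real.pi * ‖ξ‖) ^ p : ℝ) : ℂ) *
          𝓕 (cx (dyadicSum (fun k => (scale k)⁻¹ ^ 3 * sens k (comp ω.1 0 2))
            (pd I.1.2 (pd I.1.1 stream)))) ξ‖ₑ ^ 2 := by
          refine lintegral_mono fun ξ => ?_
          rw [e, mul_left_comm, enorm_mul, mul_pow]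
          refine mul_le_of_le_one_left (by positivity) ?_
          have := hone I.2
          rwa [← ofReal_norm, ← Complex.norm_real, ofReal_norm] at this
      _ ≤ C I.1.1 I.1.2 * ∫⁻ ξ, ‖𝓕 (cx ((pd 0)^[p] (comp ω.1 0 2))) ξ‖ₑ ^ 2 :=
          (hC I.1.1 I.1.2 p hp _ hw).2
      _ ≤ _ := by gcongr; exact lintegral_fourier_iterate_le_homNorm ω 0 2 0 p

lemma isReasonable_potentialOp : IsReasonable 100 potentialOp := ⟨kernel_spec 100, sobolev_spec⟩

/-! ### Closed forms `dθ ∧ dx_m` and the failure of self-adjointness -/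

lemma pd_comm {f : R3 → ℝ} (hf : ContDiff ℝ (⊤ : ℕ∞) f) (i j : Fin 3) :
    pd i (pd j f) = pd j (pd i f) := by
  funext x
  have hd : DifferentiableAt ℝ (fderiv ℝ f) x :=
    (hf.fderiv_right (m := (⊤ : ℕ∞)) (by simp)).differentiable (by simp) x
  have h : ∀ i j : Fin 3, pd i (pd j f) x
      = fderiv ℝ (fderiv ℝ f) x (EuclideanSpace.single i 1) (EuclideanSpace.single j 1) := by
    intro i j
    have : HasFDerivAt (pd j f) ((ContinuousLinearMap.apply ℝ ℝ (EuclideanSpace.single j (1:ℝ))).comp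
        (fderiv ℝ (fderiv ℝ f) x)) x :=
      (ContinuousLinearMap.apply ℝ ℝ (EuclideanSpace.single j (1:ℝ))).hasFDerivAt.comp x hd.hasFDerivAt
    rw [pd, this.fderiv]
    rfl
  have hs : IsSymmSndFDerivAt ℝ f x :=
    (hf.contDiffAt (x := x)).isSymmSndFDerivAt (by
      simp only [minSmoothness_of_isRCLikeNormedField]
      exact WithTop.coe_le_coe.2 (le_top : (2 : ℕ∞) ≤ ⊤))
  rw [h, h, hs]

/-- The constant form `dx_i ∧ dx_m`. -/
def wedge (i m : Fin 3) : Alt2 :=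
  ⟨WithLp.toLp 2 fun p => (if p.1 = i then 1 else 0) * (if p.2 = m then 1 else 0)
    - (if p.1 = m then 1 else 0) * (if p.2 = i then 1 else 0), by
    intro a b; simp only; ring⟩

/-- The closed form `dθ ∧ dx_m`. -/
def gradForm (m : Fin 3) (θ : R3 → ℝ) (x : R3) : Alt2 := ∑ i, pd i θ x • wedge i m

lemma comp_gradForm (m : Fin 3) (θ : R3 → ℝ) (a b : Fin 3) : comp (gradForm m θ) a b
    = fun x => (if b = m then 1 else 0) * pd a θ x - (if a = m then 1 else 0) * pd b θ x := by
  funext x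
  simp only [comp, gradForm, wedge, Submodule.coe_sum, Submodule.coe_smul, PiLp.smul_apply, WithLp.ofLp_sum,
    Finset.sum_apply, smul_eq_mul, mul_sub, Finset.sum_sub_distrib]
  congr 1
  · simp
  · simp

lemma gradForm_mem (m : Fin 3) {θ : R3 → ℝ} (hθ : IsTest θ) : gradForm m θ ∈ CcB2 := by
  refine ⟨?_, ?_, ?_⟩
  · exact ContDiff.sum fun i _ => (hθ.pd i).1.smul contDiff_const
  · refine HasCompactSupport.intro' (K := tsupport θ) hθ.2 (isClosed_tsupport _) fun x hx => ?_
    have : ∀ i, pd i θ x = 0 := fun i => by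
      by_contra h
      exact hx (tsupport_pd_subset θ i (subset_tsupport _ h))
    simp [gradForm, this]
  · intro x i j k
    have key : ∀ l a b, pd l (comp (gradForm m θ) a b) x
        = (if b = m then 1 else 0) * pd l (pd a θ) x - (if a = m then 1 else 0) * pd l (pd b θ) x := by
      intro l a b
      have h1 := ((hθ.pd a).differentiable x)
      have h2 := ((hθ.pd b).differentiable x)
      rw [comp_gradForm, pd, fderiv_fun_sub (h1.const_mul _) (h2.const_mul _),
        fderiv_const_mul h1, fderiv_const_mul h2]
      simp only [sub_apply, smul_apply, smul_eq_mul, pd]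
    simp only [extD2, key]
    rw [pd_comm hθ.1 j i, pd_comm hθ.1 k i, pd_comm hθ.1 k j]
    ring

lemma pairing_smul_e01 (ω : R3 → Alt2) (c : R3 → ℝ) (x : R3) :
    pairing ω (fun x => c x • e01) x = comp ω 0 1 x * c x := by
  have h : comp ω 1 0 x = - comp ω 0 1 x := (ω x).2 1 0
  simp [pairing, Fin.sum_univ_three, comp, e01] at h ⊢
  rw [h]; ring

lemma sens_eq_zero_of_layer {k : ℕ} {w : R3 → ℝ} (hw : ∀ x, w x ≠ 0 → x ∉ sensLayer k) :
    sens k w = 0 := by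
  have hk := scale_pos k
  refine integral_eq_zero_of_ae (Eventually.of_forall fun y => ?_)
  by_contra h
  obtain ⟨_, _, h2, h3⟩ := presensor_ne_zero (left_ne_zero_of_mul h)
  simp only [smul_coord] at h2 h3
  rw [inv_mul_eq_div, lt_div_iff₀ hk] at h2
  rw [inv_mul_eq_div, div_lt_iff₀ hk] at h3
  exact hw y (right_ne_zero_of_mul h) ⟨h2, h3⟩

/-- A form that is read by the sensor at scale `0` produces a stream function at height `|x₂| ≤ 2r₀`;
its own `01`-component vanishes, so that the pairing with any potential is zero. -/
lemma not_formallySelfAdjoint : ¬ FormallySelfAdjoint potentialOp := by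
  intro h
  have hr := scale_pos 0
  set θ := dil (scale 0) density with hθ
  have hθt : IsTest θ := isTest_density.dil hr
  set S := dil (scale 0) stream with hS
  have hSt : IsTest S := isTest_stream.dil hr
  set ω : CcB2 := ⟨gradForm 2 θ, gradForm_mem 2 hθt⟩ with hω
  set ω' : CcB2 := ⟨gradForm 1 (pd 0 S), gradForm_mem 1 (hSt.pd 0)⟩ with hω'
  have h1 := h ω ω'
  have e1 : comp ω.1 0 1 = fun _ => 0 := by
    rw [hω, comp_gradForm]; simp
  have e2 : comp ω.1 0 2 = pd 0 θ := by
    rw [hω, comp_gradForm]; simp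
  have e3 : comp ω'.1 0 1 = pd 0 (pd 0 S) := by
    rw [hω', comp_gradForm]; simp
  have e4 : ∀ (ω : CcB2), potentialOp ω = fun x =>
      dyadicSum (fun k => (scale k)⁻¹ * sens k (comp ω.1 0 2)) stream x • e01 :=
    fun ω => funext (potentialOp_apply ω)
  have hs : ∀ k, k ≠ 0 → sens k (pd 0 θ) = 0 := by
    intro k hk
    refine sens_eq_zero_of_layer fun x hx hx' => ?_
    have h2 : x ∈ tsupport θ := tsupport_pd_subset θ 0 (subset_tsupport _ hx)
    have h3 : tsupport θ ⊆ {x | 3 * scale 0 ≤ x 2} := by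
      refine closure_minimal (fun y hy => ?_)
        (isClosed_le continuous_const (contDiff_coord 2).continuous)
      have h4 := (density_ne_zero hy).2.2.1
      simp only [smul_coord] at h4
      rw [inv_mul_eq_div, lt_div_iff₀ hr] at h4
      exact h4.le
    have h5 : 3 * scale 0 ≤ x 2 := h3 h2
    have h6 := scale_le_div (Nat.pos_of_ne_zero hk)
    linarith [hx'.2]
  have hs0 : sens 0 (pd 0 θ) ≠ 0 := by
    have hb := (isTest_sensor.dil hr)
    rw [sens, hb.integral_mul_pd hθt, ← integral_neg]
    have e5 : ∀ y, -(pd 0 (dil (scale 0) sensor) y * θ y)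
        = ((scale 0)⁻¹ * mass⁻¹) * dil (scale 0) (fun y => density y ^ 2) y := by
      intro y
      rw [pd_dil isTest_sensor.differentiable, hθ]
      simp only [dil_apply]
      by_cases hd : density ((scale 0)⁻¹ • y) = 0
      · rw [hd]; ring
      · rw [pd_sensor (by linarith [(density_ne_zero hd).1.1])]; ring
    simp only [e5]
    rw [integral_const_mul, integral_dil hr]
    have hp : 0 < ∫ x, density x ^ 2 := by
      refine (integral_pos_iff_support_of_nonneg (fun x => sq_nonneg _) ?_).2 ?_
      · simpa [sq] using (isTest_density.mul isTest_density.1).integrable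
      · have : Function.support (fun x => density x ^ 2) = Function.support density := by
          ext x; simp
        rw [this, ← integral_pos_iff_support_of_nonneg density_nonneg isTest_density.integrable]
        exact mass_pos
    have := mass_pos
    positivity
  have e6 : ∀ x, dyadicSum (fun k => (scale k)⁻¹ * sens k (pd 0 θ)) stream x
      = ((scale 0)⁻¹ * sens 0 (pd 0 θ)) * S x := by
    intro x
    refine tsum_eq_single 0 fun k hk => ?_
    simp only [hs k hk]; ring
  rw [e4, e4] at h1
  simp only [pairing_smul_e01, e1, e2, e3, e6, zero_mul, integral_zero] at h1
  have h2 : ∫ x, pd 0 S x * pd 0 S x = 0 := by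
    have h3 := hSt.integral_mul_pd (hSt.pd 0) 0
    have h4 : ∀ x, pd 0 (pd 0 S) x * ((scale 0)⁻¹ * sens 0 (pd 0 θ) * S x)
        = ((scale 0)⁻¹ * sens 0 (pd 0 θ)) * (S x * pd 0 (pd 0 S) x) := fun x => by ring
    simp only [h4] at h1
    rw [integral_const_mul, h3] at h1
    have h5 : (scale 0)⁻¹ * sens 0 (pd 0 θ) ≠ 0 := mul_ne_zero (inv_ne_zero hr.ne') hs0
    simpa [h5] using h1.symm
  have h3 : ∀ x, pd 0 S x = 0 := by
    have h4 := (hSt.pd 0).continuous.mul (hSt.pd 0).continuous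
    have h5 := (integral_eq_zero_iff_of_nonneg (fun x => mul_self_nonneg (pd 0 S x))
      ((hSt.pd 0).mul (hSt.pd 0).1).integrable).1 h2
    have h6 := (Continuous.ae_eq_iff_eq volume h4 continuous_zero).1 h5
    intro x
    exact mul_self_eq_zero.1 (congrFun h6 x)
  set L : ℝ → R3 := fun t => WithLp.toLp 2 ![t, scale 0, 0] with hL
  have hLd : ∀ t, HasDerivAt L (EuclideanSpace.single 0 1) t := by
    intro t
    have e : L = fun t => t • EuclideanSpace.single (0 : Fin 3) (1 : ℝ) + L 0 := by
      funext t; ext i; fin_cases i <;> simp [hL]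
    rw [e]
    simpa using ((hasDerivAt_id t).smul_const (EuclideanSpace.single (0 : Fin 3) (1 : ℝ))).add_const (L 0)
  have h4 : ∀ t, HasDerivAt (S ∘ L) 0 t := by
    intro t
    have := (hSt.differentiable (L t)).hasFDerivAt.comp_hasDerivAt t (hLd t)
    rwa [show fderiv ℝ S (L t) (EuclideanSpace.single 0 1) = 0 from h3 (L t)] at this
  have h5 := is_const_of_deriv_eq_zero (f := S ∘ L) (fun t => (h4 t).differentiableAt)
    (fun t => (h4 t).deriv) 0 (scale 0)
  have h6 : (scale 0)⁻¹ * scale 0 = 1 := inv_mul_cancel₀ hr.ne'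
  simp only [Function.comp, hS, hL, dil_apply, stream, prod3, smul_coord] at h5
  simp only [Matrix.cons_val_zero, Matrix.cons_val_one, Matrix.cons_val, mul_zero, h6] at h5
  rw [gProf_eq_zero_left (by norm_num), gProf_eq_one (by norm_num) (by norm_num),
    qProf_eq (by norm_num), chiProf_eq_one (by norm_num)] at h5
  norm_num at h5

/-! ### The initial data -/

/-- The potential `θ₀` of the initial data: `1` on the box swept out by the blowup. -/
def initPot : R3 → ℝ := prod3
  (lineBump (9 / 2 * scale 0) (7 / 2 * scale 0) (4 * scale 0)
    (by linarith [scale_pos 0]) (by linarith [scale_pos 0]))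
  (lineBump 0 (scale 0) (2 * scale 0) (scale_pos 0) (by linarith [scale_pos 0]))
  (lineBump 0 (5 * scale 0) (6 * scale 0) (by linarith [scale_pos 0]) (by linarith [scale_pos 0]))

lemma initPot_ne_zero {x : R3} (h : initPot x ≠ 0) :
    (scale 0 / 2 ≤ x 0 ∧ x 0 ≤ 9 * scale 0) ∧ |x 1| ≤ 9 * scale 0 ∧ |x 2| ≤ 9 * scale 0 := by
  have hr := scale_pos 0
  have h0 := lineBump_ne_zero _ _ (left_ne_zero_of_mul (left_ne_zero_of_mul h))
  have h1 := lineBump_ne_zero _ _ (right_ne_zero_of_mul (left_ne_zero_of_mul h))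
  have h2 := lineBump_ne_zero _ _ (right_ne_zero_of_mul h)
  refine ⟨⟨?_, ?_⟩, abs_le.2 ⟨?_, ?_⟩, abs_le.2 ⟨?_, ?_⟩⟩ <;> linarith [h0.1, h0.2, h1.1, h1.2, h2.1, h2.2]

lemma isTest_initPot : IsTest initPot := by
  refine isTest_of_box (contDiff_prod3 (ContDiffBump.contDiff _) (ContDiffBump.contDiff _)
    (ContDiffBump.contDiff _)) (C := 9 * scale 0) fun x hx => ?_
  have hr := scale_pos 0
  obtain ⟨⟨h1, h2⟩, h3, h4⟩ := initPot_ne_zero hx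
  intro i
  fin_cases i
  · exact abs_le.2 ⟨by simp only [Fin.zero_eta]; linarith, h2⟩
  · exact h3
  · exact h4

lemma initPot_eq_one {x : R3} (h0 : scale 0 ≤ x 0) (h0' : x 0 ≤ 8 * scale 0) (h1 : |x 1| ≤ scale 0)
    (h2 : |x 2| ≤ 5 * scale 0) : initPot x = 1 := by
  rw [abs_le] at h1 h2
  rw [initPot, prod3, lineBump_eq_one _ _ (by linarith) (by linarith),
    lineBump_eq_one _ _ (by linarith) (by linarith), lineBump_eq_one _ _ (by linarith) (by linarith)]
  norm_num

lemma initPot_nonneg (x : R3) : 0 ≤ initPot x :=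
  mul_nonneg (mul_nonneg (ContDiffBump.nonneg _) (ContDiffBump.nonneg _)) (ContDiffBump.nonneg _)

lemma initPot_le_one (x : R3) : initPot x ≤ 1 :=
  mul_le_one₀ (mul_le_one₀ (ContDiffBump.le_one _) (ContDiffBump.nonneg _) (ContDiffBump.le_one _))
    (ContDiffBump.nonneg _) (ContDiffBump.le_one _)

/-- The initial data `ω₀ = dθ₀ ∧ dx₂`. -/
def initForm : CcB2 := ⟨gradForm 2 initPot, gradForm_mem 2 isTest_initPot⟩

lemma tsupport_initForm_subset : tsupport initForm.1 ⊆ {x | scale 0 / 2 ≤ x 0} := by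
  have h1 : tsupport initPot ⊆ {x | scale 0 / 2 ≤ x 0} :=
    closure_minimal (fun y hy => (initPot_ne_zero hy).1.1)
      (isClosed_le continuous_const (contDiff_coord 0).continuous)
  refine closure_minimal (fun y hy => ?_)
      (isClosed_le continuous_const (contDiff_coord 0).continuous)
  by_contra hy'
  have : ∀ i, pd i initPot y = 0 := fun i => by
    by_contra h
    exact hy' (h1 (tsupport_pd_subset _ i (subset_tsupport _ h)))
  exact hy (by simp [initForm, gradForm, this])

/-! ### Sobolev embedding -/

lemma exists_isFourier_of_memLp {f : R3 → ℝ} (hf : MemLp f 2 volume) :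
    ∃ g : R3 → ℂ, IsFourier f g ∧ MemLp g 2 volume ∧ eLpNorm g 2 volume = eLpNorm f 2 volume := by
  have hf' : MemLp (cx f) 2 volume := hf.ofReal
  set F := hf'.toLp with hF
  set G : Lp ℂ 2 (volume : Measure R3) := 𝓕 F with hG
  refine ⟨G, fun φ => ⟨?_, ?_, ?_⟩, Lp.memLp G, ?_⟩
  · exact hf'.integrable_mul ((𝓕 φ).memLp 2)
  · exact (Lp.memLp G).integrable_mul (φ.memLp 2)
  · have h := congrArg (fun T => T φ) (Lp.fourier_toTemperedDistribution_eq F)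
    simp only [TemperedDistribution.fourier_apply, Lp.toTemperedDistribution_apply] at h
    rw [← hG] at h
    simp only [smul_eq_mul, mul_comm (φ _)] at h
    rw [← h]
    refine integral_congr_ae ?_
    filter_upwards [hf'.coeFn_toLp] with x hx
    rw [hF, hx, mul_comm]
    rfl
  · have h : ‖G‖ = ‖F‖ := Lp.norm_fourier_eq F
    rw [Lp.norm_def, Lp.norm_def, ENNReal.toReal_eq_toReal_iff' (Lp.eLpNorm_ne_top _)
      (Lp.eLpNorm_ne_top _), hF, eLpNorm_congr_ae hf'.coeFn_toLp] at h
    rw [h]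
    exact eLpNorm_congr_norm_ae (Eventually.of_forall fun x => by simp [cx])

/-- The weight `(2π|ξ|)^s ĝ` of the homogeneous Sobolev norm. -/
def weight {E : Type*} [SMul ℂ E] (s : ℕ) (g : R3 → E) (ξ : R3) : E :=
  (((2 * Real.pi * ‖ξ‖) ^ s : ℝ) : ℂ) • g ξ

lemma norm_weight (s : ℕ) (g : R3 → ℂ) (ξ : R3) :
    ‖weight s g ξ‖ = (2 * Real.pi * ‖ξ‖) ^ s * ‖g ξ‖ := by
  rw [weight, norm_smul, Complex.norm_real, Real.norm_eq_abs, abs_of_nonneg (by positivity)]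

lemma memLp_inv_sq : MemLp (fun ξ : R3 => ((1 + ‖ξ‖) ^ 2)⁻¹) 2 volume := by
  have hc : Continuous fun ξ : R3 => ((1 + ‖ξ‖) ^ 2)⁻¹ :=
    Continuous.inv₀ (by fun_prop) fun ξ => by positivity
  rw [memLp_two_iff_integrable_sq hc.aestronglyMeasurable]
  have h := integrable_one_add_norm (E := R3) (μ := volume) (r := 4) (by
    rw [finrank_euclideanSpace_fin]; norm_num)
  refine h.congr (Eventually.of_forall fun ξ => ?_)
  simp only
  rw [Real.rpow_neg (by positivity), inv_pow, ← pow_mul]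
  norm_cast

/-- The Fourier transform of a function in `H^{10}(ℝ³)` has an integrable first moment. -/
lemma exists_fourier_moment_le : ∃ C : ℝ≥0, ∀ g : R3 → ℂ, AEStronglyMeasurable g volume →
    eLpNorm (fun ξ => ((1 + ‖ξ‖ : ℝ) : ℂ) * g ξ) 1 volume
      ≤ C * (eLpNorm g 2 volume + eLpNorm (weight 10 g) 2 volume) := by
  set j : R3 → ℝ := fun ξ => ((1 + ‖ξ‖) ^ 2)⁻¹ with hj
  have hjm : MemLp j 2 volume := memLp_inv_sq
  refine ⟨(eLpNorm j 2 volume).toNNReal * 8, fun g hg => ?_⟩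
  have hwm : AEStronglyMeasurable (weight 10 g) volume := by
    have hc : Continuous fun ξ : R3 => (((2 * Real.pi * ‖ξ‖) ^ 10 : ℝ) : ℂ) := by fun_prop
    exact hc.aestronglyMeasurable.smul hg
  have e : (fun ξ => ((1 + ‖ξ‖ : ℝ) : ℂ) * g ξ) = j • fun ξ => (((1 + ‖ξ‖) ^ 3 : ℝ) : ℂ) * g ξ := by
    funext ξ
    have h1 : (1 + ‖ξ‖ : ℝ) = j ξ * (1 + ‖ξ‖) ^ 3 := by
      rw [hj]; field_simp
    rw [Pi.smul_apply', Complex.real_smul, ← mul_assoc, ← Complex.ofReal_mul, ← h1]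
  rw [e]
  have h1 : eLpNorm (fun ξ => (((1 + ‖ξ‖) ^ 3 : ℝ) : ℂ) * g ξ) 2 volume
      ≤ 8 * (eLpNorm g 2 volume + eLpNorm (weight 10 g) 2 volume) := by
    have h2 : eLpNorm (fun ξ => (((1 + ‖ξ‖) ^ 3 : ℝ) : ℂ) * g ξ) 2 volume
        ≤ eLpNorm (fun ξ => (8 : ℝ) • (‖g ξ‖ + ‖weight 10 g ξ‖)) 2 volume := by
      refine eLpNorm_mono_real fun ξ => ?_
      rw [norm_weight, norm_mul, Complex.norm_real, Real.norm_eq_abs,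
        abs_of_nonneg (by positivity), smul_eq_mul]
      have h0 := norm_nonneg ξ
      have h3 : (1 + ‖ξ‖) ^ 3 ≤ 8 * (1 + (2 * Real.pi * ‖ξ‖) ^ 10) := by
        rcases le_total ‖ξ‖ 1 with h | h
        · have : (1 + ‖ξ‖) ^ 3 ≤ 2 ^ 3 := by gcongr; linarith
          have : 0 ≤ (2 * Real.pi * ‖ξ‖) ^ 10 := by positivity
          linarith
        · have h4 : (1 + ‖ξ‖) ^ 3 ≤ (2 * ‖ξ‖) ^ 3 := by gcongr; linarith
          have h5 : ‖ξ‖ ^ 3 ≤ ‖ξ‖ ^ 10 := pow_le_pow_right₀ h (by norm_num)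
          have h6 : ‖ξ‖ ^ 10 ≤ (2 * Real.pi * ‖ξ‖) ^ 10 := by
            gcongr
            nlinarith [Real.pi_gt_three]
          nlinarith
      calc _ ≤ 8 * (1 + (2 * Real.pi * ‖ξ‖) ^ 10) * ‖g ξ‖ := by gcongr
        _ = _ := by ring
    refine h2.trans ?_
    have h3 := eLpNorm_const_smul (8 : ℝ) (fun ξ => ‖g ξ‖ + ‖weight 10 g ξ‖) 2 (volume : Measure R3)
    refine h3.le.trans ?_
    have h4 : ‖(8 : ℝ)‖ₑ = 8 := by
      rw [← ofReal_norm]; norm_num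
    rw [h4]
    gcongr
    refine (eLpNorm_add_le hg.norm hwm.norm (by norm_num)).trans_eq ?_
    rw [eLpNorm_norm, eLpNorm_norm]
  refine (eLpNorm_smul_le_mul_eLpNorm (p := 2) (q := 2) (r := 1) ?_ hjm.1).trans ?_
  · refine AEStronglyMeasurable.mul (Continuous.aestronglyMeasurable ?_) hg
    fun_prop
  · rw [ENNReal.coe_mul, ENNReal.coe_toNNReal hjm.2.ne, mul_assoc]
    gcongr
    exact_mod_cast h1

lemma cx_eq_fourierInv {f : R3 → ℝ} (hf : Continuous f) {g : R3 → ℂ} (h : IsFourier f g)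
    (hg : Integrable g) : cx f = 𝓕⁻ g := by
  have hgc : Continuous (𝓕⁻ g) := by
    rw [Real.fourierInv_eq_fourier_comp_neg]
    exact VectorFourier.fourierIntegral_continuous Real.continuous_fourierChar (L := innerₗ R3)
      continuous_inner hg.comp_neg
  have hfc : Continuous (cx f) := Complex.continuous_ofReal.comp hf
  refine (Continuous.ae_eq_iff_eq volume hfc hgc).1 ?_
  refine ae_eq_of_integral_contDiff_smul_eq hfc.locallyIntegrable hgc.locallyIntegrable ?_
  intro φ hφ hφc
  set ψ := IsTest.schwartz ⟨hφ, hφc⟩ with hψ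
  have h1 := (h (𝓕⁻ ψ)).2.2
  rw [FourierTransform.fourier_fourierInv_eq] at h1
  have h2 : ∫ ξ, g ξ * 𝓕⁻ ψ ξ = ∫ x, 𝓕⁻ g x * ψ x := by
    have h3 := VectorFourier.integral_fourierIntegral_smul_eq_flip (L := -innerₗ R3) (μ := volume)
      (ν := volume) (f := g) (g := ψ) Real.continuous_fourierChar (by
        simp only [LinearMap.neg_apply, innerₗ_apply_apply]; fun_prop) hg ψ.integrable
    simp only [smul_eq_mul] at h3
    have e1 : ∀ x, VectorFourier.fourierIntegral Real.fourierChar volume (-innerₗ R3) g x = 𝓕⁻ g x :=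
      fun x => by rfl
    have e2 : ∀ x, VectorFourier.fourierIntegral Real.fourierChar volume (-innerₗ R3).flip ψ x = 𝓕⁻ ψ x := by
      intro x
      rw [SchwartzMap.fourierInv_coe]
      rw [show (-innerₗ R3).flip = -innerₗ R3 by ext x y; simp [real_inner_comm]]
      rfl
    simp only [e1, e2] at h3
    exact h3.symm
  rw [h2] at h1
  have e : ∀ x, ψ x = (φ x : ℂ) := fun x => rfl
  simp only [e] at h1
  simpa [cx, mul_comm] using h1

/-- The Sobolev embedding `H^{10} ⊆ C¹`, for a function given by its Fourier transform. -/
lemma exists_sobolev_scalar : ∃ C : ℝ≥0, ∀ (f : R3 → ℝ) (g : R3 → ℂ), Continuous f →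
    MemLp f 2 volume → IsFourier f g → eLpNorm (weight 10 g) 2 volume < ∞ →
    Differentiable ℝ f ∧ (∀ q, Continuous (pd q f)) ∧
    (∀ x, ‖f x‖ₑ ≤ C * (eLpNorm f 2 volume + eLpNorm (weight 10 g) 2 volume)) ∧
    ∀ q x, ‖pd q f x‖ₑ ≤ C * (eLpNorm f 2 volume + eLpNorm (weight 10 g) 2 volume) := by
  obtain ⟨C, hC⟩ := exists_fourier_moment_le
  refine ⟨(2 * Real.pi).toNNReal * C, fun f g hf hf2 hfg hw => ?_⟩
  obtain ⟨g', hg', hg'2, hgn⟩ := exists_isFourier_of_memLp hf2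
  have hae : g =ᵐ[volume] g' := hfg.ae_eq hg'
  have hgm : AEStronglyMeasurable g volume := hg'2.1.congr hae.symm
  have hB := hC g hgm
  rw [eLpNorm_congr_ae hae, hgn] at hB
  set B := eLpNorm f 2 volume + eLpNorm (weight 10 g) 2 volume with hBdef
  have hBtop : B ≠ ∞ := by
    rw [hBdef]; exact ENNReal.add_ne_top.2 ⟨hf2.2.ne, hw.ne⟩
  set m : R3 → ℂ := fun ξ => ((1 + ‖ξ‖ : ℝ) : ℂ) * g ξ with hm
  have hmi : Integrable m := by
    rw [← memLp_one_iff_integrable]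
    refine ⟨AEStronglyMeasurable.mul (Continuous.aestronglyMeasurable (by fun_prop)) hgm, ?_⟩
    exact hB.trans_lt (by finiteness)
  have hmn : ∀ ξ, ‖m ξ‖ = (1 + ‖ξ‖) * ‖g ξ‖ := fun ξ => by
    rw [hm]; simp only
    rw [norm_mul, Complex.norm_real, Real.norm_eq_abs, abs_of_nonneg (by positivity)]
  have hgi : Integrable g := hmi.mono hgm (Eventually.of_forall fun ξ => by
    rw [hmn]; exact le_mul_of_one_le_left (norm_nonneg _) (by linarith [norm_nonneg ξ]))
  have hvgi : Integrable fun ξ => ‖ξ‖ * ‖g ξ‖ := by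
    refine hmi.norm.mono' ?_ (Eventually.of_forall fun ξ => ?_)
    · exact continuous_norm.aestronglyMeasurable.mul hgm.norm
    · rw [hmn, Real.norm_eq_abs, abs_of_nonneg (by positivity)]
      gcongr; linarith
  have hfe : ∀ x, cx f x = 𝓕 g (-x) := fun x => by
    rw [cx_eq_fourierInv hf hfg hgi, Real.fourierInv_eq_fourier_neg]
  set D := VectorFourier.fourierSMulRight (innerSL ℝ) g with hD
  have hDi : Integrable D := by
    refine (hvgi.const_mul (2 * Real.pi * ‖innerSL ℝ (E := R3)‖)).mono' ?_ (Eventually.of_forall fun ξ => ?_)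
    · exact hgm.fourierSMulRight
    · exact (VectorFourier.norm_fourierSMulRight_le _ _ _).trans_eq (by ring)
  have hder : ∀ x, HasFDerivAt (cx f) ((𝓕 D (-x)).comp (-ContinuousLinearMap.id ℝ R3)) x := by
    intro x
    have h1 := (Real.hasFDerivAt_fourier hgi hvgi (-x)).comp x
      ((hasFDerivAt_id (𝕜 := ℝ) x).neg)
    have e : cx f = 𝓕 g ∘ fun x => -x := funext hfe
    rw [e]
    exact h1
  have hfd : ∀ x, HasFDerivAt f (Complex.reCLM.comp ((𝓕 D (-x)).comp (-ContinuousLinearMap.id ℝ R3))) x := by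
    intro x
    exact Complex.reCLM.hasFDerivAt.comp x (hder x)
  have hDc : Continuous (𝓕 D) :=
    VectorFourier.fourierIntegral_continuous Real.continuous_fourierChar (L := innerₗ R3)
      continuous_inner hDi
  have hpd : ∀ q x, pd q f x = (𝓕 D (-x) (-(EuclideanSpace.single q 1))).re := by
    intro q x
    rw [pd, (hfd x).fderiv]
    rfl
  have hIm : ENNReal.ofReal (∫ ξ, ‖m ξ‖) ≤ C * B := by
    rw [ofReal_integral_norm_eq_lintegral_enorm hmi, ← eLpNorm_one_eq_lintegral_enorm]
    exact hB
  have h2pi : (1 : ℝ) ≤ 2 * Real.pi := by linarith [Real.pi_gt_three]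
  have hfin : ∀ y : ℝ, |y| ≤ 2 * Real.pi * ∫ ξ, ‖m ξ‖ →
      ‖y‖ₑ ≤ ((2 * Real.pi).toNNReal * C : ℝ≥0) * B := by
    intro y hy
    rw [← ofReal_norm, Real.norm_eq_abs, ENNReal.coe_mul, mul_assoc]
    refine (ENNReal.ofReal_le_ofReal hy).trans ?_
    rw [ENNReal.ofReal_mul (by positivity)]
    exact mul_le_mul' le_rfl hIm
  have hI0 : 0 ≤ ∫ ξ, ‖m ξ‖ := integral_nonneg fun _ => norm_nonneg _
  refine ⟨fun x => (hfd x).differentiableAt, fun q => ?_, fun x => hfin _ ?_, fun q x => hfin _ ?_⟩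
  · have : pd q f = fun x => (𝓕 D (-x) (-(EuclideanSpace.single q 1))).re := funext (hpd q)
    rw [this]
    exact Complex.continuous_re.comp ((hDc.comp continuous_neg).clm_apply continuous_const)
  · have h1 : |f x| = ‖𝓕 g (-x)‖ := by rw [← hfe]; simp [cx]
    rw [h1]
    have h2 : ‖𝓕 g (-x)‖ ≤ ∫ ξ, ‖g ξ‖ := VectorFourier.norm_fourierIntegral_le_integral_norm _ _ _ _ _
    have h3 : ∫ ξ, ‖g ξ‖ ≤ ∫ ξ, ‖m ξ‖ := integral_mono hgi.norm hmi.norm fun ξ => by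
      simp only [hmn]; exact le_mul_of_one_le_left (norm_nonneg _) (by linarith [norm_nonneg ξ])
    nlinarith
  · rw [hpd]
    refine (Complex.abs_re_le_norm _).trans ?_
    refine (ContinuousLinearMap.le_opNorm _ _).trans ?_
    rw [norm_neg, show ‖EuclideanSpace.single q (1 : ℝ)‖ = 1 by simp, mul_one]
    have h2 : ‖𝓕 D (-x)‖ ≤ ∫ ξ, ‖D ξ‖ := VectorFourier.norm_fourierIntegral_le_integral_norm _ _ _ _ _
    refine h2.trans ?_
    rw [← integral_const_mul]
    refine integral_mono hDi.norm (hmi.norm.const_mul _) fun ξ => ?_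
    refine (VectorFourier.norm_fourierSMulRight_le _ _ _).trans ?_
    simp only [hmn]
    have h3 : ‖innerSL ℝ (E := R3)‖ ≤ 1 := norm_innerSL_le ℝ
    calc 2 * Real.pi * ‖innerSL ℝ (E := R3)‖ * ‖ξ‖ * ‖g ξ‖
        ≤ 2 * Real.pi * 1 * (1 + ‖ξ‖) * ‖g ξ‖ := by gcongr; linarith
      _ = _ := by ring

lemma homNorm_eq {ι : Type} [Fintype ι] {s : ℕ} {f : R3 → EuclideanSpace ℝ ι}
    {g : R3 → EuclideanSpace ℂ ι} (hg : ∀ i, IsFourier (fun x => f x i) (fun ξ => g ξ i)) :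
    homNorm s f = eLpNorm (weight s g) 2 volume := by
  refine le_antisymm (iInf₂_le g hg) (le_iInf₂ fun g' hg' => le_of_eq ?_)
  refine eLpNorm_congr_ae ?_
  have h : ∀ᵐ ξ, ∀ i, g ξ i = g' ξ i := ae_all_iff.2 fun i => (hg i).ae_eq (hg' i)
  filter_upwards [h] with ξ hξ
  rw [weight]
  congr 1
  ext i
  exact hξ i

/-- The Sobolev embedding `H^{10} ⊆ C¹`. -/
lemma exists_sobolev : ∃ C : ℝ≥0, ∀ (f : R3 → Ten2) (I : Fin 3 × Fin 3), Continuous f →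
    sobNorm 10 f < ∞ →
    Differentiable ℝ (fun x => f x I) ∧ (∀ q, Continuous (pd q fun x => f x I)) ∧
    (∀ x, ‖f x I‖ₑ ≤ C * sobNorm 10 f) ∧ ∀ q x, ‖pd q (fun x => f x I) x‖ₑ ≤ C * sobNorm 10 f := by
  obtain ⟨C, hC⟩ := exists_sobolev_scalar
  refine ⟨C * 2, fun f I hf hs => ?_⟩
  have h1 : eLpNorm f 2 volume ≤ sobNorm 10 f := by
    have : eLpNorm f 2 volume = (eLpNorm f 2 volume ^ 2) ^ (1 / 2 : ℝ) := by
      rw [← ENNReal.rpow_natCast, ← ENNReal.rpow_mul]; norm_num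
    rw [this, sobNorm]
    exact ENNReal.rpow_le_rpow le_self_add (by norm_num)
  have h2 : homNorm 10 f ≤ sobNorm 10 f := by
    have : homNorm 10 f = (homNorm 10 f ^ 2) ^ (1 / 2 : ℝ) := by
      rw [← ENNReal.rpow_natCast, ← ENNReal.rpow_mul]; norm_num
    conv_lhs => rw [this]
    rw [sobNorm]
    exact ENNReal.rpow_le_rpow le_add_self (by norm_num)
  have h3 : ∃ g : R3 → EuclideanSpace ℂ (Fin 3 × Fin 3),
      ∀ i, IsFourier (fun x => f x i) (fun ξ => g ξ i) := by
    by_contra hne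
    push Not at hne
    have : homNorm 10 f = ∞ := by
      rw [homNorm, iInf_eq_top]
      intro g
      rw [iInf_eq_top]
      intro hg
      obtain ⟨i, hi⟩ := hne g
      exact absurd (hg i) hi
    rw [this] at h2
    exact absurd (h2.trans_lt hs) (lt_irrefl _)
  obtain ⟨g, hg⟩ := h3
  have h4 : eLpNorm (weight 10 fun ξ => g ξ I) 2 volume ≤ sobNorm 10 f := by
    refine le_trans ?_ ((homNorm_eq hg).symm.le.trans h2)
    refine eLpNorm_mono fun ξ => ?_
    exact PiLp.norm_apply_le (weight 10 g ξ) I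
  have hfI : Continuous fun x => f x I := (EuclideanSpace.proj (𝕜 := ℝ) I).continuous.comp hf
  have h5 : eLpNorm (fun x => f x I) 2 volume ≤ sobNorm 10 f :=
    (eLpNorm_mono fun x => PiLp.norm_apply_le (f x) I).trans h1
  obtain ⟨r1, r2, r3, r4⟩ := hC _ _ hfI ⟨hfI.aestronglyMeasurable, h5.trans_lt hs⟩ (hg I)
    (h4.trans_lt hs)
  have h6 : (C : ℝ≥0∞) * (eLpNorm (fun x => f x I) 2 volume
      + eLpNorm (weight 10 fun ξ => g ξ I) 2 volume) ≤ (C * 2 : ℝ≥0) * sobNorm 10 f := by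
    rw [ENNReal.coe_mul, mul_assoc]
    gcongr
    calc _ ≤ sobNorm 10 f + sobNorm 10 f := add_le_add h5 h4
      _ = _ := by rw [← two_mul]; rfl
  exact ⟨r1, r2, fun x => (r3 x).trans h6, fun q x => (r4 q x).trans h6⟩

/-! ### Classical regularity of solutions -/

/-- What the Sobolev embedding yields for the vorticity of a solution: it is `C¹` in space, its
first derivatives are continuous in space-time, and it is closed in the classical sense. -/
structure RegularFamily (ω : ℝ → R3 → Alt2) : Prop where
  diff : ∀ t ∈ Icc (0 : ℝ) 1, ∀ i j, Differentiable ℝ (comp (ω t) i j)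
  unif : ∀ t ∈ Icc (0 : ℝ) 1, ∀ i j, ∀ ε > 0, ∀ᶠ τ in 𝓝[Icc 0 1] t, ∀ x,
    |comp (ω τ) i j x - comp (ω t) i j x| ≤ ε
  cont : ∀ i j, ContinuousOn (fun p : ℝ × R3 => comp (ω p.1) i j p.2) (Icc 0 1 ×ˢ univ)
  cont_pd : ∀ q i j, ContinuousOn (fun p : ℝ × R3 => pd q (comp (ω p.1) i j) p.2) (Icc 0 1 ×ˢ univ)
  closed : ∀ t ∈ Icc (0 : ℝ) 1, ∀ x i j k, extD2 (ω t) x i j k = 0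
  bound : ∃ B, ∀ t ∈ Icc (0 : ℝ) 1, ∀ x i j, |comp (ω t) i j x| ≤ B

lemma continuousOn_prod_of_unif {f : ℝ → R3 → ℝ} {s : Set ℝ} (hc : ∀ t ∈ s, Continuous (f t))
    (hu : ∀ t ∈ s, ∀ ε > 0, ∀ᶠ τ in 𝓝[s] t, ∀ x, |f τ x - f t x| ≤ ε) :
    ContinuousOn (fun p : ℝ × R3 => f p.1 p.2) (s ×ˢ univ) := by
  rintro ⟨t, x⟩ ⟨ht, -⟩
  rw [Metric.continuousWithinAt_iff']
  intro ε hε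
  have h1 : ∀ᶠ p : ℝ × R3 in 𝓝[s ×ˢ univ] (t, x), ∀ y, |f p.1 y - f t y| ≤ ε / 2 := by
    rw [nhdsWithin_prod_eq]
    exact tendsto_fst.eventually (hu t ht (ε / 2) (by linarith))
  have h2 : ∀ᶠ p : ℝ × R3 in 𝓝[s ×ˢ univ] (t, x), |f t p.2 - f t x| < ε / 2 := by
    refine nhdsWithin_le_nhds ?_
    have := ((hc t ht).comp continuous_snd).tendsto (t, x)
    have := (Metric.tendsto_nhds.1 this) (ε / 2) (by linarith)
    simp only [Real.dist_eq] at this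
    exact this
  filter_upwards [h1, h2] with p hp1 hp2
  rw [Real.dist_eq]
  have := abs_add_le (f p.1 p.2 - f t p.2) (f t p.2 - f t x)
  rw [sub_add_sub_cancel] at this
  linarith [hp1 p.2]

lemma pd_sub {f h : R3 → ℝ} (hf : Differentiable ℝ f) (hh : Differentiable ℝ h) (q : Fin 3) (x : R3) :
    pd q (fun x => f x - h x) x = pd q f x - pd q h x := by
  rw [pd, fderiv_fun_sub (hf x) (hh x)]; rfl

lemma extD2_eq_zero_of_weakClosed {ω : R3 → Alt2} (hd : ∀ i j, Differentiable ℝ (comp ω i j))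
    (hc : ∀ q i j, Continuous (pd q (comp ω i j))) (h : WeakClosed ω) (x : R3) (i j k : Fin 3) :
    extD2 ω x i j k = 0 := by
  have hcont : Continuous fun x => extD2 ω x i j k :=
    ((hc _ _ _).sub (hc _ _ _)).add (hc _ _ _)
  have hae : ∀ᵐ x, extD2 ω x i j k = 0 := by
    refine ae_eq_zero_of_integral_contDiff_smul_eq_zero hcont.locallyIntegrable fun φ hφ hφc => ?_
    have hφt : IsTest φ := ⟨hφ, hφc⟩
    have h1 := h φ hφt i j k
    have hi1 : ∀ a b q, Integrable fun x => comp ω a b x * pd q φ x := fun a b q =>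
      ((hd a b).continuous.mul (hφt.pd q).continuous).integrable_of_hasCompactSupport
        (hφt.pd q).2.mul_left
    have hi2 : ∀ a b q, Integrable fun x => pd q (comp ω a b) x * φ x := fun a b q =>
      ((hc q a b).mul hφt.continuous).integrable_of_hasCompactSupport hφc.mul_left
    have hi3 : Integrable fun x => comp ω j k x * pd i φ x - comp ω i k x * pd j φ x :=
      (hi1 _ _ _).sub (hi1 _ _ _)
    have hi4 : Integrable fun x => pd i (comp ω j k) x * φ x - pd j (comp ω i k) x * φ x :=
      (hi2 _ _ _).sub (hi2 _ _ _)
    rw [integral_add hi3 (hi1 _ _ _), integral_sub (hi1 _ _ _) (hi1 _ _ _)] at h1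
    have hp : ∀ a b q, ∫ x, comp ω a b x * pd q φ x = - ∫ x, pd q (comp ω a b) x * φ x :=
      fun a b q => integral_mul_pd (hd a b) (fun i => hc i a b) hφt q
    rw [hp, hp, hp] at h1
    have e : ∀ x, φ x • extD2 ω x i j k = (pd i (comp ω j k) x * φ x - pd j (comp ω i k) x * φ x)
        + pd k (comp ω i j) x * φ x := fun x => by rw [extD2, smul_eq_mul]; ring
    simp only [e]
    rw [integral_add hi4 (hi2 _ _ _), integral_sub (hi2 _ _ _) (hi2 _ _ _)]
    linarith
  exact congrFun ((Continuous.ae_eq_iff_eq volume hcont continuous_const).1 hae) x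

lemma IsSolution.regularFamily {A : VectorPotentialOp} {ω₀ : R3 → Alt2} {ω : ℝ → R3 → Alt2}
    {u : ℝ → R3 → R3} (h : IsSolution A 10 2 1 ω₀ ω u) : RegularFamily ω := by
  obtain ⟨C, hC⟩ := exists_sobolev
  have hct : ∀ t ∈ Icc (0 : ℝ) 1, Continuous (tens (ω t)) := fun t ht =>
    continuous_subtype_val.comp (h.cont_ω t ht)
  have hreg := fun t ht i j => hC (tens (ω t)) (i, j) (hct t ht) (h.memX.contSob t ht).1
  have hdiff : ∀ t ∈ Icc (0 : ℝ) 1, ∀ i j, Differentiable ℝ (comp (ω t) i j) :=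
    fun t ht i j => (hreg t ht i j).1
  have hcpd : ∀ t ∈ Icc (0 : ℝ) 1, ∀ i j q, Continuous (pd q (comp (ω t) i j)) :=
    fun t ht i j => (hreg t ht i j).2.1
  have hunif : ∀ t ∈ Icc (0 : ℝ) 1, ∀ i j, ∀ ε > 0, ∀ᶠ τ in 𝓝[Icc 0 1] t,
      (∀ x, |comp (ω τ) i j x - comp (ω t) i j x| ≤ ε) ∧
      ∀ q x, |pd q (comp (ω τ) i j) x - pd q (comp (ω t) i j) x| ≤ ε := by
    intro t ht i j ε hε
    have h1 := (h.memX.contSob t ht).2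
    have h2 : Tendsto (fun τ => (C : ℝ≥0∞) * sobNorm 10 (tens (ω τ) - tens (ω t)))
        (𝓝[Icc 0 1] t) (𝓝 0) := by
      simpa using ENNReal.Tendsto.const_mul h1 (Or.inr ENNReal.coe_ne_top)
    have h3 := (tendsto_order.1 h2).2 (ENNReal.ofReal ε) (by simpa using hε)
    have h4 := (tendsto_order.1 h1).2 ∞ (by simp)
    filter_upwards [h3, h4, self_mem_nhdsWithin] with τ h3 h4 hτ
    obtain ⟨-, -, r3, r4⟩ := hC (tens (ω τ) - tens (ω t)) (i, j) ((hct τ hτ).sub (hct t ht)) h4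
    have hle : ∀ y : ℝ, ‖y‖ₑ ≤ C * sobNorm 10 (tens (ω τ) - tens (ω t)) → |y| ≤ ε := by
      intro y hy
      have h5 := hy.trans h3.le
      rwa [← ofReal_norm, ENNReal.ofReal_le_ofReal_iff hε.le] at h5
    refine ⟨fun x => hle _ (r3 x), fun q x => hle _ ?_⟩
    rw [← pd_sub (hdiff τ hτ i j) (hdiff t ht i j)]
    exact r4 q x
  have hbd : ∀ t ∈ Icc (0 : ℝ) 1, ∃ B : ℝ, ∀ x i j, |comp (ω t) i j x| ≤ B := by
    intro t ht
    have hs := (h.memX.contSob t ht).1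
    refine ⟨(C * sobNorm 10 (tens (ω t))).toReal, fun x i j => ?_⟩
    have h1 := (hreg t ht i j).2.2.1 x
    have h2 := ENNReal.toReal_mono (by finiteness) h1
    change |tens (ω t) x (i, j)| ≤ _
    simpa using h2
  refine ⟨hdiff, fun t ht i j ε hε => (hunif t ht i j ε hε).mono fun τ hτ => hτ.1, fun i j => ?_,
    fun q i j => ?_, fun t ht x i j k => ?_, ?_⟩
  · exact continuousOn_prod_of_unif (fun t ht => (hdiff t ht i j).continuous)
      fun t ht ε hε => (hunif t ht i j ε hε).mono fun τ hτ => hτ.1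
  · exact continuousOn_prod_of_unif (f := fun t => pd q (comp (ω t) i j))
      (fun t ht => hcpd t ht i j q)
      fun t ht ε hε => (hunif t ht i j ε hε).mono fun τ hτ => hτ.2 q
  · exact extD2_eq_zero_of_weakClosed (hdiff t ht) (fun q i j => hcpd t ht i j q)
      (h.memX.closed t ht) x i j k
  · refine isCompact_Icc.induction_on (p := fun s => ∃ B, ∀ t ∈ s, ∀ x i j, |comp (ω t) i j x| ≤ B)
      ⟨0, by simp⟩ (fun s t hst ⟨B, hB⟩ => ⟨B, fun τ hτ => hB τ (hst hτ)⟩) ?_ ?_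
    · rintro s t ⟨B, hB⟩ ⟨B', hB'⟩
      refine ⟨max B B', fun τ hτ x i j => ?_⟩
      rcases hτ with hτ | hτ
      · exact (hB τ hτ x i j).trans (le_max_left _ _)
      · exact (hB' τ hτ x i j).trans (le_max_right _ _)
    · intro t ht
      obtain ⟨B, hB⟩ := hbd t ht
      have hall : ∀ᶠ τ in 𝓝[Icc 0 1] t, ∀ i j, ∀ x, |comp (ω τ) i j x - comp (ω t) i j x| ≤ 1 :=
        eventually_all.2 fun i => eventually_all.2 fun j =>
          (hunif t ht i j 1 one_pos).mono fun τ hτ => hτ.1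
      refine ⟨_, hall, B + 1, fun τ hτ x i j => ?_⟩
      have h1 := hτ i j x
      have h2 := abs_add_le (comp (ω τ) i j x - comp (ω t) i j x) (comp (ω t) i j x)
      rw [sub_add_cancel] at h2
      linarith [hB x i j]

lemma sens_sub (k : ℕ) {f h : R3 → ℝ} (hf : LocallyIntegrable f) (hh : LocallyIntegrable h) :
    sens k (fun y => f y - h y) = sens k f - sens k h := by
  simp only [sens, mul_sub]
  exact integral_sub (sens_integrable k hf) (sens_integrable k hh)

lemma RegularFamily.continuousOn_sens {ω : ℝ → R3 → Alt2} (h : RegularFamily ω) (k : ℕ) :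
    ContinuousOn (fun t => sens k (comp (ω t) 0 2)) (Icc 0 1) := by
  intro t ht
  have hli : ∀ τ ∈ Icc (0 : ℝ) 1, LocallyIntegrable (comp (ω τ) 0 2) := fun τ hτ =>
    (h.diff τ hτ 0 2).continuous.locallyIntegrable
  rw [Metric.continuousWithinAt_iff']
  intro ε hε
  set D := scale k ^ 3 * ∫ x, |sensor x| with hD
  have hD0 : 0 ≤ D := mul_nonneg (pow_nonneg (scale_pos k).le 3) (integral_nonneg fun _ => abs_nonneg _)
  filter_upwards [h.unif t ht 0 2 (ε / (2 * (D + 1))) (by positivity), self_mem_nhdsWithin]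
    with τ h1 hτ
  rw [Real.dist_eq, ← sens_sub k (hli τ hτ) (hli t ht)]
  refine (abs_sens_le h1 k).trans_lt ?_
  calc scale k ^ 3 * (ε / (2 * (D + 1)) * ∫ x, |sensor x|) = (ε / (2 * (D + 1))) * D := by
        rw [hD]; ring
    _ < ε := by
        rw [div_mul_eq_mul_div, div_lt_iff₀ (by positivity)]
        nlinarith

/-! ### The velocity field -/

lemma enorm_integral_mul_le {𝕜 : Type*} [RCLike 𝕜] {f h : R3 → 𝕜}
    (hf : AEStronglyMeasurable f volume) (hh : AEStronglyMeasurable h volume) :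
    ‖∫ x, f x * h x‖ₑ ≤ eLpNorm f 2 volume * eLpNorm h 2 volume := by
  refine (enorm_integral_le_lintegral_enorm _).trans ?_
  rw [← eLpNorm_one_eq_lintegral_enorm]
  have := eLpNorm_smul_le_mul_eLpNorm (p := 2) (q := 2) (r := 1) (μ := volume) (f := h) (φ := f) hh hf
  exact this

lemma eLpNorm_schwartz_div_norm_lt_top (φ : 𝓢(R3, ℂ)) :
    eLpNorm (fun ξ => ((‖ξ‖⁻¹ : ℝ) : ℂ) * φ ξ) 2 volume < ∞ := by
  obtain ⟨C0, -, h0⟩ := φ.decay 0 0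
  obtain ⟨C1, -, h1⟩ := φ.decay 1 0
  simp only [pow_zero, one_mul, norm_iteratedFDeriv_zero, pow_one] at h0 h1
  have hφ : ∀ ξ, ‖φ ξ‖ ≤ (C0 + C1) / (1 + ‖ξ‖) := fun ξ => by
    rw [le_div_iff₀ (by positivity)]
    nlinarith [h0 ξ, h1 ξ]
  have hm : AEStronglyMeasurable (fun ξ : R3 => ((‖ξ‖⁻¹ : ℝ) : ℂ) * φ ξ) volume := by
    refine AEStronglyMeasurable.mul (Measurable.aestronglyMeasurable ?_) φ.continuous.aestronglyMeasurable
    fun_prop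
  have hi : Integrable fun ξ : R3 => (‖ξ‖ ^ 2)⁻¹ * ((1 + ‖ξ‖) ^ 2)⁻¹ := by
    rw [integrable_fun_norm_addHaar volume (f := fun y => (y ^ 2)⁻¹ * ((1 + y) ^ 2)⁻¹)]
    have h2 := (integrable_one_add_norm (E := ℝ) (μ := volume) (r := 2) (by simp)).integrableOn
      (s := Ioi 0)
    refine h2.congr_fun (fun y hy => ?_) measurableSet_Ioi
    have hy : (0 : ℝ) < y := hy
    simp only [finrank_euclideanSpace_fin, smul_eq_mul, Real.norm_eq_abs, abs_of_pos hy]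
    rw [Real.rpow_neg (by positivity)]
    norm_num
    field_simp
  refine MemLp.eLpNorm_lt_top ((memLp_two_iff_integrable_sq_norm hm).2 ?_)
  refine (hi.const_mul ((C0 + C1) ^ 2)).mono' (hm.norm.pow 2) (Eventually.of_forall fun ξ => ?_)
  rw [Real.norm_eq_abs, abs_of_nonneg (by positivity), norm_mul, Complex.norm_real, norm_inv, norm_norm]
  calc (‖ξ‖⁻¹ * ‖φ ξ‖) ^ 2 ≤ (‖ξ‖⁻¹ * ((C0 + C1) / (1 + ‖ξ‖))) ^ 2 := by gcongr; exact hφ ξ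
    _ = _ := by rw [← inv_pow, ← inv_pow, div_eq_mul_inv]; ring

/-- A sequence that tends to zero in `Ḣ¹(ℝ³)` tends to zero weakly. -/
lemma tendsto_integral_of_homNorm {ι : Type} [Fintype ι] {F : ℕ → R3 → EuclideanSpace ℝ ι}
    (hF : Tendsto (fun n => homNorm 1 (F n)) atTop (𝓝 0)) {χ : R3 → ℝ} (hχ : IsTest χ) (i : ι) :
    Tendsto (fun n => ∫ x, F n x i * χ x) atTop (𝓝 0) := by
  set φ : 𝓢(R3, ℂ) := 𝓕⁻ hχ.schwartz with hφ
  have hφχ : 𝓕 φ = hχ.schwartz := FourierTransform.fourier_fourierInv_eq _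
  set K := eLpNorm (fun ξ => ((‖ξ‖⁻¹ : ℝ) : ℂ) * φ ξ) 2 volume with hK
  have hKtop : K < ∞ := eLpNorm_schwartz_div_norm_lt_top φ
  have hlim : Tendsto (fun n => homNorm 1 (F n) * K) atTop (𝓝 0) := by
    simpa using ENNReal.Tendsto.mul_const hF (Or.inr hKtop.ne)
  rw [tendsto_zero_iff_norm_tendsto_zero]
  have hlt := (tendsto_order.1 hF).2 ∞ (by simp)
  have hle : ∀ᶠ n in atTop, ‖∫ x, F n x i * χ x‖ₑ ≤ homNorm 1 (F n) * K := by
    filter_upwards [hlt] with n hn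
    obtain ⟨g, hg⟩ : ∃ g : R3 → EuclideanSpace ℂ ι, ∀ i, IsFourier (fun x => F n x i) (fun ξ => g ξ i) := by
      by_contra hne
      push Not at hne
      have : homNorm 1 (F n) = ∞ := by
        rw [homNorm, iInf_eq_top]
        intro g
        rw [iInf_eq_top]
        intro hg
        obtain ⟨i, hi⟩ := hne g
        exact absurd (hg i) hi
      rw [this] at hn
      exact absurd hn (lt_irrefl _)
    have h1 := (hg i φ).2.2
    rw [hφχ] at h1
    have h2 : ∫ x, ((F n x i : ℝ) : ℂ) * hχ.schwartz x = ((∫ x, F n x i * χ x : ℝ) : ℂ) := by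
      rw [← integral_complex_ofReal]
      refine integral_congr_ae (Eventually.of_forall fun x => ?_)
      simp [hχ.coe_schwartz, cx]
    rw [h2] at h1
    have h3 : ‖∫ x, F n x i * χ x‖ₑ = ‖∫ ξ, g ξ i * φ ξ‖ₑ := by
      rw [← h1, ← ofReal_norm, ← ofReal_norm, Complex.norm_real]
    rw [h3, homNorm_eq hg]
    have hgm := (hg i).locallyIntegrable.aestronglyMeasurable
    have hwm : AEStronglyMeasurable (weight 1 fun ξ => g ξ i) volume := by
      have hc : Continuous fun ξ : R3 => (((2 * Real.pi * ‖ξ‖) ^ 1 : ℝ) : ℂ) := by fun_prop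
      exact hc.aestronglyMeasurable.smul hgm
    have hm : AEStronglyMeasurable (fun ξ : R3 => ((‖ξ‖⁻¹ : ℝ) : ℂ) * φ ξ) volume := by
      refine AEStronglyMeasurable.mul (Measurable.aestronglyMeasurable ?_) φ.continuous.aestronglyMeasurable
      fun_prop
    have h4 : ∫ ξ, weight 1 (fun ξ => g ξ i) ξ * (((‖ξ‖⁻¹ : ℝ) : ℂ) * φ ξ)
        = (2 * Real.pi) * ∫ ξ, g ξ i * φ ξ := by
      rw [← integral_const_mul]
      refine integral_congr_ae ?_
      have h0 : ∀ᵐ ξ : R3, ξ ≠ 0 := by simp [ae_iff]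
      filter_upwards [h0] with ξ hξ
      have : (‖ξ‖ : ℂ) ≠ 0 := by simpa using hξ
      simp only [weight, smul_eq_mul, pow_one]
      push_cast
      field_simp
    have h5 := enorm_integral_mul_le hwm hm
    rw [h4, enorm_mul] at h5
    refine le_trans ?_ (h5.trans ?_)
    · refine le_mul_of_one_le_left (by positivity) ?_
      rw [← ofReal_norm, ← ENNReal.ofReal_one]
      refine ENNReal.ofReal_le_ofReal ?_
      simp [abs_of_pos Real.pi_pos]
      linarith [Real.pi_gt_three]
    · gcongr
      exact eLpNorm_mono fun ξ => PiLp.norm_apply_le (weight 1 g ξ) i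
  have h6 := tendsto_of_tendsto_of_tendsto_of_le_of_le' tendsto_const_nhds hlim
    (Eventually.of_forall fun n => zero_le) hle
  have h7 := (ENNReal.tendsto_toReal ENNReal.zero_ne_top).comp h6
  simpa [Function.comp_def, toReal_enorm] using h7

lemma tendsto_sens {a : ℕ → CcB2} {w : R3 → Alt2} (hw : Continuous (comp w 0 2))
    (h : Tendsto (fun n => eLpNorm (tens (a n).1 - tens w) 2 volume) atTop (𝓝 0)) (k : ℕ) :
    Tendsto (fun n => sens k (comp (a n).1 0 2)) atTop (𝓝 (sens k (comp w 0 2))) := by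
  rw [tendsto_iff_norm_sub_tendsto_zero]
  have hb := isTest_sensor.dil (scale_pos k)
  set K := eLpNorm (dil (scale k) sensor) 2 volume with hK
  have hKtop : K < ∞ := (hb.continuous.memLp_of_hasCompactSupport hb.2).eLpNorm_lt_top
  have hlim : Tendsto (fun n => K * eLpNorm (tens (a n).1 - tens w) 2 volume) atTop (𝓝 0) := by
    simpa using ENNReal.Tendsto.const_mul h (Or.inr hKtop.ne)
  have hle : ∀ n, ‖sens k (comp (a n).1 0 2) - sens k (comp w 0 2)‖ₑ
      ≤ K * eLpNorm (tens (a n).1 - tens w) 2 volume := by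
    intro n
    have hc := (isTest_comp (a n) 0 2).continuous
    rw [← sens_sub k hc.locallyIntegrable hw.locallyIntegrable]
    refine (enorm_integral_mul_le hb.continuous.aestronglyMeasurable
      (hc.sub hw).aestronglyMeasurable).trans ?_
    gcongr
    refine eLpNorm_mono fun x => ?_
    exact PiLp.norm_apply_le (tens (a n).1 x - tens w x) (0, 2)
  have h6 := tendsto_of_tendsto_of_tendsto_of_le_of_le tendsto_const_nhds hlim
    (fun n => zero_le) hle
  have h7 := (ENNReal.tendsto_toReal ENNReal.zero_ne_top).comp h6
  simpa [Function.comp_def, toReal_enorm] using h7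

/-- The partial sums of the velocity field `∑ₖ cₖ v(x / r_k)` with `v = (∂₁a, -∂₀a, 0)`. -/
def velPart (c : ℕ → ℝ) (N : ℕ) (j : Fin 3) (x : R3) : ℝ :=
  -∑ i, (e01 : Ten2) (i, j) * dyadicPart c (pd i stream) N x

lemma velPart_zero (c : ℕ → ℝ) (N : ℕ) (x : R3) : velPart c N 0 x = dyadicPart c (pd 1 stream) N x := by
  simp [velPart, e01]

lemma velPart_one (c : ℕ → ℝ) (N : ℕ) (x : R3) : velPart c N 1 x = -dyadicPart c (pd 0 stream) N x := by
  simp [velPart, e01]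

lemma velPart_two (c : ℕ → ℝ) (N : ℕ) (x : R3) : velPart c N 2 x = 0 := by
  simp [velPart, e01]

lemma isTest_velPart (c : ℕ → ℝ) (N : ℕ) (j : Fin 3) : IsTest (velPart c N j) := by
  have : IsTest fun x => ∑ i, (e01 : Ten2) (i, j) * dyadicPart c (pd i stream) N x :=
    IsTest.sum fun i _ => ((isTest_stream.pd i).dyadicPart c N).const_mul _
  refine ⟨this.1.neg, this.2.neg⟩

lemma codiff_potentialOp (a : CcB2) {N : ℕ} {x : R3} (hx : 256 * scale N < ‖x‖) (j : Fin 3) :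
    codiff (potentialOp a) x j
      = velPart (fun k => (scale k)⁻¹ * sens k (comp a.1 0 2) * (scale k)⁻¹) N j x := by
  simp only [codiff, velPart]
  congr 1
  refine Finset.sum_congr rfl fun i _ => ?_
  have hev : ∀ᶠ x' : R3 in 𝓝 x, 256 * scale N < ‖x'‖ :=
    (continuous_norm.tendsto x).eventually (lt_mem_nhds hx)
  have h1 : comp (potentialOp a) i j =ᶠ[𝓝 x] fun x => (e01 : Ten2) (i, j) *
      dyadicPart (fun k => (scale k)⁻¹ * sens k (comp a.1 0 2)) stream N x := by
    filter_upwards [hev] with x' hx'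
    have h2 : ∀ k, N ≤ k → dil (scale k) stream x' = 0 := by
      intro k hk
      by_contra h
      have h3 := suppInBox_stream.norm_le _ h
      have hk0 := scale_pos k
      rw [norm_smul, norm_inv, Real.norm_eq_abs, abs_of_pos hk0, inv_mul_eq_div,
        div_le_iff₀ hk0] at h3
      linarith [scale_anti hk]
    rw [comp, potentialOp_apply, dyadicSum_eq_sum h2]
    simp [dyadicPart, mul_comm]
  rw [pd, h1.fderiv_eq, fderiv_const_mul ((isTest_stream.dyadicPart _ N).differentiable x)]
  rw [← pd_dyadicPart isTest_stream]
  rfl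

/-- The velocity field of the solution, off the origin. -/
lemma IsCodiffOf.eq_velPart {w : R3 → Alt2} {v : R3 → R3} (h : IsCodiffOf potentialOp w v)
    (hw : Continuous (comp w 0 2)) (hv : Continuous v) {N : ℕ} {x : R3} (hx : 256 * scale N < ‖x‖)
    (j : Fin 3) :
    v x j = velPart (fun k => (scale k)⁻¹ * sens k (comp w 0 2) * (scale k)⁻¹) N j x := by
  obtain ⟨a, ha, ha'⟩ := h
  set m : (R3 → Alt2) → ℕ → ℝ := fun w k => (scale k)⁻¹ * sens k (comp w 0 2) * (scale k)⁻¹ with hm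
  have hvj : Continuous fun x => v x j := (EuclideanSpace.proj (𝕜 := ℝ) j).continuous.comp hv
  set U : Set R3 := {x | 256 * scale N < ‖x‖} with hU
  have hUo : IsOpen U := isOpen_lt continuous_const continuous_norm
  have hcont : Continuous fun x => velPart (m w) N j x - v x j :=
    (isTest_velPart _ N j).continuous.sub hvj
  have key : ∀ χ : R3 → ℝ, IsTest χ → tsupport χ ⊆ U →
      ∫ x, χ x • (velPart (m w) N j x - v x j) = 0 := by
    intro χ hχ hχU
    have h1 := tendsto_integral_of_homNorm ha' hχ j
    have h2 : ∀ n x, (codiff (potentialOp (a n)) - v) x j * χ x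
        = velPart (m (a n).1) N j x * χ x - v x j * χ x := by
      intro n x
      by_cases hx : x ∈ U
      · rw [Pi.sub_apply, PiLp.sub_apply, codiff_potentialOp (a n) hx, sub_mul]
      · have : χ x = 0 := by
          by_contra h0
          exact hx (hχU (subset_tsupport _ h0))
        rw [this]; ring
    have hiv : ∀ c, Integrable fun x => velPart c N j x * χ x := fun c =>
      ((isTest_velPart c N j).mul hχ.1).integrable
    have hivv : Integrable fun x => v x j * χ x :=
      (hvj.mul hχ.continuous).integrable_of_hasCompactSupport hχ.2.mul_left
    simp only [h2, integral_sub (hiv _) hivv] at h1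
    have hexp : ∀ c, ∫ x, velPart c N j x * χ x = ∑ k ∈ Finset.range N, c k *
        (-∑ i, (e01 : Ten2) (i, j) * ∫ x, dil (scale k) (pd i stream) x * χ x) := by
      intro c
      have e1 : ∀ x, velPart c N j x * χ x = ∑ i, ∑ k ∈ Finset.range N,
          (-(e01 : Ten2) (i, j) * c k) * (dil (scale k) (pd i stream) x * χ x) := by
        intro x
        simp only [velPart, dyadicPart, ← Finset.sum_neg_distrib, Finset.sum_mul, Finset.mul_sum]
        refine Finset.sum_congr rfl fun i _ => Finset.sum_congr rfl fun k _ => by ring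
      have hi : ∀ i k, Integrable fun x =>
          (-(e01 : Ten2) (i, j) * c k) * (dil (scale k) (pd i stream) x * χ x) := fun i k =>
        ((((isTest_stream.pd i).dil (scale_pos k)).mul hχ.1).integrable).const_mul _
      simp only [e1]
      rw [integral_finsetSum _ fun i _ => integrable_finsetSum _ fun k _ => hi i k]
      simp only [integral_finsetSum _ fun k _ => hi _ k, integral_const_mul]
      rw [Finset.sum_comm]
      refine Finset.sum_congr rfl fun k _ => ?_
      rw [← Finset.sum_neg_distrib, Finset.mul_sum]
      refine Finset.sum_congr rfl fun i _ => by ring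
    have h3 : Tendsto (fun n => ∫ x, velPart (m (a n).1) N j x * χ x) atTop
        (𝓝 (∫ x, velPart (m w) N j x * χ x)) := by
      simp only [hexp]
      refine tendsto_finsetSum _ fun k _ => Tendsto.mul_const _ ?_
      exact ((tendsto_sens hw ha k).const_mul _).mul_const _
    have h4 := tendsto_nhds_unique h1 (h3.sub_const _)
    have e : ∀ x, χ x • (velPart (m w) N j x - v x j) = velPart (m w) N j x * χ x - v x j * χ x :=
      fun x => by rw [smul_eq_mul]; ring
    simp only [e]
    rw [integral_sub (hiv _) hivv]
    exact h4.symm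
  have hae := hUo.ae_eq_zero_of_integral_contDiff_smul_eq_zero (μ := volume)
    (f := fun x => velPart (m w) N j x - v x j) (hcont.locallyIntegrable.locallyIntegrableOn _)
    fun χ h1 h2 h3 => key χ ⟨h1, h2⟩ h3
  have hEq := Measure.eqOn_open_of_ae_eq (μ := volume) (U := U)
    (f := fun x => velPart (m w) N j x - v x j) (g := fun _ => 0)
    ((ae_restrict_iff' hUo.measurableSet).2 hae) hUo hcont.continuousOn continuousOn_const
  have := hEq hx
  simp only at this
  linarith

/-! ### The equations in a horizontal layer -/

/-- The layer at height `r_J`: it is met by the streams at the scales below `J` only, and there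
they do not depend on the height. -/
def slab (J : ℕ) : Set R3 := {x | 2 * scale J < x 2 ∧ x 2 < 5 * scale J}

lemma isOpen_slab (J : ℕ) : IsOpen (slab J) :=
  (isOpen_lt continuous_const (contDiff_coord 2).continuous).inter
    (isOpen_lt (contDiff_coord 2).continuous continuous_const)

/-- The component `u₀` of the velocity in the layer, for the coefficients `c`. -/
def velA (J : ℕ) (c : ℕ → ℝ) (x : R3) : ℝ :=
  -dyadicPart c (prod3 gProf (deriv qProf) fun _ => 1) J x

/-- The component `u₁` of the velocity in the layer, for the coefficients `c`. -/
def velB (J : ℕ) (c : ℕ → ℝ) (x : R3) : ℝ :=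
  dyadicPart c (prod3 (deriv gProf) qProf fun _ => 1) J x

lemma contDiff_deriv_gProf : ContDiff ℝ (⊤ : ℕ∞) (deriv gProf) := by
  exact ((contDiff_infty_iff_deriv).1 contDiff_gProf).2

lemma contDiff_deriv_qProf : ContDiff ℝ (⊤ : ℕ∞) (deriv qProf) :=
  ((contDiff_infty_iff_deriv).1 contDiff_qProf).2

lemma pd_stream_zero : pd 0 stream = fun x => -prod3 (deriv gProf) qProf chiProf x := by
  have hd := fun {f : ℝ → ℝ} (h : ContDiff ℝ (⊤ : ℕ∞) f) => h.differentiable (by simp)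
  have h := (pd_prod3 (hd contDiff_gProf) (hd contDiff_qProf) (hd contDiff_chiProf)).1
  funext x
  rw [← h]
  rw [show stream = fun y => -prod3 gProf qProf chiProf y from rfl]
  simp only [pd]
  rw [fderiv_fun_neg]; rfl

lemma pd_stream_one : pd 1 stream = fun x => -prod3 gProf (deriv qProf) chiProf x := by
  have hd := fun {f : ℝ → ℝ} (h : ContDiff ℝ (⊤ : ℕ∞) f) => h.differentiable (by simp)
  have h := (pd_prod3 (hd contDiff_gProf) (hd contDiff_qProf) (hd contDiff_chiProf)).2.1
  funext x
  rw [← h]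
  rw [show stream = fun y => -prod3 gProf qProf chiProf y from rfl]
  simp only [pd]
  rw [fderiv_fun_neg]; rfl

lemma dyadicPart_slab {f f' : R3 → ℝ} (h0 : ∀ x, 2 < x 2 → f x = 0) (h1 : ∀ x, |x 2| ≤ 1 → f x = f' x)
    (c : ℕ → ℝ) {J N : ℕ} (hN : J ≤ N) {x : R3} (hx : x ∈ slab J) :
    dyadicPart c f N x = dyadicPart c f' J x := by
  obtain ⟨hx1, hx2⟩ := hx
  have hJ := scale_pos J
  unfold dyadicPart
  rw [← Finset.sum_subset (Finset.range_subset_range.2 hN)]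
  · refine Finset.sum_congr rfl fun k hk => ?_
    have hk' := scale_le_div (Finset.mem_range.1 hk)
    have hkp := scale_pos k
    rw [dil_apply, dil_apply, h1]
    rw [smul_coord, inv_mul_eq_div, abs_of_pos (by apply div_pos <;> linarith), div_le_one hkp]
    linarith
  · intro k _ hk
    have hk' := scale_anti (show J ≤ k by simpa using hk)
    have hkp := scale_pos k
    rw [dil_apply, h0, mul_zero]
    rw [smul_coord, inv_mul_eq_div, lt_div_iff₀ hkp]
    linarith

lemma velPart_slab_zero (c : ℕ → ℝ) {J N : ℕ} (hN : J ≤ N) {x : R3} (hx : x ∈ slab J) :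
    velPart c N 0 x = velA J c x := by
  have e : ∀ c, velA J c x = dyadicPart c (fun x => -prod3 gProf (deriv qProf) (fun _ => 1) x) J x := by
    intro c
    simp [velA, dyadicPart, dil, ← Finset.sum_neg_distrib]
  rw [velPart_zero, e]
  refine dyadicPart_slab (fun x hx => ?_) (fun x hx => ?_) c hN hx
  · by_contra h
    rw [pd_stream_one] at h
    have := chiProf_ne_zero (right_ne_zero_of_mul (neg_ne_zero.1 h))
    linarith
  · simp only [pd_stream_one, prod3]
    rw [chiProf_eq_one hx]

lemma velPart_slab_one (c : ℕ → ℝ) {J N : ℕ} (hN : J ≤ N) {x : R3} (hx : x ∈ slab J) :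
    velPart c N 1 x = velB J c x := by
  have e : ∀ c, velB J c x = -dyadicPart c (fun x => -prod3 (deriv gProf) qProf (fun _ => 1) x) J x := by
    intro c
    simp [velB, dyadicPart, dil]
  rw [velPart_one, e]
  congr 1
  refine dyadicPart_slab (fun x hx => ?_) (fun x hx => ?_) c hN hx
  · by_contra h
    rw [pd_stream_zero] at h
    have := chiProf_ne_zero (right_ne_zero_of_mul (neg_ne_zero.1 h))
    linarith
  · simp only [pd_stream_zero, prod3]
    rw [chiProf_eq_one hx]

lemma pd_dyadicPart_of_differentiable {f : R3 → ℝ} (hf : Differentiable ℝ f) (c : ℕ → ℝ) (N : ℕ)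
    (i : Fin 3) (x : R3) :
    pd i (dyadicPart c f N) x = dyadicPart (fun k => c k * (scale k)⁻¹) (pd i f) N x := by
  have hd : ∀ k, Differentiable ℝ (dil (scale k) f) := fun k => by
    have : Differentiable ℝ fun x : R3 => (scale k)⁻¹ • x := by fun_prop
    exact hf.comp this
  unfold dyadicPart
  rw [pd, fderiv_fun_sum fun k _ => (hd k x).const_mul _, _root_.sum_apply]
  refine Finset.sum_congr rfl fun k _ => ?_
  rw [fderiv_const_mul (hd k x)]
  have := pd_dil hf (scale k) i x
  rw [pd] at this
  simp [this]
  ring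

section
variable (J : ℕ) (c : ℕ → ℝ)

lemma contDiff_dyadicPart {f : R3 → ℝ} (hf : ContDiff ℝ (⊤ : ℕ∞) f) :
    ContDiff ℝ (⊤ : ℕ∞) (dyadicPart c f J) :=
  ContDiff.sum fun _ _ => contDiff_const.mul (contDiff_dil hf _)

lemma contDiff_velA : ContDiff ℝ (⊤ : ℕ∞) (velA J c) :=
  (contDiff_dyadicPart J c (contDiff_prod3 contDiff_gProf contDiff_deriv_qProf contDiff_const)).neg

lemma contDiff_velB : ContDiff ℝ (⊤ : ℕ∞) (velB J c) :=
  contDiff_dyadicPart J c (contDiff_prod3 contDiff_deriv_gProf contDiff_qProf contDiff_const)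

lemma pd_velA (i : Fin 3) (x : R3) : pd i (velA J c) x
    = -dyadicPart (fun k => c k * (scale k)⁻¹) (pd i (prod3 gProf (deriv qProf) fun _ => 1)) J x := by
  have hp : Differentiable ℝ (prod3 gProf (deriv qProf) fun _ => 1) :=
    (contDiff_prod3 contDiff_gProf contDiff_deriv_qProf contDiff_const).differentiable (by simp)
  rw [← pd_dyadicPart_of_differentiable hp]
  simp only [pd]
  unfold velA
  rw [fderiv_fun_neg]; rfl

lemma pd_velB (i : Fin 3) (x : R3) : pd i (velB J c) x
    = dyadicPart (fun k => c k * (scale k)⁻¹) (pd i (prod3 (deriv gProf) qProf fun _ => 1)) J x := by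
  have hp : Differentiable ℝ (prod3 (deriv gProf) qProf fun _ => 1) :=
    (contDiff_prod3 contDiff_deriv_gProf contDiff_qProf contDiff_const).differentiable (by simp)
  rw [← pd_dyadicPart_of_differentiable hp]
  rfl

lemma pd_velB_two (x : R3) : pd 2 (velB J c) x = 0 := by
  have h := (pd_prod3 (contDiff_deriv_gProf.differentiable (by simp))
    (contDiff_qProf.differentiable (by simp)) (differentiable_const (1 : ℝ))).2.2
  rw [pd_velB, h]
  simp [dyadicPart, dil, prod3]

lemma div_vel (x : R3) : pd 0 (velA J c) x + pd 1 (velB J c) x = 0 := by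
  have h1 := (pd_prod3 (contDiff_deriv_gProf.differentiable (by simp))
    (contDiff_qProf.differentiable (by simp)) (differentiable_const (1 : ℝ))).2.1
  have h2 := (pd_prod3 (contDiff_gProf.differentiable (by simp))
    (contDiff_deriv_qProf.differentiable (by simp)) (differentiable_const (1 : ℝ))).1
  rw [pd_velA, pd_velB, h1, h2]
  ring

lemma vel_eq_zero {x : R3} (hx : x 0 < scale J / 128) : velA J c x = 0 ∧ velB J c x = 0 := by
  have h : ∀ k ∈ Finset.range J, (scale k)⁻¹ * x 0 < 1 / 128 := by
    intro k hk
    have h1 := scale_le_div (Finset.mem_range.1 hk)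
    have h2 := scale_pos k
    rw [inv_mul_eq_div, div_lt_iff₀ h2]
    linarith
  constructor
  · rw [velA, dyadicPart, Finset.sum_eq_zero, neg_zero]
    intro k hk
    rw [dil_apply, prod3, smul_coord, gProf_eq_zero_left (h k hk).le]
    ring
  · rw [velB, dyadicPart, Finset.sum_eq_zero]
    intro k hk
    have : deriv gProf ((scale k)⁻¹ * x 0) = 0 := by
      by_contra h'
      linarith [(deriv_gProf_ne_zero h').1, h k hk]
    rw [dil_apply, prod3, smul_coord, this]
    ring

end

/-- The coefficients of the velocity field of a solution. -/
def mode (ω : ℝ → R3 → Alt2) (k : ℕ) (t : ℝ) : ℝ :=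
  (scale k)⁻¹ * sens k (comp (ω t) 0 2) * (scale k)⁻¹

lemma slab_velocity {ω₀ : R3 → Alt2} {ω : ℝ → R3 → Alt2} {u : ℝ → R3 → R3}
    (h : IsSolution potentialOp 10 2 1 ω₀ ω u) {t : ℝ} (ht : t ∈ Icc (0 : ℝ) 1) {J : ℕ} {x : R3}
    (hx : x ∈ slab J) : u t x 0 = velA J (fun k => mode ω k t) x ∧
      u t x 1 = velB J (fun k => mode ω k t) x ∧ u t x 2 = 0 := by
  have hw : Continuous (comp (ω t) 0 2) := (h.regularFamily.diff t ht 0 2).continuous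
  have hJ := scale_pos J
  have hx2 : 0 < ‖x‖ := by
    have h1 := abs_coord_le x 2
    have h2 := le_abs_self (x 2)
    linarith [hx.1]
  obtain ⟨N, hN⟩ := exists_scale_lt (δ := ‖x‖ / 256) (by positivity)
  have hM := hN (max N J) (le_max_left _ _)
  have key := fun j => (h.velocity_eq t ht).eq_velPart hw (h.cont_u t ht)
    (N := max N J) (x := x) (by linarith) j
  refine ⟨?_, ?_, ?_⟩
  · rw [key, velPart_slab_zero _ (le_max_right _ _) hx]; rfl
  · rw [key, velPart_slab_one _ (le_max_right _ _) hx]; rfl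
  · rw [key, velPart_two]

lemma pd_congr {f g : R3 → ℝ} {x : R3} (h : f =ᶠ[𝓝 x] g) (i : Fin 3) : pd i f x = pd i g x := by
  rw [pd, h.fderiv_eq]; rfl

lemma pd_mul {f g : R3 → ℝ} {x : R3} (hf : DifferentiableAt ℝ f x) (hg : DifferentiableAt ℝ g x)
    (i : Fin 3) : pd i (fun y => f y * g y) x = pd i f x * g x + f x * pd i g x := by
  rw [pd, fderiv_fun_mul hf hg]
  simp [pd]; ring

lemma comp_swap (w : R3 → Alt2) (i j : Fin 3) (x : R3) : comp w i j x = - comp w j i x := (w x).2 i j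

/-- The evolution of the vorticity in a layer. With `F = ω₀₁`, `G = ω₀₂`, `H = ω₁₂` and the
divergence-free planar velocity `(A, B)`: `F` is transported, and
`∂ₜG = -∂₀(A G + B H) - B ∂₂F`. Where `x₀ ≤ 0` nothing moves. -/
structure SlabFlow (J : ℕ) (ω : ℝ → R3 → Alt2) : Prop where
  deriv01 : ∀ t ∈ Icc (0 : ℝ) 1, ∀ x ∈ slab J, HasDerivWithinAt (fun τ => comp (ω τ) 0 1 x)
    (-(velA J (fun k => mode ω k t) x * pd 0 (comp (ω t) 0 1) x
      + velB J (fun k => mode ω k t) x * pd 1 (comp (ω t) 0 1) x)) (Icc 0 1) t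
  deriv02 : ∀ t ∈ Icc (0 : ℝ) 1, ∀ x ∈ slab J, HasDerivWithinAt (fun τ => comp (ω τ) 0 2 x)
    (-(pd 0 (fun y => velA J (fun k => mode ω k t) y * comp (ω t) 0 2 y
        + velB J (fun k => mode ω k t) y * comp (ω t) 1 2 y) x
      + velB J (fun k => mode ω k t) x * pd 2 (comp (ω t) 0 1) x)) (Icc 0 1) t
  vanish : ∀ t ∈ Icc (0 : ℝ) 1, ∀ x ∈ slab J, x 0 ≤ 0 → ∀ i j, comp (ω t) i j x = 0

lemma IsSolution.slabFlow {ω₀ : R3 → Alt2} {ω : ℝ → R3 → Alt2} {u : ℝ → R3 → R3}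
    (h : IsSolution potentialOp 10 2 1 ω₀ ω u) (h0 : ∀ x : R3, x 0 ≤ 0 → ω₀ x = 0) (J : ℕ) :
    SlabFlow J ω := by
  have hreg := h.regularFamily
  have hc : ∀ t ∈ Icc (0 : ℝ) 1, ∀ x ∈ slab J, ∀ j, contract2 (u t) (ω t) j =ᶠ[𝓝 x] fun y =>
      velA J (fun k => mode ω k t) y * comp (ω t) 0 j y
        + velB J (fun k => mode ω k t) y * comp (ω t) 1 j y := by
    intro t ht x hx j
    filter_upwards [(isOpen_slab J).mem_nhds hx] with y hy
    obtain ⟨h1, h2, h3⟩ := slab_velocity h ht hy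
    simp [contract2, Fin.sum_univ_three, h1, h2, h3]
  have hA := fun t => (contDiff_velA J (fun k => mode ω k t)).differentiable (by simp)
  have hB := fun t => (contDiff_velB J (fun k => mode ω k t)).differentiable (by simp)
  have hL : ∀ t ∈ Icc (0 : ℝ) 1, ∀ x i j,
      lieD (u t) (ω t) x i j = pd i (contract2 (u t) (ω t) j) x - pd j (contract2 (u t) (ω t) i) x := by
    intro t ht x i j
    simp [lieD, extD1, hreg.closed t ht]
  have hswap : ∀ t i, comp (ω t) i i = fun _ => 0 := by
    intro t i; funext y
    have := comp_swap (ω t) i i y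
    linarith
  have hten : ∀ t, comp (ω t) 1 0 = fun y => - comp (ω t) 0 1 y := fun t => funext fun y =>
    comp_swap (ω t) 1 0 y
  refine ⟨fun t ht x hx => ?_, fun t ht x hx => ?_, fun t ht x hx hx0 i j => ?_⟩
  · refine (h.vorticity_eq t ht x 0 1).congr_deriv ?_
    congr 1
    have dF := hreg.diff t ht 0 1 x
    have hBn : DifferentiableAt ℝ (fun y => -velB J (fun k => mode ω k t) y) x := (hB t x).neg
    have e1 : contract2 (u t) (ω t) 1 =ᶠ[𝓝 x] fun y =>
        velA J (fun k => mode ω k t) y * comp (ω t) 0 1 y := by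
      filter_upwards [hc t ht x hx 1] with y hy
      rw [hy, hswap t 1]; ring
    have e2 : contract2 (u t) (ω t) 0 =ᶠ[𝓝 x] fun y =>
        (fun y => -velB J (fun k => mode ω k t) y) y * comp (ω t) 0 1 y := by
      filter_upwards [hc t ht x hx 0] with y hy
      rw [hy, hswap t 0, hten]; ring
    rw [hL t ht, pd_congr e1, pd_congr e2, pd_mul (hA t x) dF, pd_mul hBn dF]
    have hd := div_vel J (fun k => mode ω k t) x
    have e3 : pd 1 (fun y => -velB J (fun k => mode ω k t) y) x = - pd 1 (velB J fun k => mode ω k t) x := by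
      rw [pd, fderiv_fun_neg]; rfl
    rw [e3]
    linear_combination (comp (ω t) 0 1 x) * hd
  · refine (h.vorticity_eq t ht x 0 2).congr_deriv ?_
    congr 1
    have dF := hreg.diff t ht 0 1 x
    have hBn : DifferentiableAt ℝ (fun y => -velB J (fun k => mode ω k t) y) x := (hB t x).neg
    have e2 : contract2 (u t) (ω t) 0 =ᶠ[𝓝 x] fun y =>
        (fun y => -velB J (fun k => mode ω k t) y) y * comp (ω t) 0 1 y := by
      filter_upwards [hc t ht x hx 0] with y hy
      rw [hy, hswap t 0, hten]; ring
    rw [hL t ht, pd_congr (hc t ht x hx 2), pd_congr e2, pd_mul hBn dF]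
    have e3 : pd 2 (fun y => -velB J (fun k => mode ω k t) y) x = 0 := by
      have : pd 2 (fun y => -velB J (fun k => mode ω k t) y) x = - pd 2 (velB J fun k => mode ω k t) x := by
        rw [pd, fderiv_fun_neg]; rfl
      rw [this, pd_velB_two, neg_zero]
    rw [e3]
    ring
  · have hJ := scale_pos J
    have hconst : ∀ s ∈ Icc (0 : ℝ) 1, HasDerivWithinAt (fun τ => comp (ω τ) i j x) 0 (Icc 0 1) s := by
      intro s hs
      refine (h.vorticity_eq s hs x i j).congr_deriv ?_
      have e : ∀ j, contract2 (u s) (ω s) j =ᶠ[𝓝 x] fun _ => 0 := by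
        intro j
        have hx' : ∀ᶠ y : R3 in 𝓝 x, y 0 < scale J / 128 :=
          ((contDiff_coord 0).continuous.tendsto x).eventually (gt_mem_nhds (by simp only; linarith))
        filter_upwards [hc s hs x hx j, hx'] with y hy hy'
        obtain ⟨h1, h2⟩ := vel_eq_zero J (fun k => mode ω k s) hy'
        rw [hy, h1, h2]; ring
      rw [hL s hs, pd_congr (e j), pd_congr (e i)]
      simp [pd]
    have h1 := constant_of_has_deriv_right_zero (f := fun τ => comp (ω τ) i j x) (a := 0) (b := 1)
      (fun s hs => (hconst s hs).continuousWithinAt)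
      (fun s hs => (hconst s ⟨hs.1, hs.2.le⟩).mono_of_mem_nhdsWithin (Icc_mem_nhdsGE_of_mem hs)) t ht
    rw [h1, h.initial, comp, h0 x hx0]
    simp

/-- The point with the coordinates `X`, `Y`, `z`. -/
def pt (X Y z : ℝ) : R3 := !₂[X, Y, z]

@[simp] lemma pt_zero (X Y z : ℝ) : pt X Y z 0 = X := rfl
@[simp] lemma pt_one (X Y z : ℝ) : pt X Y z 1 = Y := rfl
@[simp] lemma pt_two (X Y z : ℝ) : pt X Y z 2 = z := rfl

lemma pt_eta (x : R3) : pt (x 0) (x 1) (x 2) = x := by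
  ext i; fin_cases i <;> rfl

lemma fderiv_apply_eq_sum (f : R3 → ℝ) (x v : R3) : fderiv ℝ f x v = ∑ i, v i * pd i f x := by
  have : v = ∑ i, v i • EuclideanSpace.single i (1 : ℝ) := by
    ext j
    fin_cases j <;> simp [Fin.sum_univ_three]
  conv_lhs => rw [this]
  simp [pd]

lemma hasDerivAt_pt {X Y z : ℝ → ℝ} {X' Y' z' s : ℝ} (hX : HasDerivAt X X' s)
    (hY : HasDerivAt Y Y' s) (hz : HasDerivAt z z' s) :
    HasDerivAt (fun τ => pt (X τ) (Y τ) (z τ)) (pt X' Y' z') s := by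
  have h : HasDerivAt (fun τ => ![X τ, Y τ, z τ]) ![X', Y', z'] s := by
    rw [hasDerivAt_pi]
    intro i
    fin_cases i <;> simpa
  exact ((PiLp.continuousLinearEquiv 2 ℝ (fun _ : Fin 3 => ℝ)).symm.toContinuousLinearMap.hasFDerivAt
    |>.comp_hasDerivAt s h)

lemma continuous_pt : Continuous fun p : ℝ × ℝ × ℝ => pt p.1 p.2.1 p.2.2 := by
  unfold pt
  refine (PiLp.continuous_toLp 2 _).comp ?_
  refine continuous_pi fun i => ?_
  fin_cases i <;> simp <;> fun_prop

/-- The chain rule along a moving point, for a field with spatial derivatives that are continuous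
in space and time. -/
lemma hasDerivAt_along {f : ℝ → R3 → ℝ} {γ : ℝ → R3} {s a : ℝ} {v : R3}
    (hf : HasDerivAt (fun τ => f τ (γ s)) a s) (hd : ∀ᶠ τ in 𝓝 s, Differentiable ℝ (f τ))
    (hc : ∀ i, ContinuousAt (fun p : ℝ × R3 => pd i (f p.1) p.2) (s, γ s))
    (hγ : HasDerivAt γ v s) :
    HasDerivAt (fun τ => f τ (γ τ)) (a + ∑ i, v i * pd i (f s) (γ s)) s := by
  have hcf : Tendsto ↿(fun τ x => fderiv ℝ (f τ) x) (𝓝 s ×ˢ 𝓝[univ] γ s) (𝓝 (fderiv ℝ (f s) (γ s))) := by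
    have e : ∀ (τ : ℝ) (x : R3), fderiv ℝ (f τ) x
        = ∑ i, pd i (f τ) x • (EuclideanSpace.proj (𝕜 := ℝ) i : R3 →L[ℝ] ℝ) := by
      intro τ x
      ext v
      rw [fderiv_apply_eq_sum]
      simp [mul_comm]
    rw [nhdsWithin_univ, ← nhds_prod_eq, e]
    have : ↿(fun τ x => fderiv ℝ (f τ) x) = fun p : ℝ × R3 =>
        ∑ i, pd i (f p.1) p.2 • (EuclideanSpace.proj (𝕜 := ℝ) i : R3 →L[ℝ] ℝ) := funext fun p => e _ _
    rw [this]
    exact tendsto_finsetSum _ fun i _ => (hc i).tendsto.smul_const _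
  have h1 : (fun τ => f τ (γ τ) - f τ (γ s) - fderiv ℝ (f s) (γ s) (γ τ - γ s))
      =o[𝓝 s] fun τ => γ τ - γ s := by
    rw [Asymptotics.isLittleO_iff]
    intro ε hε
    rw [nhdsWithin_univ, ← nhds_prod_eq] at hcf
    have h := (Metric.tendsto_nhds.1 hcf) ε hε
    rw [nhds_prod_eq] at h
    obtain ⟨P, hP, Q, hQ, hPQ⟩ := Filter.eventually_prod_iff.1 h
    obtain ⟨ρ, hρ, hball⟩ := Metric.eventually_nhds_iff_ball.1 hQ
    filter_upwards [hd, hP, hγ.continuousAt (Metric.ball_mem_nhds _ hρ)] with τ h1 h2 h3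
    refine (convex_ball (γ s) ρ).norm_image_sub_le_of_norm_fderiv_le' (fun z _ => h1 z)
      (fun z hz => ?_) (Metric.mem_ball_self hρ) h3
    rw [← dist_eq_norm]
    exact (hPQ h2 (hball z hz)).le
  have h2 : HasDerivAt (fun τ => f τ (γ τ) - f τ (γ s)) (fderiv ℝ (f s) (γ s) v) s := by
    have h3 := h1.trans_isBigO hγ.isBigO_sub
    have h4 : HasDerivAt (fun τ => f τ (γ τ) - f τ (γ s) - fderiv ℝ (f s) (γ s) (γ τ - γ s)) 0 s := by
      rw [hasDerivAt_iff_isLittleO]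
      simpa using h3
    have h5 : HasDerivAt (fun τ => fderiv ℝ (f s) (γ s) (γ τ - γ s)) (fderiv ℝ (f s) (γ s) v) s :=
      (fderiv ℝ (f s) (γ s)).hasFDerivAt.comp_hasDerivAt s (hγ.sub_const _)
    simpa using h4.fun_add h5
  have h6 := h2.fun_add hf
  rw [fderiv_apply_eq_sum, add_comm] at h6
  simpa using h6

/-! ### Trajectories -/

/-- Global solvability for time-dependent combinations of compactly supported vector fields, with
the value prescribed at any time `t₀`. -/
lemma exists_ode_solution {E : Type*} [NormedAddCommGroup E] [NormedSpace ℝ E] [CompleteSpace E]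
    (J : ℕ) {Φ : ℕ → E → E} (hΦ : ∀ k, ContDiff ℝ 1 (Φ k)) (hΦ' : ∀ k, HasCompactSupport (Φ k))
    {c : ℕ → ℝ → ℝ} {T : ℝ} (hc : ∀ k, ContinuousOn (c k) (Icc 0 T)) {t₀ : ℝ} (ht : t₀ ∈ Icc 0 T)
    (p : E) : ∃ γ : ℝ → E, γ t₀ = p ∧ ∀ t ∈ Icc 0 T,
      HasDerivWithinAt γ (∑ k ∈ Finset.range J, c k t • Φ k (γ t)) (Icc 0 T) t := by
  have h1 : ∀ k, ∃ L : ℝ≥0, LipschitzWith L (Φ k) := fun k =>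
    (hΦ k).lipschitzWith_of_hasCompactSupport (hΦ' k) (by simp)
  have h2 : ∀ k, ∃ B : ℝ, ∀ x, ‖Φ k x‖ ≤ B := fun k =>
    (hΦ k).continuous.bounded_above_of_compact_support (hΦ' k)
  have h3 : ∀ k, ∃ M : ℝ, ∀ t ∈ Icc 0 T, ‖c k t‖ ≤ M := fun k =>
    isCompact_Icc.exists_bound_of_continuousOn (hc k)
  choose L hL using h1
  choose B hB using h2
  choose M hM using h3
  have hM0 : ∀ k, 0 ≤ M k := fun k => (norm_nonneg _).trans (hM k t₀ ht)
  have hB0 : ∀ k, 0 ≤ B k := fun k => (norm_nonneg _).trans (hB k p)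
  set D : ℝ≥0 := ∑ k ∈ Finset.range J, (M k).toNNReal * (B k).toNNReal with hD
  have hPL : IsPicardLindelof (fun t x => ∑ k ∈ Finset.range J, c k t • Φ k x)
      (⟨t₀, ht⟩ : Icc 0 T) p (D * T.toNNReal) 0 D
      (∑ k ∈ Finset.range J, (M k).toNNReal * L k) := by
    have hT : 0 ≤ T := ht.1.trans ht.2
    refine ⟨fun t ht => ?_, fun x _ => ?_, fun t ht x _ => ?_, ?_⟩
    · refine LipschitzWith.lipschitzOnWith ?_
      refine LipschitzWith.of_dist_le_mul fun x y => ?_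
      rw [dist_eq_norm, ← Finset.sum_sub_distrib]
      push_cast
      rw [Finset.sum_mul]
      refine (norm_sum_le _ _).trans (Finset.sum_le_sum fun k _ => ?_)
      rw [← smul_sub, norm_smul, mul_assoc, Real.coe_toNNReal _ (hM0 k)]
      have := (hL k).dist_le_mul x y
      rw [dist_eq_norm] at this
      exact mul_le_mul (hM k t ht) this (norm_nonneg _) (hM0 k)
    · exact continuousOn_finsetSum _ fun k _ => (hc k).smul continuousOn_const
    · rw [hD]
      push_cast
      refine (norm_sum_le _ _).trans (Finset.sum_le_sum fun k _ => ?_)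
      rw [norm_smul, Real.coe_toNNReal _ (hM0 k), Real.coe_toNNReal _ (hB0 k)]
      exact mul_le_mul (hM k t ht) (hB k x) (norm_nonneg _) (hM0 k)
    · push_cast
      rw [Real.coe_toNNReal _ hT, sub_zero, sub_zero]
      refine mul_le_mul_of_nonneg_left ?_ D.2
      exact max_le (by linarith [ht.1]) (by linarith [ht.2])
  exact hPL.exists_eq_forall_mem_Icc_hasDerivWithinAt₀


lemma velA_pt (J : ℕ) (c : ℕ → ℝ) (X Y z z' : ℝ) : velA J c (pt X Y z) = velA J c (pt X Y z') := by
  simp [velA, dyadicPart, dil, prod3]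

lemma velB_pt (J : ℕ) (c : ℕ → ℝ) (X Y z z' : ℝ) : velB J c (pt X Y z) = velB J c (pt X Y z') := by
  simp [velB, dyadicPart, dil, prod3]

/-- `(X, Y)` is a trajectory on `[0, t]` of the planar velocity with the coefficients `c`. -/
structure IsTraj (J : ℕ) (c : ℕ → ℝ → ℝ) (t : ℝ) (X Y : ℝ → ℝ) : Prop where
  contX : ContinuousOn X (Icc 0 t)
  contY : ContinuousOn Y (Icc 0 t)
  derivX : ∀ s ∈ Ioo 0 t, HasDerivAt X (velA J (fun k => c k s) (pt (X s) (Y s) 0)) s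
  derivY : ∀ s ∈ Ioo 0 t, HasDerivAt Y (velB J (fun k => c k s) (pt (X s) (Y s) 0)) s

lemma hasCompactSupport_gProf : HasCompactSupport gProf :=
  HasCompactSupport.intro (isCompact_Icc (a := 0) (b := 16)) fun x hx => by
    by_contra h
    have := gProf_ne_zero h
    exact hx ⟨by linarith, by linarith⟩

lemma hasCompactSupport_qProf : HasCompactSupport qProf :=
  HasCompactSupport.intro (isCompact_Icc (a := -128) (b := 128)) fun x hx => by
    by_contra h
    have := qProf_ne_zero h
    exact hx ⟨by linarith, by linarith⟩

lemma hasCompactSupport_mul_prod {f h : ℝ → ℝ} (hf : HasCompactSupport f) (hh : HasCompactSupport h)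
    {r : ℝ} (hr : 0 < r) : HasCompactSupport fun p : ℝ × ℝ => f (r⁻¹ * p.1) * h (r⁻¹ * p.2) := by
  have h1 := hf.comp_homeomorph (Homeomorph.mulLeft₀ r⁻¹ (inv_pos.2 hr).ne')
  have h2 := hh.comp_homeomorph (Homeomorph.mulLeft₀ r⁻¹ (inv_pos.2 hr).ne')
  refine HasCompactSupport.intro (h1.isCompact.prod h2.isCompact) fun p hp => ?_
  by_contra h
  exact hp ⟨subset_tsupport _ (left_ne_zero_of_mul h), subset_tsupport _ (right_ne_zero_of_mul h)⟩

lemma exists_isTraj (J : ℕ) {c : ℕ → ℝ → ℝ} {t : ℝ} (ht : 0 ≤ t)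
    (hc : ∀ k, ContinuousOn (c k) (Icc 0 t)) (x y : ℝ) :
    ∃ X Y, IsTraj J c t X Y ∧ X t = x ∧ Y t = y := by
  set Φ : ℕ → ℝ × ℝ → ℝ × ℝ := fun k p =>
    (-(gProf ((scale k)⁻¹ * p.1) * deriv qProf ((scale k)⁻¹ * p.2)),
      deriv gProf ((scale k)⁻¹ * p.1) * qProf ((scale k)⁻¹ * p.2)) with hΦ
  have hcd : ∀ k, ContDiff ℝ (⊤ : ℕ∞) (Φ k) := by
    intro k
    have e1 : ∀ {f : ℝ → ℝ}, ContDiff ℝ (⊤ : ℕ∞) f →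
        ContDiff ℝ (⊤ : ℕ∞) fun p : ℝ × ℝ => f ((scale k)⁻¹ * p.1) := fun hf => hf.comp (by fun_prop)
    have e2 : ∀ {f : ℝ → ℝ}, ContDiff ℝ (⊤ : ℕ∞) f →
        ContDiff ℝ (⊤ : ℕ∞) fun p : ℝ × ℝ => f ((scale k)⁻¹ * p.2) := fun hf => hf.comp (by fun_prop)
    exact ((e1 contDiff_gProf).mul (e2 contDiff_deriv_qProf)).neg.prodMk
      ((e1 contDiff_deriv_gProf).mul (e2 contDiff_qProf))
  have hcs : ∀ k, HasCompactSupport (Φ k) := by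
    intro k
    have h1 := (hasCompactSupport_mul_prod hasCompactSupport_gProf hasCompactSupport_qProf.deriv
      (scale_pos k))
    have h2 := (hasCompactSupport_mul_prod hasCompactSupport_gProf.deriv hasCompactSupport_qProf
      (scale_pos k))
    refine HasCompactSupport.intro (h1.isCompact.union h2.isCompact) fun p hp => ?_
    rw [mem_union, not_or] at hp
    have a1 := image_eq_zero_of_notMem_tsupport hp.1
    have a2 := image_eq_zero_of_notMem_tsupport hp.2
    simp only [hΦ, a1, a2, neg_zero, Prod.mk_zero_zero]
  obtain ⟨γ, hγ, hd⟩ := exists_ode_solution J (fun k => (hcd k).of_le (by norm_cast))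
    hcs hc (right_mem_Icc.2 ht) (x, y)
  have hcont : ContinuousOn γ (Icc 0 t) := fun s hs => (hd s hs).continuousWithinAt
  have hda : ∀ s ∈ Ioo 0 t, HasDerivAt γ _ s := fun s hs =>
    (hd s (Ioo_subset_Icc_self hs)).hasDerivAt (Icc_mem_nhds hs.1 hs.2)
  refine ⟨fun s => (γ s).1, fun s => (γ s).2, ⟨hcont.fst, hcont.snd, fun s hs => ?_, fun s hs => ?_⟩,
    by simp [hγ], by simp [hγ]⟩
  · refine ((ContinuousLinearMap.fst ℝ ℝ ℝ).hasFDerivAt.comp_hasDerivAt s (hda s hs)).congr_deriv ?_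
    simp [velA, dyadicPart, dil, prod3, hΦ, Finset.sum_neg_distrib]
  · refine ((ContinuousLinearMap.snd ℝ ℝ ℝ).hasFDerivAt.comp_hasDerivAt s (hda s hs)).congr_deriv ?_
    simp [velB, dyadicPart, dil, prod3, hΦ]

/-! ### The vorticity along trajectories -/

lemma eq_of_hasDerivAt_zero {f : ℝ → ℝ} {a b : ℝ} (hab : a ≤ b) (hf : ContinuousOn f (Icc a b))
    (hd : ∀ s ∈ Ioo a b, HasDerivAt f 0 s) : f b = f a := by
  rcases hab.eq_or_lt with rfl | h
  · rfl
  obtain ⟨c, -, hc⟩ := exists_hasDerivAt_eq_slope f (fun _ => 0) h hf hd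
  have : b - a ≠ 0 := by linarith
  field_simp at hc
  linarith

lemma hasDerivAt_line (i : Fin 3) {f : R3 → ℝ} (hf : Differentiable ℝ f) {γ : ℝ → R3} {s v : ℝ}
    (hγ : HasDerivAt γ (EuclideanSpace.single i v) s) :
    HasDerivAt (fun τ => f (γ τ)) (v * pd i f (γ s)) s := by
  refine ((hf (γ s)).hasFDerivAt.comp_hasDerivAt s hγ).congr_deriv ?_
  rw [fderiv_apply_eq_sum, Finset.sum_eq_single i]
  · simp
  · intro j _ hj; simp [hj]
  · simp

lemma pd_two_pt {f : R3 → ℝ} (hf : Differentiable ℝ f) (X Y z : ℝ) :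
    HasDerivAt (fun ζ => f (pt X Y ζ)) (pd 2 f (pt X Y z)) z := by
  have h := hasDerivAt_pt (hasDerivAt_const z X) (hasDerivAt_const z Y) (hasDerivAt_id z)
  have e : pt 0 0 1 = EuclideanSpace.single 2 1 := by ext i; fin_cases i <;> simp [pt]
  rw [e] at h
  simpa using hasDerivAt_line 2 hf h

lemma hasDerivAt_ray {f : R3 → ℝ} (hf : Differentiable ℝ f) (X Y z l : ℝ) :
    HasDerivAt (fun l => f (pt (l * X) Y z)) (X * pd 0 f (pt (l * X) Y z)) l := by
  have h := hasDerivAt_pt ((hasDerivAt_id l).mul_const X) (hasDerivAt_const l Y) (hasDerivAt_const l z)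
  have e : pt (1 * X) 0 0 = EuclideanSpace.single 0 X := by ext i; fin_cases i <;> simp [pt]
  rw [e] at h
  exact hasDerivAt_line 0 hf h

section
variable {J : ℕ} {ω : ℝ → R3 → Alt2} {t : ℝ} {X Y : ℝ → ℝ}

lemma pt_mem_slab {z : ℝ} (hz : z ∈ Ioo (2 * scale J) (5 * scale J)) (x y : ℝ) :
    pt x y z ∈ slab J := hz

lemma continuousOn_along {f : ℝ × R3 → ℝ} {z : ℝ}
    (hf : ContinuousOn f (Icc 0 1 ×ˢ univ)) (ht1 : t ≤ 1) (hX : ContinuousOn X (Icc 0 t))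
    (hY : ContinuousOn Y (Icc 0 t)) :
    ContinuousOn (fun s => f (s, pt (X s) (Y s) z)) (Icc 0 t) := by
  refine hf.comp (f := fun s => (s, pt (X s) (Y s) z)) (continuousOn_id.prodMk
    (continuous_pt.comp_continuousOn (hX.prodMk (hY.prodMk continuousOn_const)))) ?_
  intro s hs
  exact ⟨⟨hs.1, hs.2.trans ht1⟩, trivial⟩

lemma RegularFamily.hasDerivAt_along (hreg : RegularFamily ω) {s a : ℝ} (hs : s ∈ Ioo (0 : ℝ) 1)
    (i j : Fin 3) {x y z : ℝ → ℝ} {x' y' z' : ℝ} (hx : HasDerivAt x x' s) (hy : HasDerivAt y y' s)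
    (hz : HasDerivAt z z' s)
    (hf : HasDerivWithinAt (fun τ => comp (ω τ) i j (pt (x s) (y s) (z s))) a (Icc 0 1) s) :
    HasDerivAt (fun τ => comp (ω τ) i j (pt (x τ) (y τ) (z τ)))
      (a + (x' * pd 0 (comp (ω s) i j) (pt (x s) (y s) (z s))
        + y' * pd 1 (comp (ω s) i j) (pt (x s) (y s) (z s))
        + z' * pd 2 (comp (ω s) i j) (pt (x s) (y s) (z s)))) s := by
  have hn : Icc (0 : ℝ) 1 ∈ 𝓝 s := Icc_mem_nhds hs.1 hs.2
  have h := GenEuler.hasDerivAt_along (f := fun τ => comp (ω τ) i j)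
    (γ := fun τ => pt (x τ) (y τ) (z τ)) (hf.hasDerivAt hn)
    (by filter_upwards [hn] with τ hτ using hreg.diff τ hτ i j)
    (fun q => (hreg.cont_pd q i j).continuousAt (prod_mem_nhds hn univ_mem))
    (hasDerivAt_pt hx hy hz)
  refine h.congr_deriv ?_
  simp [Fin.sum_univ_three]

/-- In the layer the component `ω₀₁` is constant along trajectories. -/
lemma SlabFlow.transport (hS : SlabFlow J ω) (hreg : RegularFamily ω) (ht : 0 ≤ t) (ht1 : t ≤ 1)
    (hT : IsTraj J (mode ω) t X Y) {z : ℝ} (hz : z ∈ Ioo (2 * scale J) (5 * scale J)) :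
    comp (ω t) 0 1 (pt (X t) (Y t) z) = comp (ω 0) 0 1 (pt (X 0) (Y 0) z) := by
  refine eq_of_hasDerivAt_zero (f := fun s => comp (ω s) 0 1 (pt (X s) (Y s) z)) ht
    (continuousOn_along (hreg.cont 0 1) ht1 hT.contX hT.contY) fun s hs => ?_
  have hs1 : s ∈ Ioo (0 : ℝ) 1 := ⟨hs.1, hs.2.trans_le ht1⟩
  have h := hreg.hasDerivAt_along hs1 0 1 (hT.derivX s hs) (hT.derivY s hs) (hasDerivAt_const s z)
    (hS.deriv01 s (Ioo_subset_Icc_self hs1) _ (pt_mem_slab hz (X s) (Y s)))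
  refine h.congr_deriv ?_
  rw [velA_pt J _ (X s) (Y s) z 0, velB_pt J _ (X s) (Y s) z 0]
  ring

lemma RegularFamily.continuousOn_mode (hreg : RegularFamily ω) (k : ℕ) :
    ContinuousOn (mode ω k) (Icc 0 1) :=
  (continuousOn_const.mul (hreg.continuousOn_sens k)).mul continuousOn_const

/-- As all points of a vertical segment in the layer move along the same planar trajectory, the
vertical derivative of `ω₀₁` is bounded by its initial values. -/
lemma SlabFlow.abs_pd_two_le (hS : SlabFlow J ω) (hreg : RegularFamily ω) {ε : ℝ}
    (hε : ∀ y, |pd 2 (comp (ω 0) 0 1) y| ≤ ε) (ht : t ∈ Icc (0 : ℝ) 1) {x : R3} (hx : x ∈ slab J) :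
    |pd 2 (comp (ω t) 0 1) x| ≤ ε := by
  obtain ⟨X, Y, hT, hX, hY⟩ := exists_isTraj J ht.1
    (fun k => (hreg.continuousOn_mode k).mono (Icc_subset_Icc_right ht.2)) (x 0) (x 1)
  have h1 := pd_two_pt (hreg.diff t ht 0 1) (x 0) (x 1) (x 2)
  have h2 := pd_two_pt (hreg.diff 0 ⟨le_rfl, zero_le_one⟩ 0 1) (X 0) (Y 0) (x 2)
  have hev : (fun ζ => comp (ω t) 0 1 (pt (x 0) (x 1) ζ)) =ᶠ[𝓝 (x 2)]
      fun ζ => comp (ω 0) 0 1 (pt (X 0) (Y 0) ζ) := by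
    filter_upwards [Ioo_mem_nhds hx.1 hx.2] with ζ hζ
    rw [← hX, ← hY]
    exact hS.transport hreg ht.1 ht.2 hT hζ
  have h3 := h1.unique (h2.congr_of_eventuallyEq hev)
  rw [pt_eta] at h3
  rw [h3]
  exact hε _

end

/-! ### The potential of the vorticity along trajectories -/

lemma continuousOn_dyadicPart {c : ℕ → ℝ → ℝ} {s : Set ℝ} (hc : ∀ k, ContinuousOn (c k) s)
    {f : R3 → ℝ} (hf : Continuous f) (J : ℕ) :
    ContinuousOn (fun p : ℝ × R3 => dyadicPart (fun k => c k p.1) f J p.2) (s ×ˢ univ) := by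
  unfold dyadicPart
  refine continuousOn_finsetSum _ fun k _ => ?_
  refine ((hc k).comp continuousOn_fst fun p hp => hp.1).mul ?_
  exact (hf.comp ((continuous_const_smul _).comp continuous_snd)).continuousOn

section
variable {J : ℕ} {ω : ℝ → R3 → Alt2} {t : ℝ} {X Y : ℝ → ℝ}

lemma RegularFamily.continuousOn_velA (hreg : RegularFamily ω) (J : ℕ) :
    ContinuousOn (fun p : ℝ × R3 => velA J (fun k => mode ω k p.1) p.2) (Icc 0 1 ×ˢ univ) :=
  (continuousOn_dyadicPart hreg.continuousOn_mode
    (contDiff_prod3 contDiff_gProf contDiff_deriv_qProf contDiff_const).continuous J).neg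

lemma RegularFamily.continuousOn_velB (hreg : RegularFamily ω) (J : ℕ) :
    ContinuousOn (fun p : ℝ × R3 => velB J (fun k => mode ω k p.1) p.2) (Icc 0 1 ×ˢ univ) :=
  continuousOn_dyadicPart hreg.continuousOn_mode
    (contDiff_prod3 contDiff_deriv_gProf contDiff_qProf contDiff_const).continuous J

lemma continuous_pd {f : R3 → ℝ} (hf : ContDiff ℝ (⊤ : ℕ∞) f) (i : Fin 3) : Continuous (pd i f) :=
  (hf.continuous_fderiv (by simp)).clm_apply continuous_const

/-- The planar flux `A ω₀₂ + B ω₁₂` of the vorticity. -/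
def flux (J : ℕ) (ω : ℝ → R3 → Alt2) (s : ℝ) (y : R3) : ℝ :=
  velA J (fun k => mode ω k s) y * comp (ω s) 0 2 y
    + velB J (fun k => mode ω k s) y * comp (ω s) 1 2 y

lemma RegularFamily.differentiable_flux (hreg : RegularFamily ω) (J : ℕ) {s : ℝ}
    (hs : s ∈ Icc (0 : ℝ) 1) : Differentiable ℝ (flux J ω s) :=
  (((contDiff_velA J _).differentiable (by simp)).mul (hreg.diff s hs 0 2)).add
    (((contDiff_velB J _).differentiable (by simp)).mul (hreg.diff s hs 1 2))

lemma RegularFamily.continuousOn_pd_flux (hreg : RegularFamily ω) (J : ℕ) :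
    ContinuousOn (fun p : ℝ × R3 => pd 0 (flux J ω p.1) p.2) (Icc 0 1 ×ˢ univ) := by
  have hm : ∀ k, ContinuousOn (fun t => mode ω k t * (scale k)⁻¹) (Icc 0 1) := fun k =>
    (hreg.continuousOn_mode k).mul continuousOn_const
  have hA : ContinuousOn (fun p : ℝ × R3 => pd 0 (velA J fun k => mode ω k p.1) p.2)
      (Icc 0 1 ×ˢ univ) := by
    simp only [pd_velA]
    exact (continuousOn_dyadicPart hm (continuous_pd
      (contDiff_prod3 contDiff_gProf contDiff_deriv_qProf contDiff_const) 0) J).neg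
  have hB : ContinuousOn (fun p : ℝ × R3 => pd 0 (velB J fun k => mode ω k p.1) p.2)
      (Icc 0 1 ×ˢ univ) := by
    simp only [pd_velB]
    exact continuousOn_dyadicPart hm (continuous_pd
      (contDiff_prod3 contDiff_deriv_gProf contDiff_qProf contDiff_const) 0) J
  refine (((hA.mul (hreg.cont 0 2)).add ((hreg.continuousOn_velA J).mul (hreg.cont_pd 0 0 2))).add
    ((hB.mul (hreg.cont 1 2)).add ((hreg.continuousOn_velB J).mul (hreg.cont_pd 0 1 2)))).congr ?_
  rintro ⟨s, y⟩ ⟨hs, -⟩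
  have dA := (contDiff_velA J fun k => mode ω k s).differentiable (by simp) y
  have dB := (contDiff_velB J fun k => mode ω k s).differentiable (by simp) y
  have dG := hreg.diff s hs 0 2 y
  have dH := hreg.diff s hs 1 2 y
  change pd 0 (flux J ω s) y = (pd 0 (velA J fun k => mode ω k s) y * comp (ω s) 0 2 y
      + velA J (fun k => mode ω k s) y * pd 0 (comp (ω s) 0 2) y)
    + (pd 0 (velB J fun k => mode ω k s) y * comp (ω s) 1 2 y
      + velB J (fun k => mode ω k s) y * pd 0 (comp (ω s) 1 2) y)
  rw [← pd_mul dA dG, ← pd_mul dB dH, pd]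
  unfold flux
  rw [fderiv_fun_add (dA.fun_mul dG) (dB.fun_mul dH)]
  rfl

/-- The potential `∫₀^{x₀} ω₀₂(l, x₁, x₂) dl`. -/
def axialPot (w : R3 → Alt2) (x : R3) : ℝ :=
  ∫ l in (0 : ℝ)..1, x 0 * comp w 0 2 (pt (l * x 0) (x 1) (x 2))

/-- The time derivative of the integrand of the potential along a trajectory. -/
def potRate (J : ℕ) (ω : ℝ → R3 → Alt2) (X Y : ℝ → ℝ) (z s l : ℝ) : ℝ :=
  velA J (fun k => mode ω k s) (pt (X s) (Y s) 0) * comp (ω s) 0 2 (pt (l * X s) (Y s) z)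
    + X s * (-(pd 0 (flux J ω s) (pt (l * X s) (Y s) z)
        + velB J (fun k => mode ω k s) (pt (l * X s) (Y s) z)
          * pd 2 (comp (ω s) 0 1) (pt (l * X s) (Y s) z))
      + (l * velA J (fun k => mode ω k s) (pt (X s) (Y s) 0)
          * pd 0 (comp (ω s) 0 2) (pt (l * X s) (Y s) z)
        + velB J (fun k => mode ω k s) (pt (X s) (Y s) 0)
          * pd 1 (comp (ω s) 0 2) (pt (l * X s) (Y s) z)))

lemma continuousOn_along_ray {f : ℝ × R3 → ℝ} {z : ℝ}
    (hf : ContinuousOn f (Icc 0 1 ×ˢ univ)) (ht1 : t ≤ 1) (hX : ContinuousOn X (Icc 0 t))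
    (hY : ContinuousOn Y (Icc 0 t)) :
    ContinuousOn (fun p : ℝ × ℝ => f (p.1, pt (p.2 * X p.1) (Y p.1) z)) (Icc 0 t ×ˢ univ) := by
  have hX' : ContinuousOn (fun p : ℝ × ℝ => X p.1) (Icc 0 t ×ˢ univ) :=
    hX.comp continuousOn_fst fun p hp => hp.1
  have hY' : ContinuousOn (fun p : ℝ × ℝ => Y p.1) (Icc 0 t ×ˢ univ) :=
    hY.comp continuousOn_fst fun p hp => hp.1
  refine hf.comp (f := fun p : ℝ × ℝ => (p.1, pt (p.2 * X p.1) (Y p.1) z))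
    (continuousOn_fst.prodMk (continuous_pt.comp_continuousOn
      ((continuousOn_snd.mul hX').prodMk (hY'.prodMk continuousOn_const)))) ?_
  intro p hp
  exact ⟨⟨hp.1.1, hp.1.2.trans ht1⟩, trivial⟩

lemma RegularFamily.continuousOn_potRate (hreg : RegularFamily ω) (ht1 : t ≤ 1)
    (hX : ContinuousOn X (Icc 0 t)) (hY : ContinuousOn Y (Icc 0 t)) (J : ℕ) (z : ℝ) :
    ContinuousOn (fun p : ℝ × ℝ => potRate J ω X Y z p.1 p.2) (Icc 0 t ×ˢ univ) := by
  have hX' : ContinuousOn (fun p : ℝ × ℝ => X p.1) (Icc 0 t ×ˢ univ) :=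
    hX.comp continuousOn_fst fun p hp => hp.1
  have hA : ContinuousOn (fun p : ℝ × ℝ => velA J (fun k => mode ω k p.1) (pt (X p.1) (Y p.1) 0))
      (Icc 0 t ×ˢ univ) :=
    (continuousOn_along (hreg.continuousOn_velA J) ht1 hX hY).comp continuousOn_fst fun p hp => hp.1
  have hB : ContinuousOn (fun p : ℝ × ℝ => velB J (fun k => mode ω k p.1) (pt (X p.1) (Y p.1) 0))
      (Icc 0 t ×ˢ univ) :=
    (continuousOn_along (hreg.continuousOn_velB J) ht1 hX hY).comp continuousOn_fst fun p hp => hp.1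
  have r := fun {f : ℝ × R3 → ℝ} (hf : ContinuousOn f (Icc 0 1 ×ˢ univ)) =>
    continuousOn_along_ray (z := z) hf ht1 hX hY
  exact (hA.mul (r (hreg.cont 0 2))).add (hX'.mul (((r (hreg.continuousOn_pd_flux J)).add
    ((r (hreg.continuousOn_velB J)).mul (r (hreg.cont_pd 2 0 1)))).neg.add
      (((continuousOn_snd.mul hA).mul (r (hreg.cont_pd 0 0 2))).add
        (hB.mul (r (hreg.cont_pd 1 0 2))))))

lemma SlabFlow.hasDerivAt_integrand (hS : SlabFlow J ω) (hreg : RegularFamily ω) (ht1 : t ≤ 1)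
    (hT : IsTraj J (mode ω) t X Y) {z : ℝ} (hz : z ∈ Ioo (2 * scale J) (5 * scale J)) {s : ℝ}
    (hs : s ∈ Ioo 0 t) (l : ℝ) :
    HasDerivAt (fun τ => X τ * comp (ω τ) 0 2 (pt (l * X τ) (Y τ) z)) (potRate J ω X Y z s l) s := by
  have hs1 : s ∈ Ioo (0 : ℝ) 1 := ⟨hs.1, hs.2.trans_le ht1⟩
  have h := hreg.hasDerivAt_along hs1 0 2 ((hT.derivX s hs).const_mul l) (hT.derivY s hs)
    (hasDerivAt_const s z) (hS.deriv02 s (Ioo_subset_Icc_self hs1) _ (pt_mem_slab hz (l * X s) (Y s)))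
  refine ((hT.derivX s hs).fun_mul h).congr_deriv ?_
  unfold potRate flux
  ring

/-- The rate of change of the potential along a trajectory: by closedness of the vorticity, all
terms but those with the vertical derivative of `ω₀₁` are an axial derivative. -/
lemma SlabFlow.integral_potRate (hS : SlabFlow J ω) (hreg : RegularFamily ω) (ht1 : t ≤ 1)
    {z : ℝ} (hz : z ∈ Ioo (2 * scale J) (5 * scale J)) {s : ℝ} (hs : s ∈ Ioo 0 t) :
    ∫ l in (0 : ℝ)..1, potRate J ω X Y z s l = ∫ l in (0 : ℝ)..1,
      X s * ((velB J (fun k => mode ω k s) (pt (X s) (Y s) 0)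
        - velB J (fun k => mode ω k s) (pt (l * X s) (Y s) z))
          * pd 2 (comp (ω s) 0 1) (pt (l * X s) (Y s) z)) := by
  have hs1 : s ∈ Icc (0 : ℝ) 1 := ⟨hs.1.le, hs.2.le.trans ht1⟩
  set a := velA J (fun k => mode ω k s) (pt (X s) (Y s) 0) with ha
  set b := velB J (fun k => mode ω k s) (pt (X s) (Y s) 0) with hb
  have cont : ∀ {f : ℝ × R3 → ℝ}, ContinuousOn f (Icc 0 1 ×ˢ univ) →
      Continuous fun l => f (s, pt (l * X s) (Y s) z) := by
    intro f hf
    refine continuousOn_univ.1 (hf.comp (f := fun l => (s, pt (l * X s) (Y s) z)) ?_ ?_)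
    · exact (continuous_const.prodMk (continuous_pt.comp (by fun_prop : Continuous fun l : ℝ =>
        (l * X s, Y s, z)))).continuousOn
    · exact fun l _ => ⟨hs1, trivial⟩
  have c1 := cont (hreg.cont 0 2)
  have c2 := cont (hreg.cont_pd 0 0 2)
  have c3 := cont (hreg.continuousOn_pd_flux J)
  have c4 := cont (hreg.cont_pd 0 1 2)
  have c5 := cont (hreg.continuousOn_velB J)
  have c6 := cont (hreg.cont_pd 2 0 1)
  simp only at c1 c2 c3 c4 c5 c6
  set P' : ℝ → ℝ := fun l => (1 * a) * comp (ω s) 0 2 (pt (l * X s) (Y s) z)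
      + (l * a) * (X s * pd 0 (comp (ω s) 0 2) (pt (l * X s) (Y s) z))
      - X s * pd 0 (flux J ω s) (pt (l * X s) (Y s) z)
      + b * (X s * pd 0 (comp (ω s) 1 2) (pt (l * X s) (Y s) z)) with hP'
  have hder : ∀ l ∈ uIcc (0 : ℝ) 1, HasDerivAt (fun l => (l * a) * comp (ω s) 0 2 (pt (l * X s) (Y s) z)
      - flux J ω s (pt (l * X s) (Y s) z) + b * comp (ω s) 1 2 (pt (l * X s) (Y s) z)) (P' l) l := by
    intro l _
    exact ((((hasDerivAt_id l).mul_const a).fun_mul (hasDerivAt_ray (hreg.diff s hs1 0 2) _ _ _ _)).fun_sub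
      (hasDerivAt_ray (hreg.differentiable_flux J hs1) _ _ _ _)).fun_add
        ((hasDerivAt_ray (hreg.diff s hs1 1 2) _ _ _ _).const_mul b)
  have hPc : Continuous P' := by fun_prop
  have hP0 := intervalIntegral.integral_eq_sub_of_hasDerivAt hder (hPc.intervalIntegrable 0 1)
  have hv := fun i j => hS.vanish s hs1 (pt 0 (Y s) z) (pt_mem_slab hz _ _) le_rfl i j
  have e1 : velA J (fun k => mode ω k s) (pt (X s) (Y s) z) = a := velA_pt _ _ _ _ _ _
  have e2 : velB J (fun k => mode ω k s) (pt (X s) (Y s) z) = b := velB_pt _ _ _ _ _ _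
  -- At `l = 1` the terms cancel since `(a, b)` is the velocity there; at `l = 0` the vorticity is `0`.
  have hzero : ∫ l in (0 : ℝ)..1, P' l = 0 := by
    rw [hP0]
    simp only [flux, one_mul, zero_mul, hv, e1, e2]
    ring
  have hsplit : ∀ l, potRate J ω X Y z s l = P' l + X s * ((b
        - velB J (fun k => mode ω k s) (pt (l * X s) (Y s) z))
          * pd 2 (comp (ω s) 0 1) (pt (l * X s) (Y s) z)) := by
    intro l
    have hcl := hreg.closed s hs1 (pt (l * X s) (Y s) z) 0 1 2
    simp only [extD2] at hcl
    simp only [potRate, hP', ← ha, ← hb]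
    linear_combination (-(X s * b)) * hcl
  simp_rw [hsplit]
  rw [intervalIntegral.integral_add (hPc.intervalIntegrable 0 1)
    (Continuous.intervalIntegrable (by fun_prop) 0 1), hzero, zero_add]

/-- The potential is almost conserved along trajectories as long as the initial vertical derivative
of `ω₀₁` is small. -/
lemma SlabFlow.abs_axialPot_sub_le (hS : SlabFlow J ω) (hreg : RegularFamily ω) (ht : 0 ≤ t)
    (ht1 : t ≤ 1) (hT : IsTraj J (mode ω) t X Y) {z : ℝ}
    (hz : z ∈ Ioo (2 * scale J) (5 * scale J)) {K R ε : ℝ}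
    (hK : ∀ s ∈ Icc 0 t, ∀ x, |velB J (fun k => mode ω k s) x| ≤ K)
    (hR : ∀ s ∈ Icc 0 t, |X s| ≤ R) (hε : ∀ y, |pd 2 (comp (ω 0) 0 1) y| ≤ ε) :
    |axialPot (ω t) (pt (X t) (Y t) z) - axialPot (ω 0) (pt (X 0) (Y 0) z)| ≤ R * (2 * K * ε) := by
  have h0 : (0 : ℝ) ∈ Icc 0 t := ⟨le_rfl, ht⟩
  have hK0 : 0 ≤ K := (abs_nonneg _).trans (hK 0 h0 0)
  have hR0 : 0 ≤ R := (abs_nonneg _).trans (hR 0 h0)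
  have hε0 : 0 ≤ ε := (abs_nonneg _).trans (hε 0)
  have hbd : 0 ≤ R * (2 * K * ε) := by positivity
  rcases ht.eq_or_lt with rfl | htp
  · simpa using hbd
  have hF : ContinuousOn (fun p : ℝ × ℝ => X p.1 * comp (ω p.1) 0 2 (pt (p.2 * X p.1) (Y p.1) z))
      (Icc 0 t ×ˢ univ) :=
    (hT.contX.comp continuousOn_fst fun p hp => hp.1).mul
      (continuousOn_along_ray (hreg.cont 0 2) ht1 hT.contX hT.contY)
  have hF' := hreg.continuousOn_potRate ht1 hT.contX hT.contY J z
  have slice : ∀ {f : ℝ × ℝ → ℝ}, ContinuousOn f (Icc 0 t ×ˢ univ) → ∀ s ∈ Icc 0 t,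
      Continuous fun l => f (s, l) := by
    intro f hf s hs
    exact continuousOn_univ.1 (hf.comp (f := fun l => (s, l)) (by fun_prop) fun l _ => ⟨hs, trivial⟩)
  have hcpt : IsCompact (Icc 0 t ×ˢ Icc (0 : ℝ) 1) := isCompact_Icc.prod isCompact_Icc
  obtain ⟨M, hM⟩ := hcpt.exists_bound_of_continuousOn (hF.mono (by gcongr; exact subset_univ _))
  obtain ⟨M', hM'⟩ := hcpt.exists_bound_of_continuousOn (hF'.mono (by gcongr; exact subset_univ _))
  have hI : ∀ l ∈ uIoc (0 : ℝ) 1, l ∈ Icc (0 : ℝ) 1 := by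
    intro l hl
    rw [uIoc_of_le zero_le_one] at hl
    exact Ioc_subset_Icc_self hl
  have hcont : ContinuousOn (fun s => axialPot (ω s) (pt (X s) (Y s) z)) (Icc 0 t) := by
    intro s hs
    refine intervalIntegral.continuousWithinAt_of_dominated_interval (bound := fun _ => M) ?_ ?_ ?_ ?_
    · filter_upwards [self_mem_nhdsWithin] with τ hτ
      exact (slice hF τ hτ).aestronglyMeasurable
    · filter_upwards [self_mem_nhdsWithin] with τ hτ
      exact Eventually.of_forall fun l hl => hM (τ, l) ⟨hτ, hI l hl⟩
    · exact intervalIntegrable_const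
    · refine Eventually.of_forall fun l _ => ?_
      exact (hF.comp (f := fun s => (s, l)) (by fun_prop) fun s hs => ⟨hs, trivial⟩) s hs
  have hder : ∀ s ∈ Ioo 0 t, HasDerivAt (fun s => axialPot (ω s) (pt (X s) (Y s) z))
      (∫ l in (0 : ℝ)..1, potRate J ω X Y z s l) s := by
    intro s hs
    refine (intervalIntegral.hasDerivAt_integral_of_dominated_loc_of_deriv_le (𝕜 := ℝ)
      (F := fun s l => X s * comp (ω s) 0 2 (pt (l * X s) (Y s) z))
      (F' := fun s l => potRate J ω X Y z s l) (bound := fun _ => M')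
      (Ioo_mem_nhds hs.1 hs.2) ?_ ?_ ?_ ?_ ?_ ?_).2
    · filter_upwards [Ioo_mem_nhds hs.1 hs.2] with τ hτ
      exact (slice hF τ (Ioo_subset_Icc_self hτ)).aestronglyMeasurable
    · exact (slice hF s (Ioo_subset_Icc_self hs)).intervalIntegrable 0 1
    · exact (slice hF' s (Ioo_subset_Icc_self hs)).aestronglyMeasurable
    · exact Eventually.of_forall fun l hl τ hτ => hM' (τ, l) ⟨Ioo_subset_Icc_self hτ, hI l hl⟩
    · exact intervalIntegrable_const
    · exact Eventually.of_forall fun l _ τ hτ => hS.hasDerivAt_integrand hreg ht1 hT hz hτ l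
  obtain ⟨s, hs, hsl⟩ := exists_hasDerivAt_eq_slope _ _ htp hcont hder
  have hb : |∫ l in (0 : ℝ)..1, potRate J ω X Y z s l| ≤ R * (2 * K * ε) := by
    have hs' := Ioo_subset_Icc_self hs
    rw [hS.integral_potRate hreg ht1 hz hs, ← Real.norm_eq_abs]
    refine (intervalIntegral.norm_integral_le_of_norm_le_const (C := R * (2 * K * ε)) fun l _ => ?_).trans
      (by simp)
    rw [Real.norm_eq_abs, abs_mul, abs_mul]
    have h1 := hS.abs_pd_two_le hreg hε ⟨hs'.1, hs'.2.trans ht1⟩ (pt_mem_slab hz (l * X s) (Y s))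
    have h2 := (abs_sub _ _).trans (add_le_add (hK s hs' (pt (X s) (Y s) 0))
      (hK s hs' (pt (l * X s) (Y s) z)))
    have h3 := hR s hs'
    rw [← two_mul] at h2
    exact mul_le_mul h3 (mul_le_mul h2 h1 (abs_nonneg _) (by positivity)) (by positivity) hR0
  have hmul : axialPot (ω t) (pt (X t) (Y t) z) - axialPot (ω 0) (pt (X 0) (Y 0) z)
      = (∫ l in (0 : ℝ)..1, potRate J ω X Y z s l) * t := by
    rw [hsl]; field_simp; ring
  rw [hmul, abs_mul, abs_of_nonneg ht]
  nlinarith [abs_nonneg (∫ l in (0 : ℝ)..1, potRate J ω X Y z s l)]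

end

/-! ### The sensors as averages of the potential -/

lemma axialPot_eq (w : R3 → Alt2) (x : R3) :
    axialPot w x = ∫ l in (0 : ℝ)..x 0, comp w 0 2 (pt l (x 1) (x 2)) := by
  have h := intervalIntegral.mul_integral_comp_mul_right (a := 0) (b := 1)
    (f := fun l => comp w 0 2 (pt l (x 1) (x 2))) (x 0)
  rw [zero_mul, one_mul] at h
  rw [← h, axialPot, intervalIntegral.integral_const_mul]

lemma continuous_ray {a : ℝ → ℝ} (ha : Continuous a) (Y z : ℝ) : Continuous fun l => pt (a l) Y z :=
  continuous_pt.comp (ha.prodMk (continuous_const.prodMk continuous_const))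

lemma continuous_axialPot {w : R3 → Alt2} (hw : Continuous (comp w 0 2)) :
    Continuous (axialPot w) := by
  have hx := fun i => (contDiff_coord i).continuous
  refine intervalIntegral.continuous_parametric_intervalIntegral_of_continuous'
    (f := fun (x : R3) l => x 0 * comp w 0 2 (pt (l * x 0) (x 1) (x 2))) ?_ 0 1
  exact ((hx 0).comp continuous_fst).mul (hw.comp (continuous_pt.comp
    ((continuous_snd.mul ((hx 0).comp continuous_fst)).prodMk
      (((hx 1).comp continuous_fst).prodMk ((hx 2).comp continuous_fst)))))

lemma hasLineDerivAt_axialPot {w : R3 → Alt2} (hw : Continuous (comp w 0 2)) (x : R3) :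
    HasLineDerivAt ℝ (axialPot w) (comp w 0 2 x) x (EuclideanSpace.single 0 1) := by
  have hc : Continuous fun l => comp w 0 2 (pt l (x 1) (x 2)) :=
    hw.comp (continuous_ray (by fun_prop) _ _)
  have h1 : HasDerivAt (fun u => ∫ l in (0 : ℝ)..u, comp w 0 2 (pt l (x 1) (x 2)))
      (comp w 0 2 x) (x 0 + 0) := by
    rw [add_zero]
    have := intervalIntegral.integral_hasDerivAt_right (hc.intervalIntegrable 0 (x 0))
      (hc.stronglyMeasurableAtFilter _ _) hc.continuousAt
    rwa [pt_eta] at this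
  have h2 := h1.comp_const_add (x 0) 0
  refine h2.congr_of_eventuallyEq (Eventually.of_forall fun τ => ?_)
  simp [axialPot_eq]

/-- Integration by parts along the axis turns the reading of the sensor into an average of the
potential, provided that the vorticity vanishes for `x₀ ≤ 0`, where the sensor is not controlled. -/
lemma mode_eq {ω : ℝ → R3 → Alt2} {t : ℝ} {J : ℕ} (hw : Continuous (comp (ω t) 0 2))
    (hv : ∀ x ∈ slab J, x 0 ≤ 0 → comp (ω t) 0 2 x = 0) :
    mode ω J t = (scale J)⁻¹ ^ 3 * mass⁻¹ * ∫ x, dil (scale J) density x * axialPot (ω t) x := by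
  have hJ := scale_pos J
  have hb := isTest_sensor.dil hJ
  have hΘ := continuous_axialPot hw
  have hint : ∀ {f h : R3 → ℝ}, IsTest f → Continuous h → Integrable fun x => f x * h x := fun hf hh =>
    (hf.continuous.mul hh).integrable_of_hasCompactSupport hf.2.mul_right
  have hparts : ∫ x, dil (scale J) sensor x * comp (ω t) 0 2 x
      = -∫ x, pd 0 (dil (scale J) sensor) x * axialPot (ω t) x := by
    refine integral_bilinear_hasLineDerivAt_right_eq_neg_left_of_integrable
      (B := ContinuousLinearMap.mul ℝ ℝ) (v := EuclideanSpace.single 0 1) ?_ ?_ ?_ ?_ ?_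
    · exact hint (hb.pd 0) hΘ
    · exact hint hb hw
    · exact hint hb hΘ
    · exact fun x _ => (hb.differentiable x).hasFDerivAt.hasLineDerivAt _
    · exact fun x _ => hasLineDerivAt_axialPot hw x
  have hpt : ∀ x, pd 0 (dil (scale J) sensor) x * axialPot (ω t) x
      = -((scale J)⁻¹ * mass⁻¹ * (dil (scale J) density x * axialPot (ω t) x)) := by
    intro x
    rw [pd_dil isTest_sensor.differentiable, dil_apply, dil_apply]
    rcases le_or_gt (x 0) 0 with h0 | h0
    · have hd : density ((scale J)⁻¹ • x) = 0 := by
        by_contra h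
        have := (density_ne_zero h).1.1
        rw [smul_coord] at this
        have := mul_nonpos_of_nonneg_of_nonpos (inv_pos.2 hJ).le h0
        linarith
      rw [hd]
      by_cases hp : pd 0 sensor ((scale J)⁻¹ • x) = 0
      · rw [hp]; ring
      · have h2 : 3 < ((scale J)⁻¹ • x) 2 ∧ ((scale J)⁻¹ • x) 2 < 4 := by
          rw [sensor, pd_presensor] at hp
          exact (presensor_ne_zero hp).2.2
        rw [smul_coord, inv_mul_eq_div, lt_div_iff₀ hJ, div_lt_iff₀ hJ] at h2
        have hz : axialPot (ω t) x = 0 := by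
          unfold axialPot
          rw [intervalIntegral.integral_congr (g := fun _ => 0), intervalIntegral.integral_zero]
          intro l hl
          rw [uIcc_of_le zero_le_one] at hl
          simp only
          rw [hv, mul_zero]
          · exact ⟨by rw [pt_two]; linarith [h2.1], by rw [pt_two]; linarith [h2.2]⟩
          · exact mul_nonpos_of_nonneg_of_nonpos hl.1 h0
        rw [hz]; ring
    · rw [pd_sensor (by rw [smul_coord]; positivity)]
      ring
  unfold mode sens
  rw [hparts]
  simp_rw [hpt]
  rw [integral_neg, integral_const_mul]
  ring

/-- The region over which the sensor at scale `J` averages the potential. -/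
def sensorBox (J : ℕ) : Set R3 := {x | (2 * scale J < x 0 ∧ x 0 < 3 * scale J) ∧ |x 1| < scale J ∧
  (3 * scale J < x 2 ∧ x 2 < 4 * scale J)}

lemma mem_sensorBox {J : ℕ} {x : R3} (h : dil (scale J) density x ≠ 0) : x ∈ sensorBox J := by
  have hJ := scale_pos J
  obtain ⟨⟨h1, h2⟩, ⟨h3, h4⟩, h5, h6⟩ := density_ne_zero h
  rw [smul_coord, inv_mul_eq_div] at h1 h2 h3 h4 h5 h6
  rw [lt_div_iff₀ hJ] at h1 h3 h5
  rw [div_lt_iff₀ hJ] at h2 h4 h6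
  exact ⟨⟨h1, h2⟩, abs_lt.2 ⟨by linarith, by linarith⟩, h5, h6⟩

/-- A mode lies between the bounds of the potential over the box of its sensor, as the density has
mass `r_J³ mass`. -/
lemma mode_mem_Icc {ω : ℝ → R3 → Alt2} {t : ℝ} {J : ℕ} (hw : Continuous (comp (ω t) 0 2))
    (hv : ∀ x ∈ slab J, x 0 ≤ 0 → comp (ω t) 0 2 x = 0) {a b : ℝ}
    (hab : ∀ x ∈ sensorBox J, axialPot (ω t) x ∈ Icc a b) : mode ω J t ∈ Icc a b := by
  have hJ := scale_pos J
  have hm := mass_pos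
  have hd := isTest_density.dil hJ
  have hd0 : ∀ x, 0 ≤ dil (scale J) density x := fun x => density_nonneg _
  have hI : Integrable fun x => dil (scale J) density x * axialPot (ω t) x :=
    (hd.continuous.mul (continuous_axialPot hw)).integrable_of_hasCompactSupport hd.2.mul_right
  have hmass : ∫ x, dil (scale J) density x = scale J ^ 3 * mass := integral_dil hJ density
  have key : ∀ c, c = (scale J)⁻¹ ^ 3 * mass⁻¹ * ∫ x, dil (scale J) density x * c := by
    intro c
    rw [integral_mul_const, hmass]
    field_simp
  have hle : ∀ f g : R3 → ℝ, Integrable f → Integrable g → (∀ x, f x ≤ g x) →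
      (scale J)⁻¹ ^ 3 * mass⁻¹ * ∫ x, f x ≤ (scale J)⁻¹ ^ 3 * mass⁻¹ * ∫ x, g x := by
    intro f g hf hg hfg
    exact mul_le_mul_of_nonneg_left (integral_mono hf hg hfg) (by positivity)
  rw [mode_eq hw hv]
  constructor
  · conv_lhs => rw [key a]
    refine hle _ _ (hd.integrable.mul_const a) hI fun x => ?_
    by_cases h : dil (scale J) density x = 0
    · simp [h]
    · exact mul_le_mul_of_nonneg_left (hab x (mem_sensorBox h)).1 (hd0 x)
  · conv_rhs => rw [key b]
    refine hle _ _ hI (hd.integrable.mul_const b) fun x => ?_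
    by_cases h : dil (scale J) density x = 0
    · simp [h]
    · exact mul_le_mul_of_nonneg_left (hab x (mem_sensorBox h)).2 (hd0 x)

/-! ### Bounds for the planar velocity and for perturbed data -/

lemma dyadicPart_congr {f : R3 → ℝ} {c c' : ℕ → ℝ} {J : ℕ} (h : ∀ k < J, c k = c' k) (x : R3) :
    dyadicPart c f J x = dyadicPart c' f J x :=
  Finset.sum_congr rfl fun k hk => by rw [h k (Finset.mem_range.1 hk)]

/-- Bounded coefficients give a bounded velocity, uniformly in the number of scales, since at most two
scales overlap. -/
lemma exists_vel_bound : ∃ K : ℝ, 0 ≤ K ∧ ∀ (J : ℕ) (c : ℕ → ℝ), (∀ k < J, |c k| ≤ 2) → ∀ x,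
    |velA J c x| ≤ K ∧ |velB J c x| ≤ K := by
  have hs : ∀ i, SuppInBox (pd i stream) := fun i =>
    suppInBox_of_tsupport ((tsupport_pd_subset _ i).trans tsupport_stream_subset)
  obtain ⟨B₀, h0, hB₀⟩ := (isTest_stream.pd 0).exists_bound
  obtain ⟨B₁, h1, hB₁⟩ := (isTest_stream.pd 1).exists_bound
  refine ⟨2 * (2 * B₀) + 2 * (2 * B₁), by positivity, fun J c hc x => ?_⟩
  set c' : ℕ → ℝ := fun k => if k < J then c k else 0 with hc'
  have hcc : ∀ k < J, c k = c' k := fun k hk => by simp [hc', hk]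
  have hc2 : ∀ k, |c' k| ≤ 2 := by
    intro k
    by_cases hk : k < J
    · rw [← hcc k hk]; exact hc k hk
    · simp [hc', hk]
  have hI : ∀ {B : ℝ}, 0 ≤ B → ∀ y : R3,
      (Metric.closedBall (0 : R3) 256).indicator (fun _ => 2 * (2 * B)) y ≤ 2 * (2 * B) := fun hB y =>
    indicator_le_self' (fun _ _ => by positivity) y
  have hA : velA J c x = dyadicPart c' (pd 1 stream) J (pt (x 0) (x 1) 0) := by
    rw [← dyadicPart_congr hcc]
    simp [velA, dyadicPart, dil, prod3, pd_stream_one, chiProf_eq_one, Finset.sum_neg_distrib]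
  have hB : velB J c x = -dyadicPart c' (pd 0 stream) J (pt (x 0) (x 1) 0) := by
    rw [← dyadicPart_congr hcc]
    simp [velB, dyadicPart, dil, prod3, pd_stream_zero, chiProf_eq_one, Finset.sum_neg_distrib]
  have e1 := ((hs 1).dyadicPart_le h1 hB₁ zero_le_two hc2 J (pt (x 0) (x 1) 0)).trans (hI h1 _)
  have e0 := ((hs 0).dyadicPart_le h0 hB₀ zero_le_two hc2 J (pt (x 0) (x 1) 0)).trans (hI h0 _)
  rw [hA, hB, abs_neg]
  constructor <;> linarith

lemma abs_comp_le (w : R3 → Alt2) (i j : Fin 3) (x : R3) : |comp w i j x| ≤ ‖w x‖ := by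
  have := PiLp.norm_apply_le (w x : Ten2) (i, j)
  rwa [Real.norm_eq_abs] at this

lemma abs_pd_comp_le {w : R3 → Alt2} (hw : ContDiff ℝ (⊤ : ℕ∞) w) (q i j : Fin 3) (x : R3) :
    |pd q (comp w i j) x| ≤ ‖iteratedFDeriv ℝ 1 w x‖ := by
  set L : Alt2 →L[ℝ] ℝ := (EuclideanSpace.proj (𝕜 := ℝ) (i, j)).comp Alt2.subtypeL with hL
  have hd := (hw.differentiable (by simp) x).hasFDerivAt
  have h1 : HasFDerivAt (comp w i j) (L.comp (fderiv ℝ w x)) x := L.hasFDerivAt.comp x hd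
  have h2 : pd q (comp w i j) x = comp (fun _ => fderiv ℝ w x (EuclideanSpace.single q 1)) i j x := by
    rw [pd, h1.fderiv]; rfl
  rw [h2, norm_iteratedFDeriv_one]
  refine (abs_comp_le _ i j x).trans ?_
  simpa using (fderiv ℝ w x).le_opNorm (EuclideanSpace.single q 1)

lemma comp_initForm_zero_one : comp initForm.1 0 1 = fun _ => 0 := by
  change comp (gradForm 2 initPot) 0 1 = _
  rw [comp_gradForm]
  funext x
  simp

lemma comp_initForm_zero_two : comp initForm.1 0 2 = pd 0 initPot := by
  change comp (gradForm 2 initPot) 0 2 = _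
  rw [comp_gradForm]
  funext x
  simp

lemma axialPot_initForm (x : R3) : axialPot initForm.1 x = initPot x := by
  have hd := isTest_initPot.differentiable
  have hc : Continuous fun l => x 0 * pd 0 initPot (pt (l * x 0) (x 1) (x 2)) :=
    continuous_const.mul ((isTest_initPot.pd 0).continuous.comp (continuous_ray (by fun_prop) _ _))
  have h := intervalIntegral.integral_eq_sub_of_hasDerivAt (a := 0) (b := 1)
    (fun l _ => hasDerivAt_ray hd (x 0) (x 1) (x 2) l) (hc.intervalIntegrable 0 1)
  rw [axialPot, comp_initForm_zero_two, h, one_mul, zero_mul, pt_eta]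
  have : initPot (pt 0 (x 1) (x 2)) = 0 := by
    by_contra h'
    have := (initPot_ne_zero h').1.1
    rw [pt_zero] at this
    linarith [scale_pos 0]
  rw [this, sub_zero]

lemma comp_sub (w w' : R3 → Alt2) (i j : Fin 3) (x : R3) :
    comp (w - w') i j x = comp w i j x - comp w' i j x := by
  simp [comp]

lemma abs_pd_two_initial_le {ε : ℝ} {ω₁ : CcB2}
    (h : ∀ n ≤ 1, ∀ x, ‖iteratedFDeriv ℝ n (ω₁.1 - initForm.1) x‖ < ε) (x : R3) :
    |pd 2 (comp ω₁.1 0 1) x| ≤ ε := by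
  have h1 : comp ω₁.1 0 1 = comp (ω₁.1 - initForm.1) 0 1 := by
    funext y
    rw [comp_sub, comp_initForm_zero_one, sub_zero]
  rw [h1]
  exact (abs_pd_comp_le (ω₁.2.1.sub initForm.2.1) 2 0 1 x).trans (h 1 le_rfl x).le

lemma abs_axialPot_initial_le {ε : ℝ} {ω₁ : CcB2}
    (h : ∀ n ≤ 1, ∀ x, ‖iteratedFDeriv ℝ n (ω₁.1 - initForm.1) x‖ < ε) (x : R3) :
    |axialPot ω₁.1 x - initPot x| ≤ ε * |x 0| := by
  have hc : ∀ ω : CcB2, Continuous fun l => x 0 * comp ω.1 0 2 (pt (l * x 0) (x 1) (x 2)) := fun ω =>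
    continuous_const.mul ((isTest_comp ω 0 2).continuous.comp (continuous_ray (by fun_prop) _ _))
  rw [← axialPot_initForm, axialPot, axialPot, ← intervalIntegral.integral_sub
    ((hc _).intervalIntegrable 0 1) ((hc _).intervalIntegrable 0 1), ← Real.norm_eq_abs]
  refine (intervalIntegral.norm_integral_le_of_norm_le_const (C := ε * |x 0|) fun l _ => ?_).trans
    (by simp)
  rw [← mul_sub, ← comp_sub, norm_mul, mul_comm, Real.norm_eq_abs, Real.norm_eq_abs]
  refine mul_le_mul_of_nonneg_right ?_ (abs_nonneg _)
  refine (abs_comp_le _ 0 2 _).trans ?_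
  have := (h 0 zero_le_one (pt (l * x 0) (x 1) (x 2))).le
  rwa [norm_iteratedFDeriv_zero] at this

/-! ### Trajectories traced backwards -/

/-- The axial speed of the reversed motion, for the coefficients `m`. -/
def speed (J : ℕ) (m : ℕ → ℝ) (x : ℝ) : ℝ :=
  ∑ k ∈ Finset.range J, m k * gProf ((scale k)⁻¹ * x)

/-- The derivative of the axial speed. -/
def strain (J : ℕ) (m : ℕ → ℝ) (x : ℝ) : ℝ :=
  ∑ k ∈ Finset.range J, m k * ((scale k)⁻¹ * deriv gProf ((scale k)⁻¹ * x))

lemma overlap_gProf {x : ℝ} {k l : ℕ} (hk : gProf ((scale k)⁻¹ * x) ≠ 0)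
    (hl : gProf ((scale l)⁻¹ * x) ≠ 0) : l ≤ k + 1 := by
  by_contra! h
  have h1 := scale_le_div h
  have h2 := scale_succ k
  have h3 := (gProf_ne_zero hk).1
  have h4 := (gProf_ne_zero hl).2
  rw [inv_mul_eq_div, lt_div_iff₀ (scale_pos k)] at h3
  rw [inv_mul_eq_div, div_lt_iff₀ (scale_pos l)] at h4
  linarith [scale_pos k]

lemma sum_gProf_le {J : ℕ} {m : ℕ → ℝ} {C : ℝ} (hC : 0 ≤ C) (hm : ∀ k < J, m k ≤ C) (x : ℝ) :
    ∑ k ∈ Finset.range J, m k * gProf ((scale k)⁻¹ * x) ≤ 2 * C := by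
  refine sum_le_of_overlap (P := fun k => gProf ((scale k)⁻¹ * x) ≠ 0)
    (fun k l => overlap_gProf) _ hC (fun k _ h => right_ne_zero_of_mul h) fun k hk _ => ?_
  have h1 := hm k (Finset.mem_range.1 hk)
  have h2 := gProf_nonneg ((scale k)⁻¹ * x)
  have h3 := gProf_le_one ((scale k)⁻¹ * x)
  nlinarith

section
variable {J : ℕ} {m : ℕ → ℝ} {x : ℝ} {k : ℕ}

lemma speed_le (hm : ∀ k < J, m k ∈ Icc (-0.1 : ℝ) 1.1) : speed J m x ≤ 2.2 := by
  have := sum_gProf_le (C := 1.1) (by norm_num) (fun k hk => (hm k hk).2) x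
  unfold speed; linarith

lemma le_speed (hm : ∀ k < J, m k ∈ Icc (-0.1 : ℝ) 1.1) : -0.2 ≤ speed J m x := by
  have := sum_gProf_le (m := fun k => -m k) (C := 0.1) (by norm_num)
    (fun k hk => by have := (hm k hk).1; linarith) x
  simp only [neg_mul, Finset.sum_neg_distrib] at this
  unfold speed; linarith

lemma scaled_mem (h1 : scale (k + 1) ≤ x) (h2 : x ≤ 8 * scale k) :
    1 / 64 ≤ (scale k)⁻¹ * x ∧ (scale k)⁻¹ * x ≤ 8 := by
  have hk := scale_pos k
  rw [scale_succ] at h1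
  rw [inv_mul_eq_div, le_div_iff₀ hk, div_le_iff₀ hk]
  constructor <;> linarith

lemma scaled_le {i : ℕ} (h2 : x ≤ 8 * scale k) (hi : i < k) : (scale i)⁻¹ * x ≤ 1 / 8 := by
  have := scale_le_div hi
  rw [inv_mul_eq_div, div_le_iff₀ (scale_pos i)]
  linarith

lemma scaled_le' {i : ℕ} (h2 : x ≤ 8 * scale k) (hi : i + 1 < k) : (scale i)⁻¹ * x ≤ 1 / 512 := by
  have := scale_le_div hi
  have := scale_succ i
  rw [inv_mul_eq_div, div_le_iff₀ (scale_pos i)]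
  linarith

lemma le_scaled {i : ℕ} (h1 : scale (k + 1) ≤ x) (hi : k < i) : 1 ≤ (scale i)⁻¹ * x := by
  have := scale_anti (show k + 1 ≤ i from hi)
  rw [inv_mul_eq_div, le_div_iff₀ (scale_pos i)]
  linarith

lemma le_scaled' {i : ℕ} (h1 : scale (k + 1) ≤ x) (hi : k + 1 < i) : 64 ≤ (scale i)⁻¹ * x := by
  have := scale_le_div hi
  rw [inv_mul_eq_div, le_div_iff₀ (scale_pos i)]
  linarith

/-- Where the profile at scale `k` is `1`, one coefficient close to `1` drives the motion. -/
lemma le_speed_of_stage (hm : ∀ k < J, m k ∈ Icc (-0.1 : ℝ) 1.1) (hk : k < J) (hmk : 0.9 ≤ m k)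
    (h1 : scale (k + 1) ≤ x) (h2 : x ≤ 8 * scale k) : 0.7 ≤ speed J m x := by
  have hg := gProf_eq_one (scaled_mem h1 h2).1 (scaled_mem h1 h2).2
  have h := sum_gProf_le (J := J) (m := fun i => if i = k then 0 else -m i) (C := 0.1) (by norm_num)
    (fun i hi => by
      by_cases h : i = k
      · simp [h]; norm_num
      · have := (hm i hi).1
        simp only [h, if_false]; linarith) x
  have hs : speed J m x = m k
      - ∑ i ∈ Finset.range J, (if i = k then 0 else -m i) * gProf ((scale i)⁻¹ * x) := by
    have hsub : ∀ i ∈ Finset.range J, m i * gProf ((scale i)⁻¹ * x)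
        = (if i = k then m k else 0) - (if i = k then 0 else -m i) * gProf ((scale i)⁻¹ * x) := by
      intro i _
      by_cases h : i = k
      · subst h; simp [hg]
      · simp [h]
    rw [speed, Finset.sum_congr rfl hsub, Finset.sum_sub_distrib]
    simp [hk]
  rw [hs]; linarith

/-- A signed count of the profiles met on the way out: it increases along the motion in the
stage `k`, as fast as the strain can act. -/
def stagePot (J k : ℕ) (x : ℝ) : ℝ :=
  ∑ i ∈ Finset.range J, (if i < k then 1 else if k < i then -1 else 0) * gProf ((scale i)⁻¹ * x)

/-- The sum of the absolute slopes of the profiles. -/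
def slopes (J : ℕ) (x : ℝ) : ℝ :=
  ∑ i ∈ Finset.range J, (scale i)⁻¹ * |deriv gProf ((scale i)⁻¹ * x)|

lemma slopes_nonneg : 0 ≤ slopes J x :=
  Finset.sum_nonneg fun i _ => mul_nonneg (inv_pos.2 (scale_pos i)).le (abs_nonneg _)

lemma neg_strain_le (hm : ∀ k < J, m k ∈ Icc (-0.1 : ℝ) 1.1) :
    -strain J m x ≤ 1.1 * slopes J x := by
  rw [strain, slopes, ← Finset.sum_neg_distrib, Finset.mul_sum]
  refine Finset.sum_le_sum fun i hi => ?_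
  obtain ⟨h1, h2⟩ := hm i (Finset.mem_range.1 hi)
  have h3 := (inv_pos.2 (scale_pos i)).le
  have h4 : -(m i * deriv gProf ((scale i)⁻¹ * x)) ≤ 1.1 * |deriv gProf ((scale i)⁻¹ * x)| := by
    refine (neg_le_abs _).trans ?_
    rw [abs_mul]
    exact mul_le_mul_of_nonneg_right (abs_le.2 ⟨by linarith, h2⟩) (abs_nonneg _)
  nlinarith

lemma hasDerivAt_stagePot (h1 : scale (k + 1) ≤ x) (h2 : x ≤ 8 * scale k) :
    HasDerivAt (stagePot J k) (slopes J x) x := by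
  unfold stagePot slopes
  refine HasDerivAt.fun_sum fun i _ => ?_
  have hd : HasDerivAt gProf (deriv gProf ((scale i)⁻¹ * x)) ((scale i)⁻¹ * x) :=
    (contDiff_gProf.differentiable (by simp) _).hasDerivAt
  have h := (hd.comp x ((hasDerivAt_id x).const_mul (scale i)⁻¹)).const_mul
    (if i < k then (1 : ℝ) else if k < i then -1 else 0)
  refine h.congr_deriv ?_
  rcases lt_trichotomy i k with hi | hi | hi
  · rw [abs_of_nonneg (deriv_gProf_nonneg (by linarith [scaled_le h2 hi]))]
    simp [hi]; ring
  · subst hi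
    rw [deriv_gProf_eq_zero (scaled_mem h1 h2).1 (scaled_mem h1 h2).2]
    simp
  · rw [abs_of_nonpos (deriv_gProf_nonpos (by linarith [le_scaled h1 hi]))]
    simp [hi, hi.not_gt]; ring

lemma stagePot_mem (h1 : scale (k + 1) ≤ x) (h2 : x ≤ 8 * scale k) :
    stagePot J k x ∈ Icc (-1 : ℝ) 1 := by
  have hle : ∀ (j : ℕ), ∑ i ∈ Finset.range J, (if i = j then (1 : ℝ) else 0) ≤ 1 := by
    intro j
    rw [Finset.sum_ite_eq']
    split_ifs <;> norm_num
  have hg0 := fun y => gProf_nonneg y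
  have hg1 := fun y => gProf_le_one y
  unfold stagePot
  constructor
  · have : ∀ i ∈ Finset.range J, -(if i = k + 1 then (1 : ℝ) else 0)
        ≤ (if i < k then 1 else if k < i then -1 else 0) * gProf ((scale i)⁻¹ * x) := by
      intro i _
      rcases lt_trichotomy i k with hi | hi | hi
      · simp only [hi, if_true, one_mul]
        split_ifs <;> linarith [hg0 ((scale i)⁻¹ * x)]
      · simp [hi]
      · rcases (Nat.succ_le_of_lt hi).eq_or_lt with h | h
        · have : i = k + 1 := h.symm
          rw [if_neg hi.not_gt, if_pos hi, if_pos this]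
          linarith [hg1 ((scale i)⁻¹ * x)]
        · rw [gProf_eq_zero_right (by linarith [le_scaled' h1 h])]
          have : i ≠ k + 1 := by omega
          simp [this]
    have := Finset.sum_le_sum this
    rw [Finset.sum_neg_distrib] at this
    linarith [hle (k + 1)]
  · rcases k with _ | k
    · refine (Finset.sum_nonpos fun i _ => ?_).trans zero_le_one
      rcases Nat.eq_zero_or_pos i with hi | hi
      · simp [hi]
      · simp [hi, hg0]
    · refine (Finset.sum_le_sum fun i _ => ?_).trans (hle k)
      rcases lt_trichotomy i (k + 1) with hi | hi | hi
      · rcases (Nat.lt_succ_iff.1 hi).eq_or_lt with h | h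
        · simp [h, hg1]
        · rw [gProf_eq_zero_left (by linarith [scaled_le' h2 (Nat.succ_lt_succ h)]), mul_zero]
          split_ifs <;> norm_num
      · simp [hi]
      · simp only [hi, hi.not_gt, if_true, if_false]
        have : i ≠ k := by omega
        simp [this, hg0]

end

/-- A solution of the linearised reversed equations `Z' = U(Z)`, `V' = -U'(Z) V`, where `U` is the
axial speed with the coefficients `M`. -/
structure BackFlow (J : ℕ) (M : ℕ → ℝ → ℝ) (t : ℝ) (Z V : ℝ → ℝ) : Prop where
  derivZ : ∀ τ ∈ Icc 0 t, HasDerivWithinAt Z (speed J (fun k => M k τ) (Z τ)) (Icc 0 t) τ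
  contV : ContinuousOn V (Icc 0 t)
  derivV : ∀ τ ∈ Ioo 0 t, HasDerivAt V (-(strain J (fun k => M k τ) (Z τ) * V τ)) τ

lemma exists_backFlow (J : ℕ) {M : ℕ → ℝ → ℝ} {t : ℝ} (ht : 0 ≤ t)
    (hM : ∀ k, ContinuousOn (M k) (Icc 0 t)) (x y : ℝ) :
    ∃ Z V, BackFlow J M t Z V ∧ Z 0 = x ∧ V 0 = y := by
  have hsm : ∀ k, ContDiff ℝ (⊤ : ℕ∞) fun x => gProf ((scale k)⁻¹ * x) := fun k =>
    contDiff_gProf.comp (by fun_prop)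
  obtain ⟨Z, hZ0, hZ⟩ := exists_ode_solution J (Φ := fun k x => gProf ((scale k)⁻¹ * x))
    (fun k => (hsm k).of_le (by norm_cast))
    (fun k => hasCompactSupport_gProf.comp_homeomorph
      (Homeomorph.mulLeft₀ (scale k)⁻¹ (inv_pos.2 (scale_pos k)).ne')) hM (left_mem_Icc.2 ht) x
  have hZc : ContinuousOn Z (Icc 0 t) := fun τ hτ => (hZ τ hτ).continuousWithinAt
  set h : ℝ → ℝ := fun τ => strain J (fun k => M k τ) (Z τ) with hh
  have hc : ContinuousOn h (Icc 0 t) := by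
    simp only [hh, strain]
    refine continuousOn_finsetSum _ fun k _ => (hM k).mul (continuousOn_const.mul ?_)
    exact contDiff_deriv_gProf.continuous.comp_continuousOn (continuousOn_const.mul hZc)
  set H : ℝ → ℝ := IccExtend ht ((Icc 0 t).domRestrict h) with hH
  have hHc : Continuous H := hc.domRestrict.Icc_extend'
  have hHe : ∀ τ ∈ Icc 0 t, H τ = h τ := fun τ hτ => by
    rw [hH, IccExtend_of_mem _ _ hτ]; rfl
  have hP : ∀ τ, HasDerivAt (fun τ => y * Real.exp (-∫ σ in (0 : ℝ)..τ, H σ))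
      (y * (Real.exp (-∫ σ in (0 : ℝ)..τ, H σ) * (-H τ))) τ := fun τ =>
    ((intervalIntegral.integral_hasDerivAt_right (hHc.intervalIntegrable 0 τ)
      (hHc.stronglyMeasurableAtFilter _ _) hHc.continuousAt).neg.exp).const_mul y
  refine ⟨Z, fun τ => y * Real.exp (-∫ σ in (0 : ℝ)..τ, H σ), ⟨?_, ?_, ?_⟩, hZ0, by simp⟩
  · exact fun τ hτ => hZ τ hτ
  · exact fun τ _ => (hP τ).continuousAt.continuousWithinAt
  · intro τ hτ
    refine (hP τ).congr_deriv ?_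
    rw [hHe τ (Ioo_subset_Icc_self hτ)]
    ring

namespace BackFlow

variable {J : ℕ} {M : ℕ → ℝ → ℝ} {t : ℝ} {Z V : ℝ → ℝ}

lemma contZ (h : BackFlow J M t Z V) : ContinuousOn Z (Icc 0 t) := fun τ hτ =>
  (h.derivZ τ hτ).continuousWithinAt

lemma hasDerivAtZ (h : BackFlow J M t Z V) {τ : ℝ} (hτ : τ ∈ Ioo 0 t) :
    HasDerivAt Z (speed J (fun k => M k τ) (Z τ)) τ :=
  (h.derivZ τ (Ioo_subset_Icc_self hτ)).hasDerivAt (Icc_mem_nhds hτ.1 hτ.2)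

lemma sub_mem (h : BackFlow J M t Z V) (hM : ∀ k < J, ∀ τ ∈ Icc 0 t, M k τ ∈ Icc (-0.1 : ℝ) 1.1)
    {a b : ℝ} (ha : 0 ≤ a) (hab : a ≤ b) (hb : b ≤ t) :
    Z b - Z a ∈ Icc (-0.2 * (b - a)) (2.2 * (b - a)) := by
  rcases hab.eq_or_lt with rfl | hlt
  · simp
  obtain ⟨τ, hτ, hs⟩ := exists_hasDerivAt_eq_slope Z (fun τ => speed J (fun k => M k τ) (Z τ)) hlt
    (h.contZ.mono (Icc_subset_Icc ha hb))
    (fun τ hτ => h.hasDerivAtZ ⟨ha.trans_lt hτ.1, hτ.2.trans_le hb⟩)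
  have hτ' : τ ∈ Icc 0 t := ⟨ha.trans hτ.1.le, hτ.2.le.trans hb⟩
  have h1 := speed_le (x := Z τ) fun k hk => hM k hk τ hτ'
  have h2 := le_speed (x := Z τ) fun k hk => hM k hk τ hτ'
  have hp : 0 < b - a := by linarith
  rw [eq_div_iff hp.ne'] at hs
  rw [← hs]
  constructor <;> nlinarith

/-- One stage of the reversed motion, from the scale `k + 1` to the scale `k`, driven by the mode
`k`. The factor `exp 8` is less than `64 ^ 2`. -/
lemma stage (h : BackFlow J M t Z V) (hM : ∀ k < J, ∀ τ ∈ Icc 0 t, M k τ ∈ Icc (-0.1 : ℝ) 1.1)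
    {k : ℕ} (hk : k < J) {a b : ℝ} (ha : 0 ≤ a) (hb : b ≤ t) (hab : b - a = 2 * scale k)
    (hMk : ∀ τ ∈ Icc a b, 0.9 ≤ M k τ) (h1 : scale (k + 1) ≤ Z a) (h2 : Z a ≤ 8 * scale (k + 1)) :
    (∀ τ ∈ Icc a b, (scale (k + 1) ≤ Z τ ∧ Z τ ≤ 8 * scale k) ∧ V τ ^ 2 ≤ Real.exp 8 * V a ^ 2) ∧
      scale k ≤ Z b := by
  have hkp := scale_pos k
  have hsc := scale_succ k
  have hlt : a < b := by linarith
  have hsub : Icc a b ⊆ Icc 0 t := Icc_subset_Icc ha hb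
  have hup : ∀ τ ∈ Icc a b, Z τ ≤ 8 * scale k := by
    intro τ hτ
    have := (h.sub_mem hM ha hτ.1 (hτ.2.trans hb)).2
    linarith [hτ.2]
  -- The barrier `r_{k+1} + 0.65 (τ - a)` stays in the region where the speed is at least `0.7`.
  have hlow : ∀ τ ∈ Icc a b, scale (k + 1) + 0.65 * (τ - a) ≤ Z τ := by
    intro τ hτ
    have := image_le_of_deriv_right_lt_deriv_boundary' (f := fun τ => scale (k + 1) + 0.65 * (τ - a))
      (f' := fun _ => 0.65) (B := Z) (B' := fun τ => speed J (fun k => M k τ) (Z τ)) (a := a) (b := b)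
      (by fun_prop)
      (fun τ _ => by
        simpa using ((((hasDerivAt_id τ).sub_const a).const_mul (0.65 : ℝ)).const_add
          (scale (k + 1))).hasDerivWithinAt)
      (by simpa using h1) (h.contZ.mono hsub)
      (fun τ hτ => (h.derivZ τ (hsub (Ico_subset_Icc_self hτ))).mono_of_mem_nhdsWithin
        (mem_of_superset (Icc_mem_nhdsGE (hτ.2.trans_le hb)) (Icc_subset_Icc_left (ha.trans hτ.1))))
      (fun τ hτ he => ?_)
    · exact this hτ
    · have hτ' := Ico_subset_Icc_self hτ
      have : (0.7 : ℝ) ≤ speed J (fun k => M k τ) (Z τ) :=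
        le_speed_of_stage (fun k hk => hM k hk τ (hsub hτ')) hk (hMk τ hτ')
          (by rw [← he]; linarith [hτ.1]) (hup τ hτ')
      linarith
  have hlow' : ∀ τ ∈ Icc a b, scale (k + 1) ≤ Z τ := fun τ hτ => by linarith [hlow τ hτ, hτ.1]
  have hanti : AntitoneOn (fun τ => V τ ^ 2 * Real.exp (-4 * stagePot J k (Z τ))) (Icc a b) := by
    have hd : ∀ τ ∈ interior (Icc a b),
        HasDerivAt (fun τ => V τ ^ 2 * Real.exp (-4 * stagePot J k (Z τ)))
          (2 * V τ * (-(strain J (fun k => M k τ) (Z τ) * V τ)) * Real.exp (-4 * stagePot J k (Z τ))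
            + V τ ^ 2 * (Real.exp (-4 * stagePot J k (Z τ))
              * (-4 * (slopes J (Z τ) * speed J (fun k => M k τ) (Z τ))))) τ := by
      intro τ hτ
      rw [interior_Icc] at hτ
      have hτ' : τ ∈ Ioo 0 t := ⟨ha.trans_lt hτ.1, hτ.2.trans_le hb⟩
      have hi := Ioo_subset_Icc_self hτ
      have hW := (hasDerivAt_stagePot (J := J) (hlow' τ hi) (hup τ hi)).comp τ (h.hasDerivAtZ hτ')
      have := ((h.derivV τ hτ').fun_pow 2).fun_mul ((hW.const_mul (-4)).exp)
      refine this.congr_deriv ?_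
      simp
    refine antitoneOn_of_deriv_nonpos (convex_Icc a b) ?_
      (fun τ hτ => (hd τ hτ).differentiableAt.differentiableWithinAt) fun τ hτ => ?_
    · refine ((h.contV.mono hsub).pow 2).mul (Real.continuous_exp.comp_continuousOn
        (continuousOn_const.mul ?_))
      have : Continuous (stagePot J k) := by
        unfold stagePot
        exact continuous_finsetSum _ fun i _ => continuous_const.mul
          (contDiff_gProf.continuous.comp (by fun_prop))
      exact this.comp_continuousOn (h.contZ.mono hsub)
    · rw [(hd τ hτ).deriv]
      rw [interior_Icc] at hτ
      have hi := Ioo_subset_Icc_self hτ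
      have e1 := neg_strain_le (x := Z τ) fun k hk => hM k hk τ (hsub hi)
      have e2 := le_speed_of_stage (fun k hk => hM k hk τ (hsub hi)) hk (hMk τ hi) (hlow' τ hi) (hup τ hi)
      have e3 := slopes_nonneg (J := J) (x := Z τ)
      have e4 : 0 ≤ V τ ^ 2 * Real.exp (-4 * stagePot J k (Z τ)) := by positivity
      -- `2 · 1.1 ≤ 4 · 0.7`: the growth of the potential dominates the strain.
      have e5 : -2 * strain J (fun k => M k τ) (Z τ)
          - 4 * (slopes J (Z τ) * speed J (fun k => M k τ) (Z τ)) ≤ 0 := by nlinarith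
      have e6 := mul_nonpos_of_nonneg_of_nonpos e4 e5
      refine le_of_eq_of_le ?_ e6
      ring
  refine ⟨fun τ hτ => ⟨⟨hlow' τ hτ, hup τ hτ⟩, ?_⟩, ?_⟩
  · have hla := left_mem_Icc.2 hlt.le
    have e1 := hanti hla hτ hτ.1
    have e2 := stagePot_mem (J := J) (hlow' τ hτ) (hup τ hτ)
    have e3 := stagePot_mem (J := J) (hlow' a hla) (hup a hla)
    simp only at e1
    have e4 : V τ ^ 2 * Real.exp (-4) ≤ V a ^ 2 * Real.exp 4 := by
      refine (mul_le_mul_of_nonneg_left (Real.exp_le_exp.2 ?_) (sq_nonneg _)).trans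
        (e1.trans (mul_le_mul_of_nonneg_left (Real.exp_le_exp.2 ?_) (sq_nonneg _)))
      · linarith [e2.2]
      · linarith [e3.1]
    have e5 : Real.exp 8 = Real.exp 4 * Real.exp 4 := by rw [← Real.exp_add]; norm_num
    have e6 : Real.exp (-4) * Real.exp 4 = 1 := by rw [← Real.exp_add]; norm_num
    have e7 := Real.exp_pos 4
    calc V τ ^ 2 = V τ ^ 2 * Real.exp (-4) * Real.exp 4 := by rw [mul_assoc, e6, mul_one]
      _ ≤ V a ^ 2 * Real.exp 4 * Real.exp 4 := mul_le_mul_of_nonneg_right e4 e7.le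
      _ = Real.exp 8 * V a ^ 2 := by rw [e5]; ring
  · have := hlow b (right_mem_Icc.2 hlt.le)
    rw [hab] at this
    linarith [scale_pos (k + 1)]

end BackFlow

/-- The time at which the activation of the mode `k` begins. -/
def stageTime (k : ℕ) : ℝ := 2 * ∑ i ∈ Finset.range k, scale i

lemma stageTime_succ (k : ℕ) : stageTime (k + 1) = stageTime k + 2 * scale k := by
  unfold stageTime
  rw [Finset.sum_range_succ]; ring

lemma stageTime_zero : stageTime 0 = 0 := by simp [stageTime]

lemma stageTime_nonneg (k : ℕ) : 0 ≤ stageTime k :=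
  mul_nonneg zero_le_two (Finset.sum_nonneg fun i _ => (scale_pos i).le)

lemma stageTime_le (k : ℕ) : stageTime k ≤ 1 := by
  have h : stageTime k ≤ 1 / 16 - 4 * scale k := by
    induction k with
    | zero => rw [stageTime_zero]; norm_num [scale]
    | succ k ih =>
      rw [stageTime_succ, scale_succ]
      linarith [scale_pos k]
  linarith [scale_pos k]

lemma exp_eight_lt : Real.exp 8 < 64 ^ 2 := by
  have h := Real.exp_one_lt_d9
  have e : Real.exp 8 = Real.exp 1 ^ 8 := by rw [← Real.exp_nat_mul]; norm_num
  rw [e]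
  calc Real.exp 1 ^ 8 ≤ (2.75 : ℝ) ^ 8 := by gcongr; linarith
    _ < 64 ^ 2 := by norm_num

namespace BackFlow

variable {J : ℕ} {M : ℕ → ℝ → ℝ} {t : ℝ} {Z V : ℝ → ℝ}

/-- Before the activation of the mode `J`, the points of the sensor at the scale `J` stay where
the strain vanishes. -/
lemma initial_stage (h : BackFlow J M t Z V)
    (hM : ∀ k < J, ∀ τ ∈ Icc 0 t, M k τ ∈ Icc (-0.1 : ℝ) 1.1) {b : ℝ} (hb : b ≤ t)
    (hbJ : b ≤ 2 * scale J) (h1 : 2 * scale J ≤ Z 0) (h2 : Z 0 ≤ 3 * scale J) :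
    ∀ τ ∈ Icc 0 b, (scale J ≤ Z τ ∧ Z τ ≤ 8 * scale J) ∧ V τ = V 0 := by
  have hJ := scale_pos J
  have hZ : ∀ τ ∈ Icc 0 b, scale J ≤ Z τ ∧ Z τ ≤ 8 * scale J := by
    intro τ hτ
    have := h.sub_mem hM le_rfl hτ.1 (hτ.2.trans hb)
    rw [sub_zero] at this
    constructor <;> linarith [this.1, this.2, hτ.1, hτ.2]
  refine fun τ hτ => ⟨hZ τ hτ, ?_⟩
  refine eq_of_hasDerivAt_zero hτ.1 (h.contV.mono (Icc_subset_Icc_right (hτ.2.trans hb)))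
    fun σ hσ => ?_
  have hσb : σ ∈ Icc 0 b := ⟨hσ.1.le, hσ.2.le.trans hτ.2⟩
  refine (h.derivV σ ⟨hσ.1, hσ.2.trans_le (hτ.2.trans hb)⟩).congr_deriv ?_
  have hz : strain J (fun k => M k σ) (Z σ) = 0 := by
    obtain ⟨hZ1, hZ2⟩ := hZ σ hσb
    refine Finset.sum_eq_zero fun i hi => ?_
    have : deriv gProf ((scale i)⁻¹ * Z σ) = 0 := by
      rcases (Nat.succ_le_of_lt (Finset.mem_range.1 hi)).eq_or_lt with hiJ | hiJ
      · have hiJ : i + 1 = J := hiJ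
        have := scaled_mem (k := i) (x := Z σ) (by rwa [hiJ])
          (hZ2.trans (by linarith [scale_anti (show i ≤ J by omega)]))
        exact deriv_gProf_eq_zero this.1 this.2
      · by_contra h'
        have h3 := (deriv_gProf_ne_zero h').1
        have h4 := scaled_le' hZ2 hiJ
        norm_num at h3 h4
        linarith
    rw [this]; ring
  rw [hz]; ring

/-- The reversed motion of a point of the sensor at the scale `J` runs outwards through the scales.
It stays where the transverse profiles of the active scales are linear. -/
lemma trace (h : BackFlow J M t Z V) (hM : ∀ k < J, ∀ τ ∈ Icc 0 t, M k τ ∈ Icc (-0.1 : ℝ) 1.1)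
    (ht : t ∈ Icc (stageTime J) (stageTime (J + 1)))
    (hM9 : ∀ k < J, ∀ τ ∈ Icc (t - stageTime (k + 1)) (t - stageTime k), 0.9 ≤ M k τ)
    (h1 : 2 * scale J ≤ Z 0) (h2 : Z 0 ≤ 3 * scale J) (hV : |V 0| ≤ scale J) :
    ((scale 0 ≤ Z t ∧ Z t ≤ 8 * scale 0) ∧ |V t| ≤ scale 0) ∧
      ∀ τ ∈ Icc 0 t, ∀ i < J, (scale i)⁻¹ * Z τ ≤ 16 → |V τ| < 64 * scale i := by
  have key : ∀ d ≤ J, ((scale (J - d) ≤ Z (t - stageTime (J - d)) ∧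
      Z (t - stageTime (J - d)) ≤ 8 * scale (J - d)) ∧ |V (t - stageTime (J - d))| ≤ scale (J - d)) ∧
      ∀ τ ∈ Icc 0 (t - stageTime (J - d)), ∀ i < J, (scale i)⁻¹ * Z τ ≤ 16 → |V τ| < 64 * scale i := by
    intro d
    induction d with
    | zero =>
      intro _
      have hst := h.initial_stage hM (b := t - stageTime J) (by linarith [stageTime_nonneg J])
        (by have := ht.2; rw [stageTime_succ] at this; linarith) h1 h2
      have hlast := hst (t - stageTime J) ⟨by linarith [ht.1], le_rfl⟩
      rw [Nat.sub_zero]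
      refine ⟨⟨hlast.1, by rw [hlast.2]; exact hV⟩, fun τ hτ i hi _ => ?_⟩
      rw [(hst τ hτ).2]
      linarith [scale_anti hi.le, scale_pos i]
    | succ d ih =>
      intro hd
      obtain ⟨⟨⟨i1, i2⟩, i3⟩, i4⟩ := ih (by omega)
      obtain ⟨k, hk⟩ : ∃ k, J = d + 1 + k := ⟨J - (d + 1), by omega⟩
      have e1 : J - d = k + 1 := by omega
      have e2 : J - (d + 1) = k := by omega
      rw [e1] at i1 i2 i3 i4
      rw [e2]
      have hkJ : k < J := by omega
      have hmono : stageTime (k + 1) ≤ stageTime J :=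
        mul_le_mul_of_nonneg_left (Finset.sum_le_sum_of_subset_of_nonneg
          (Finset.range_subset_range.2 hkJ) fun i _ _ => (scale_pos i).le) zero_le_two
      have hsucc := stageTime_succ k
      have hkp := scale_pos k
      have hksc := scale_succ k
      obtain ⟨hst, hend⟩ := h.stage hM hkJ (a := t - stageTime (k + 1)) (b := t - stageTime k)
        (by linarith [ht.1]) (by linarith [stageTime_nonneg k]) (by linarith) (hM9 k hkJ) i1 i2
      have hVlt : ∀ τ ∈ Icc (t - stageTime (k + 1)) (t - stageTime k), |V τ| < 64 * scale (k + 1) := by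
        intro τ hτ
        refine abs_lt_of_sq_lt_sq ?_ (by linarith)
        have e3 := (hst τ hτ).2
        have e4 : V (t - stageTime (k + 1)) ^ 2 ≤ scale (k + 1) ^ 2 :=
          sq_le_sq' (by linarith [neg_abs_le (V (t - stageTime (k + 1)))]) ((le_abs_self _).trans i3)
        have e5 : 0 < scale (k + 1) ^ 2 := by have := scale_pos (k + 1); positivity
        have e6 := exp_eight_lt
        calc V τ ^ 2 ≤ Real.exp 8 * scale (k + 1) ^ 2 :=
              e3.trans (mul_le_mul_of_nonneg_left e4 (Real.exp_pos _).le)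
          _ < 64 ^ 2 * scale (k + 1) ^ 2 := mul_lt_mul_of_pos_right e6 e5
          _ = (64 * scale (k + 1)) ^ 2 := by ring
      have hright : t - stageTime k ∈ Icc (t - stageTime (k + 1)) (t - stageTime k) :=
        ⟨by linarith, le_rfl⟩
      refine ⟨⟨⟨hend, (hst _ hright).1.2⟩, by linarith [hVlt _ hright]⟩, fun τ hτ i hi hact => ?_⟩
      rcases le_total τ (t - stageTime (k + 1)) with hle | hle
      · exact i4 τ ⟨hτ.1, hle⟩ i hi hact
      · have hτ' : τ ∈ Icc (t - stageTime (k + 1)) (t - stageTime k) := ⟨hle, hτ.2⟩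
        have hik : i ≤ k + 1 := by
          by_contra! h'
          linarith [le_scaled' (hst τ hτ').1.1 h']
        linarith [hVlt τ hτ', scale_anti hik]
  have := key J le_rfl
  rw [Nat.sub_self, stageTime_zero, sub_zero] at this
  exact this

/-- Where the transverse profiles are linear, the reversed motion follows a trajectory. -/
lemma isTraj {c : ℕ → ℝ → ℝ} (h : BackFlow J (fun k τ => c k (t - τ)) t Z V)
    (hlin : ∀ τ ∈ Icc 0 t, ∀ i < J, (scale i)⁻¹ * Z τ ≤ 16 → |V τ| < 64 * scale i) :
    IsTraj J c t (fun s => Z (t - s)) (fun s => V (t - s)) := by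
  have hmaps : MapsTo (fun s => t - s) (Icc 0 t) (Icc 0 t) := fun s hs =>
    ⟨by linarith [hs.2], by linarith [hs.1]⟩
  have hsub : ∀ s, HasDerivAt (fun s => t - s) (-1) s := fun s => (hasDerivAt_id s).const_sub t
  refine ⟨h.contZ.comp (by fun_prop) hmaps, h.contV.comp (by fun_prop) hmaps, fun s hs => ?_,
    fun s hs => ?_⟩
  all_goals
    have hτ : t - s ∈ Ioo 0 t := ⟨by linarith [hs.2], by linarith [hs.1]⟩
    have hact := hlin (t - s) (Ioo_subset_Icc_self hτ)
    have hsc : ∀ i, |V (t - s)| < 64 * scale i → |(scale i)⁻¹ * V (t - s)| < 64 := by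
      intro i hi
      rw [abs_mul, abs_of_pos (inv_pos.2 (scale_pos i)), inv_mul_eq_div, div_lt_iff₀ (scale_pos i)]
      exact hi
  · refine ((h.hasDerivAtZ hτ).comp s (hsub s)).congr_deriv ?_
    simp only [sub_sub_cancel, velA, dyadicPart, speed, dil_apply, prod3, smul_coord, pt_zero, pt_one,
      mul_one, mul_neg]
    congr 1
    refine Finset.sum_congr rfl fun i hi => ?_
    by_cases hg : gProf ((scale i)⁻¹ * Z (t - s)) = 0
    · rw [hg]; ring
    · rw [deriv_qProf_eq (hsc i (hact i (Finset.mem_range.1 hi) (gProf_ne_zero hg).2.le))]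
      ring
  · refine ((h.derivV _ hτ).comp s (hsub s)).congr_deriv ?_
    simp only [sub_sub_cancel, velB, dyadicPart, strain, dil_apply, prod3, smul_coord, pt_zero, pt_one,
      mul_one, mul_neg, neg_neg]
    rw [Finset.sum_mul]
    refine Finset.sum_congr rfl fun i hi => ?_
    by_cases hg : deriv gProf ((scale i)⁻¹ * Z (t - s)) = 0
    · rw [hg]; ring
    · rw [qProf_eq (hsc i (hact i (Finset.mem_range.1 hi) (deriv_gProf_ne_zero hg).2)).le]
      ring

end BackFlow

/-! ### The cascade -/

lemma IsTraj.abs_le {J : ℕ} {c : ℕ → ℝ → ℝ} {t : ℝ} {X Y : ℝ → ℝ} (h : IsTraj J c t X Y)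
    (ht : t ≤ 1) {K : ℝ} (hK0 : 0 ≤ K) (hK : ∀ s ∈ Icc 0 t, ∀ x, |velA J (fun k => c k s) x| ≤ K)
    (hX : |X t| ≤ 1) : ∀ s ∈ Icc 0 t, |X s| ≤ 1 + K := by
  intro s hs
  rcases hs.2.eq_or_lt with rfl | hlt
  · linarith
  obtain ⟨σ, hσ, he⟩ := exists_hasDerivAt_eq_slope X (fun σ => velA J (fun k => c k σ) (pt (X σ) (Y σ) 0))
    hlt (h.contX.mono (Icc_subset_Icc_left hs.1))
    (fun σ hσ => h.derivX σ ⟨hs.1.trans_lt hσ.1, hσ.2⟩)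
  have h1 := hK σ ⟨hs.1.trans hσ.1.le, hσ.2.le⟩ (pt (X σ) (Y σ) 0)
  have hp : 0 < t - s := by linarith
  rw [he, abs_div, abs_of_pos hp, div_le_iff₀ hp] at h1
  have h2 : |X s| ≤ |X t| + |X t - X s| := by
    have := abs_sub (X t) (X t - X s)
    rwa [sub_sub_cancel] at this
  nlinarith [hs.1]

/-- For data close to `initForm`, the potential is close to `1` at points that come from the
region where the initial potential is `1`, and between `0` and `1` up to a small error at all
others. -/
lemma axialPot_mem {ω : ℝ → R3 → Alt2} {J : ℕ} {ω₁ : CcB2} (hω : ω 0 = ω₁.1) (hS : SlabFlow J ω)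
    (hreg : RegularFamily ω) {ε K : ℝ} (hK0 : 0 ≤ K)
    (hK : ∀ (J : ℕ) (c : ℕ → ℝ), (∀ k < J, |c k| ≤ 2) → ∀ x, |velA J c x| ≤ K ∧ |velB J c x| ≤ K)
    (hε : (1 + K) * (2 * K + 1) * ε ≤ 0.1)
    (hclose : ∀ n ≤ 1, ∀ x, ‖iteratedFDeriv ℝ n (ω₁.1 - initForm.1) x‖ < ε)
    (hm : ∀ k < J, ∀ t ∈ Icc (0 : ℝ) 1, mode ω k t ∈ Icc (-0.1 : ℝ) 1.1) {t : ℝ}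
    (ht : t ∈ Icc (0 : ℝ) 1) {X Y : ℝ → ℝ} (hT : IsTraj J (mode ω) t X Y) {z : ℝ}
    (hz : z ∈ Ioo (2 * scale J) (5 * scale J)) (hX : |X t| ≤ 1) :
    |axialPot (ω t) (pt (X t) (Y t) z) - initPot (pt (X 0) (Y 0) z)| ≤ 0.1 := by
  have hv : ∀ s ∈ Icc 0 t, ∀ x, |velA J (fun k => mode ω k s) x| ≤ K ∧
      |velB J (fun k => mode ω k s) x| ≤ K := fun s hs x => hK J _ (fun k hk => by
    have := hm k hk s ⟨hs.1, hs.2.trans ht.2⟩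
    exact abs_le.2 ⟨by linarith [this.1], by linarith [this.2]⟩) x
  have hR := hT.abs_le ht.2 hK0 (fun s hs x => (hv s hs x).1) hX
  have h1 := hS.abs_axialPot_sub_le hreg ht.1 ht.2 hT hz (fun s hs x => (hv s hs x).2) hR
    (ε := ε) (by rw [hω]; exact abs_pd_two_initial_le hclose)
  have h2 := abs_axialPot_initial_le hclose (pt (X 0) (Y 0) z)
  rw [hω] at h1
  have hε0 : 0 ≤ ε := (abs_nonneg _).trans (abs_pd_two_initial_le hclose 0)
  have h3 : ε * |X 0| ≤ ε * (1 + K) := mul_le_mul_of_nonneg_left (hR 0 ⟨le_rfl, ht.1⟩) hε0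
  rw [pt_zero] at h2
  have h4 := abs_sub_le (axialPot (ω t) (pt (X t) (Y t) z)) (axialPot ω₁.1 (pt (X 0) (Y 0) z))
    (initPot (pt (X 0) (Y 0) z))
  nlinarith

/-- The modes are activated one after the other, within a bounded time. -/
lemma cascade {ω : ℝ → R3 → Alt2} {ω₁ : CcB2} (hω : ω 0 = ω₁.1) (hS : ∀ J, SlabFlow J ω)
    (hreg : RegularFamily ω) {ε K : ℝ} (hK0 : 0 ≤ K)
    (hK : ∀ (J : ℕ) (c : ℕ → ℝ), (∀ k < J, |c k| ≤ 2) → ∀ x, |velA J c x| ≤ K ∧ |velB J c x| ≤ K)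
    (hε : (1 + K) * (2 * K + 1) * ε ≤ 0.1)
    (hclose : ∀ n ≤ 1, ∀ x, ‖iteratedFDeriv ℝ n (ω₁.1 - initForm.1) x‖ < ε) (J : ℕ) :
    (∀ t ∈ Icc (0 : ℝ) 1, mode ω J t ∈ Icc (-0.1 : ℝ) 1.1) ∧
      ∀ t ∈ Icc (stageTime J) (stageTime (J + 1)), 0.9 ≤ mode ω J t := by
  induction J using Nat.strong_induction_on with
  | _ J ih =>
    have hJ := scale_pos J
    have hJ1 : scale J ≤ 1 / 64 := (scale_anti (Nat.zero_le J)).trans (by norm_num [scale])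
    have hm : ∀ k < J, ∀ t ∈ Icc (0 : ℝ) 1, mode ω k t ∈ Icc (-0.1 : ℝ) 1.1 := fun k hk => (ih k hk).1
    have hw : ∀ t ∈ Icc (0 : ℝ) 1, Continuous (comp (ω t) 0 2) := fun t ht =>
      (hreg.diff t ht 0 2).continuous
    have hbox : ∀ x ∈ sensorBox J, x 2 ∈ Ioo (2 * scale J) (5 * scale J) ∧ |x 0| ≤ 1 := by
      rintro x ⟨⟨h1, h2⟩, -, h3, h4⟩
      exact ⟨⟨by linarith, by linarith⟩, abs_le.2 ⟨by linarith, by linarith⟩⟩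
    have hcont : ∀ t ∈ Icc (0 : ℝ) 1, ∀ k, ContinuousOn (mode ω k) (Icc 0 t) := fun t ht k =>
      (hreg.continuousOn_mode k).mono (Icc_subset_Icc_right ht.2)
    constructor
    · intro t ht
      refine mode_mem_Icc (hw t ht) (fun x hx h0 => (hS J).vanish t ht x hx h0 0 2) fun x hx => ?_
      obtain ⟨hz, hx0⟩ := hbox x hx
      obtain ⟨X, Y, hT, hX, hY⟩ := exists_isTraj J ht.1 (hcont t ht) (x 0) (x 1)
      have h := axialPot_mem hω (hS J) hreg hK0 hK hε hclose hm ht hT hz (by rwa [hX])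
      rw [hX, hY, pt_eta, abs_le] at h
      have h0 := initPot_nonneg (pt (X 0) (Y 0) (x 2))
      have h1 := initPot_le_one (pt (X 0) (Y 0) (x 2))
      constructor <;> linarith [h.1, h.2]
    · intro t htJ
      have ht : t ∈ Icc (0 : ℝ) 1 :=
        ⟨(stageTime_nonneg J).trans htJ.1, htJ.2.trans (stageTime_le _)⟩
      refine (mode_mem_Icc (b := 1.1) (hw t ht) (fun x hx h0 => (hS J).vanish t ht x hx h0 0 2)
        fun x hx => ?_).1
      obtain ⟨hz, hx0⟩ := hbox x hx
      have hmaps : MapsTo (fun τ => t - τ) (Icc 0 t) (Icc 0 t) := fun s hs =>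
        ⟨by linarith [hs.2], by linarith [hs.1]⟩
      obtain ⟨Z, V, hB, hZ, hV⟩ := exists_backFlow J (M := fun k τ => mode ω k (t - τ)) ht.1
        (fun k => (hcont t ht k).comp (by fun_prop) hmaps) (x 0) (x 1)
      obtain ⟨⟨⟨z1, z2⟩, z3⟩, hlin⟩ := hB.trace
        (fun k hk τ hτ => hm k hk _ ⟨(hmaps hτ).1, (hmaps hτ).2.trans ht.2⟩) htJ
        (fun k hk τ hτ => (ih k hk).2 _ ⟨by linarith [hτ.2], by linarith [hτ.1]⟩)
        (by rw [hZ]; exact hx.1.1.le) (by rw [hZ]; exact hx.1.2.le) (by rw [hV]; exact hx.2.1.le)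
      have h := axialPot_mem hω (hS J) hreg hK0 hK hε hclose hm ht (hB.isTraj hlin) hz
        (by simpa [hZ] using hx0)
      simp only [sub_self, sub_zero] at h
      have hz5 : |x 2| ≤ 5 * scale 0 := by
        have := scale_anti (Nat.zero_le J)
        exact abs_le.2 ⟨by linarith [hz.1], by linarith [hz.2]⟩
      rw [hZ, hV, pt_eta, initPot_eq_one (x := pt (Z t) (V t) (x 2)) z1 z2 z3 hz5, abs_le] at h
      constructor <;> linarith [h.1, h.2]

/-- A solution would have modes of size at least `0.9` at arbitrarily small scales, but bounded
vorticity makes the mode `J` of size `O(r_J)`. -/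
lemma not_isSolution {ω₁ : CcB2} {ε K : ℝ} (hK0 : 0 ≤ K)
    (hK : ∀ (J : ℕ) (c : ℕ → ℝ), (∀ k < J, |c k| ≤ 2) → ∀ x, |velA J c x| ≤ K ∧ |velB J c x| ≤ K)
    (hε : (1 + K) * (2 * K + 1) * ε ≤ 0.1)
    (hclose : ∀ n ≤ 1, ∀ x, ‖iteratedFDeriv ℝ n (ω₁.1 - initForm.1) x‖ < ε)
    (h0 : ∀ x : R3, x 0 ≤ 0 → ω₁.1 x = 0) :
    ¬ ∃ (ω : ℝ → R3 → Alt2) (u : ℝ → R3 → R3), IsSolution potentialOp 10 2 1 ω₁.1 ω u := by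
  rintro ⟨ω, u, h⟩
  have hreg := h.regularFamily
  have hc := fun J => (cascade h.initial (fun J => h.slabFlow h0 J) hreg hK0 hK hε hclose J).2
    (stageTime J) ⟨le_rfl, by rw [stageTime_succ]; linarith [scale_pos J]⟩
  obtain ⟨B, hB⟩ := hreg.bound
  set D := B * ∫ x, |sensor x| with hD
  have hle : ∀ J, 0.9 ≤ scale J * D := by
    intro J
    have hJ := scale_pos J
    have h1 := abs_sens_le (fun x => hB (stageTime J) ⟨stageTime_nonneg J, stageTime_le J⟩ x 0 2) J
    refine (hc J).trans ((le_abs_self _).trans ?_)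
    rw [mode, abs_mul, abs_mul, abs_of_pos (inv_pos.2 hJ)]
    calc (scale J)⁻¹ * |sens J (comp (ω (stageTime J)) 0 2)| * (scale J)⁻¹
        ≤ (scale J)⁻¹ * (scale J ^ 3 * D) * (scale J)⁻¹ := by gcongr
      _ = scale J * D := by field_simp
  have hlim : Tendsto (fun J => scale J * D) atTop (𝓝 (0 * D)) := tendsto_scale.mul_const D
  rw [zero_mul] at hlim
  have := ge_of_tendsto' hlim hle
  norm_num at this

end GenEuler
end

theorem theorem1p5 :
    ∃ A : VectorPotentialOp,
      IsReasonable 100 A ∧ ¬ FormallySelfAdjoint A ∧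
      ∃ ω₀ : CcB2,
        (¬ ∃ (ω : ℝ → R3 → Alt2) (u : ℝ → R3 → R3), IsSolution A 10 2 1 ω₀.1 ω u) ∧
        ∃ ε > (0 : ℝ), ∃ N : ℕ, ∀ ω₁ : CcB2,
          tsupport ω₁.1 ⊆ Metric.thickening ε (tsupport ω₀.1) →
          (∀ n ≤ N, ∀ x, ‖iteratedFDeriv ℝ n (ω₁.1 - ω₀.1) x‖ < ε) →
          ¬ ∃ (ω : ℝ → R3 → Alt2) (u : ℝ → R3 → R3), IsSolution A 10 2 1 ω₁.1 ω u := by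
  obtain ⟨K, hK0, hK⟩ := exists_vel_bound
  have hr := scale_pos 0
  have hC : 0 < (1 + K) * (2 * K + 1) := by positivity
  obtain ⟨ε, hε, hε1, hε2⟩ : ∃ ε > 0, (1 + K) * (2 * K + 1) * ε ≤ 0.1 ∧ ε ≤ scale 0 / 2 := by
    refine ⟨min (0.1 / ((1 + K) * (2 * K + 1))) (scale 0 / 2), by positivity, ?_, min_le_right _ _⟩
    calc (1 + K) * (2 * K + 1) * min (0.1 / ((1 + K) * (2 * K + 1))) (scale 0 / 2)
        ≤ (1 + K) * (2 * K + 1) * (0.1 / ((1 + K) * (2 * K + 1))) :=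
          mul_le_mul_of_nonneg_left (min_le_left _ _) hC.le
      _ = 0.1 := by field_simp
  have main : ∀ ω₁ : CcB2, tsupport ω₁.1 ⊆ Metric.thickening ε (tsupport initForm.1) →
      (∀ n ≤ 1, ∀ x, ‖iteratedFDeriv ℝ n (ω₁.1 - initForm.1) x‖ < ε) →
      ¬ ∃ (ω : ℝ → R3 → Alt2) (u : ℝ → R3 → R3), IsSolution potentialOp 10 2 1 ω₁.1 ω u := by
    intro ω₁ hsupp hclose
    refine not_isSolution hK0 hK hε1 hclose fun x hx => ?_
    by_contra hne
    obtain ⟨y, hy, hxy⟩ := Metric.mem_thickening_iff.1 (hsupp (subset_tsupport _ hne))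
    have h1 : scale 0 / 2 ≤ y 0 := tsupport_initForm_subset hy
    have h2 := abs_coord_le (x - y) 0
    rw [← dist_eq_norm] at h2
    have h3 := neg_abs_le ((x - y) 0)
    simp only [PiLp.sub_apply] at h2 h3
    linarith
  refine ⟨potentialOp, isReasonable_potentialOp, not_formallySelfAdjoint, initForm, ?_, ε, hε, 1, main⟩
  refine main initForm (Metric.self_subset_thickening hε _) fun n hn x => ?_
  rw [sub_self]
  interval_cases n
  · rw [norm_iteratedFDeriv_zero]
    simpa using hε
  · rw [norm_iteratedFDeriv_one]
    refine lt_of_le_of_lt (ContinuousLinearMap.opNorm_le_bound _ le_rfl fun y => ?_) hε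
    simp [fderiv_zero]
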